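/- **Conventions.** A *linearly compact* real Lie algebra is a real Lie algebra $\mathfrak g_0$ that is a Hausdorff topological vector space with continuous Lie bracket, in which every family of closed affine subspaces with the finite intersection property has nonempty intersection. Let $\mathfrak g=\mathbb C\otimes\mathfrak g_0$, with conjugation with respect to $\mathfrak g_0$. * A *contact pair* $(\mathfrak g_0,\mathfrak l_0)$: $\mathfrak g_0$ is linearly compact and $\mathfrak l_0$ is a closed subspace of finite codimension that generates $\mathfrak g_0$ as a Lie algebra. * A *transitive pair* $(\mathfrak g_0,\mathfrak i_0)$: $\mathfrak g_0$ is linearly compact and $\mathfrak i_0$ is a closed subalgebra of finite codimension that contains no nonzero ideal of $\mathfrak g_0$. * A *contact triple* $(\mathfrak g_0,\mathfrak i_0,\mathfrak l_0)$: $(\mathfrak g_0,\mathfrak l_0)$ is a contact pair, $(\mathfrak g_0,\mathfrak i_0)$ is a transitive pair, $\mathfrak i_0\subseteq\mathfrak l_0$ and $[\mathfrak i_0,\mathfrak l_0]\subseteq\mathfrak l_0$. * A *CR algebra* $(\mathfrak g_0,\mathfrak q)$: $\mathfrak q$ is a closed complex Lie subalgebra of $\mathfrak g$ such that $(\mathfrak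 g_0,\mathfrak q\cap\bar{\mathfrak q}\cap\mathfrak g_0)$ is a transitive pair. It is *fundamental* if $(\mathfrak g_0,(\mathfrak q+\bar{\mathfrak q})\cap\mathfrak g_0)$ is a contact pair. A contact triple $(\mathfrak g_0',\mathfrak i_0',\mathfrak l_0')$ *extends* $(\mathfrak g_0,\mathfrak i_0,\mathfrak l_0)$ through an injective Lie algebra homomorphism $\phi:\mathfrak g_0\to\mathfrak g_0'$ if $\phi(\mathfrak l_0)\subseteq\mathfrak l_0'$, $\phi(\mathfrak i_0)\subseteq\mathfrak i_0'$, and the induced maps $\mathfrak g_0/\mathfrak l_0\to\mathfrak g_0'/\mathfrak l_0'$ and $\mathfrak g_0/\mathfrak i_0\to\mathfrak g_0'/\mathfrak i_0'$ are bijective. A CR algebra $(\mathfrak g_0',\mathfrak q')$ *extends* $(\mathfrak g_0,\mathfrak q)$ through $\phi$ if $\phi(\mathfrak q)\subseteq\mathfrak q'$ and the induced maps $\mathfrak g_0/(\mathfrak q\cap\bar{\mathfrak q}\cap\mathfrak g_0)\to\mathfrak g_0'/(\mathfrak q'\cap\bar{\mathfrak q}'\cap\mathfrak g_0')$ and $\mathfrak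 g/\mathfrak q\to\mathfrak g'/\mathfrak q'$ are bijective. An object is *maximal* if each of its extensions is bijective. An extension $\phi$ of an object by $M$ is *greatest* if for every other extension $\phi'$ by some $T'$ there is exactly one $\psi$ through which $M$ extends $T'$ with $\psi\circ\phi'=\phi$, and this $\psi$ is continuous. *Formal vector fields.* Let $\mathfrak i_0$ be a subalgebra of finite codimension in $\mathfrak g_0$, $V$ a linear complement of $\mathfrak i_0$ in $\mathfrak g_0$, $\pi:\mathfrak g_0\to V$ the projection along $\mathfrak i_0$, $\mathcal F=\prod_{h\ge0}\mathrm{Sym}^h(V)$ the ring of formal power series on $V$, $\mathrm{Der}(\mathcal F)=\mathcal F\otimes V$ its Lie algebra of derivations, and $\frac{t}{1-e^{-t}}=\sum_h b_ht^h$. For $X\in\mathfrak g_0$ and $\varepsilon=\pm1$ define homogeneous polynomials $T_n$ of degree $n$ on $V$ with values in $\mathfrak g_0$ by $$T_n(v)=\varepsilon^n b_n\,\mathrm{ad}(v)^nX-\sum_{r=0}^{n-1}b_{r+1}\,\mathrm{ad}(v)^{r+1}\bigl((1-\pi)T_{n-1-r}(v)\bigr),$$ and let $L_X^*=\sum_n\pi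 T_n$ for $\varepsilon=1$, $R_X^*=\sum_n\pi T_n$ for $\varepsilon=-1$; both are in $\mathrm{Der}(\mathcal F)$, and $L^*$ is extended $\mathbb C$-linearly to $\mathfrak g$. The formal module of a subspace $\mathfrak l_0\subseteq\mathfrak g_0$ is the $\mathcal F$-submodule $\mathfrak l_0^*=\mathcal F\langle L_w^*\mid w\in V\cap\mathfrak l_0\rangle$ of $\mathrm{Der}(\mathcal F)$, and that of a complex subspace $\mathfrak q\subseteq\mathfrak g$ is the $\mathbb C\otimes\mathcal F$-submodule $\mathfrak q^*=(\mathbb C\otimes\mathcal F)\langle L_w^*\mid w\in V_{\mathbb C}\cap\mathfrak q\rangle$ of $\mathbb C\otimes\mathrm{Der}(\mathcal F)$. The stabilizer of $\mathfrak l_0^*$ (of $\mathfrak q^*$) consists of the $D\in\mathrm{Der}(\mathcal F)$ such that $[D,\cdot]$ maps the module into itself. **Proposition.** (1) Every contact triple $(\mathfrak g_0,\mathfrak i_0,\mathfrak l_0)$ has an extension that is a maximal contact triple and is greatest. Any two maximal contact triples extending it are isomorphic, by an isomorphism compatible with the embeddings of $\mathfrak g_0$. For every complement $V$ of $\mathfrak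 i_0$, a maximal and greatest extension $(\mathfrak g_0',\mathfrak i_0',\mathfrak l_0')$ is obtained as follows: $\mathfrak g_0'$ is the opposite Lie algebra of the stabilizer of $\mathfrak l_0^*$ in $\mathrm{Der}(\mathcal F)$, with the topology of convergence of all coefficients, $\phi(X)=R_X^*$, $\mathfrak i_0'=\{D\in\mathfrak g_0'\mid D(0)=0\}$ and $\mathfrak l_0'=\{D\in\mathfrak g_0'\mid D(0)=\Theta(0)\text{ for some }\Theta\in\mathfrak l_0^*\}$. (2) Every CR algebra $(\mathfrak g_0,\mathfrak q)$ has an extension that is a maximal CR algebra and is greatest. Any two maximal CR algebras extending it are isomorphic, by an isomorphism compatible with the embeddings of $\mathfrak g_0$. Every extension of a fundamental CR algebra is fundamental. For every complement $V$ of $\mathfrak i_0=\mathfrak q\cap\bar{\mathfrak q}\cap\mathfrak g_0$, a maximal and greatest extension $(\mathfrak g_0',\mathfrak q')$ is obtained as follows: $\mathfrak g_0'$ is the opposite Lie algebra of the stabilizer of $\mathfrak q^*$ in $\mathrm{Der}(\mathcal F)$, with the topology of convergence of all coefficients, $\phi(X)=R_X^*$, $\mathfrak q'=\{Z\in\mathbb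 C\otimes\mathfrak g_0'\mid Z(0)=\Theta(0)\text{ for some }\Theta\in\mathfrak q^*\}$, and $\mathfrak q'\cap\bar{\mathfrak q}'\cap\mathfrak g_0'=\{D\in\mathfrak g_0'\mid D(0)=0\}$. -/

import Mathlib

open scoped TensorProduct

universe u

noncomputable section

/-- A linearly compact topological real Lie algebra: a Hausdorff topological vector space over `ℝ`
with (jointly) continuous Lie bracket, in which every family of closed affine subspaces with the
finite intersection property has nonempty intersection. -/
structure IsLinearlyCompactLieAlgebra (L : Type u) [LieRing L] [LieAlgebra ℝ L]
    [TopologicalSpace L] : Prop where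
  t2 : T2Space L
  isTopologicalAddGroup : IsTopologicalAddGroup L
  continuousSMul : ContinuousSMul ℝ L
  continuous_lie : Continuous fun p : L × L => ⁅p.1, p.2⁆
  nonempty_sInter : ∀ 𝒜 : Set (AffineSubspace ℝ L),
    (∀ A ∈ 𝒜, IsClosed (A : Set L)) →
    (∀ S : Finset (AffineSubspace ℝ L), (S : Set (AffineSubspace ℝ L)) ⊆ 𝒜 →
      (⋂ A ∈ S, (A : Set L)).Nonempty) →
    (⋂ A ∈ 𝒜, (A : Set L)).Nonempty

/-- A contact pair `(L, l)`. -/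
structure IsContactPair (L : Type u) [LieRing L] [LieAlgebra ℝ L] [TopologicalSpace L]
    (l : Submodule ℝ L) : Prop where
  linearlyCompact : IsLinearlyCompactLieAlgebra L
  isClosed : IsClosed (l : Set L)
  finite_codim : FiniteDimensional ℝ (L ⧸ l)
  generates : LieSubalgebra.lieSpan ℝ L (l : Set L) = ⊤

/-- A transitive pair `(L, i)`. -/
structure IsTransitivePair (L : Type u) [LieRing L] [LieAlgebra ℝ L] [TopologicalSpace L]
    (i : LieSubalgebra ℝ L) : Prop where
  linearlyCompact : IsLinearlyCompactLieAlgebra L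
  isClosed : IsClosed (i : Set L)
  finite_codim : FiniteDimensional ℝ (L ⧸ i.toSubmodule)
  ideal_eq_bot : ∀ J : LieIdeal ℝ L, (J : Set L) ⊆ (i : Set L) → J = ⊥

/-- A contact triple `(𝔤, isot, dist)`. -/
structure ContactTriple : Type (u + 1) where
  𝔤 : Type u
  [lieRing : LieRing 𝔤]
  [lieAlgebra : LieAlgebra ℝ 𝔤]
  [topology : TopologicalSpace 𝔤]
  isot : LieSubalgebra ℝ 𝔤
  dist : Submodule ℝ 𝔤
  contactPair : IsContactPair 𝔤 dist
  transitivePair : IsTransitivePair 𝔤 isot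
  isot_le : isot.toSubmodule ≤ dist
  lie_mem : ∀ x ∈ isot, ∀ y ∈ dist, ⁅x, y⁆ ∈ dist

attribute [instance] ContactTriple.lieRing ContactTriple.lieAlgebra ContactTriple.topology

namespace ContactTriple

/-- `φ` exhibits `T'` as an extension of `T`. -/
structure IsExtension (T T' : ContactTriple.{u}) (φ : T.𝔤 →ₗ⁅ℝ⁆ T'.𝔤) : Prop where
  injective : Function.Injective φ
  dist_le : T.dist ≤ T'.dist.comap (φ : T.𝔤 →ₗ[ℝ] T'.𝔤)
  isot_le : T.isot.toSubmodule ≤ T'.isot.toSubmodule.comap (φ : T.𝔤 →ₗ[ℝ] T'.𝔤)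
  bijective_quot_dist :
    Function.Bijective (Submodule.mapQ T.dist T'.dist (φ : T.𝔤 →ₗ[ℝ] T'.𝔤) dist_le)
  bijective_quot_isot : Function.Bijective
    (Submodule.mapQ T.isot.toSubmodule T'.isot.toSubmodule (φ : T.𝔤 →ₗ[ℝ] T'.𝔤) isot_le)

/-- `T` has no proper extension. -/
def IsMaximal (T : ContactTriple.{u}) : Prop :=
  ∀ (T' : ContactTriple.{u}) (φ : T.𝔤 →ₗ⁅ℝ⁆ T'.𝔤), T.IsExtension T' φ → Function.Bijective φ

/-- `e` is an isomorphism of contact triples. -/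
def IsIso (T T' : ContactTriple.{u}) (e : T.𝔤 ≃ₗ⁅ℝ⁆ T'.𝔤) : Prop :=
  (∀ x, x ∈ T.isot ↔ e x ∈ T'.isot) ∧ (∀ x, x ∈ T.dist ↔ e x ∈ T'.dist)

/-- The extension `φ : T → M` is the greatest one: every extension of `T` is extended by `M`,
compatibly with the embeddings of `T`, in exactly one way, and that way is continuous. -/
def IsGreatest (T M : ContactTriple.{u}) (φ : T.𝔤 →ₗ⁅ℝ⁆ M.𝔤) : Prop :=
  ∀ (T' : ContactTriple.{u}) (φ' : T.𝔤 →ₗ⁅ℝ⁆ T'.𝔤), T.IsExtension T' φ' →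
    ∃ ψ : T'.𝔤 →ₗ⁅ℝ⁆ M.𝔤, T'.IsExtension M ψ ∧ (∀ x, ψ (φ' x) = φ x) ∧ Continuous ψ ∧
      ∀ ψ' : T'.𝔤 →ₗ⁅ℝ⁆ M.𝔤, T'.IsExtension M ψ' → (∀ x, ψ' (φ' x) = φ x) → ψ' = ψ

end ContactTriple

/-- For a complex subspace `q` of the complexification `ℂ ⊗ L`, the real Lie subalgebra
`q ∩ q̄ ∩ L`; as a real vector lies in `q` iff it lies in `q̄`, it is `q ∩ L`. -/
def realPoints {L : Type u} [LieRing L] [LieAlgebra ℝ L] (q : LieSubalgebra ℂ (ℂ ⊗[ℝ] L)) :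
    LieSubalgebra ℝ L where
  carrier := {x | (1 : ℂ) ⊗ₜ[ℝ] x ∈ q}
  zero_mem' := by simp
  add_mem' {x y} hx hy := by
    simp only [Set.mem_ofPred_eq, TensorProduct.tmul_add] at *
    exact q.add_mem hx hy
  smul_mem' r x hx := by
    simp only [Set.mem_ofPred_eq] at *
    have h := q.smul_mem (r : ℂ) hx
    rwa [TensorProduct.smul_tmul', smul_eq_mul, mul_one,
      show (r : ℂ) = r • (1 : ℂ) by simp, TensorProduct.smul_tmul] at h
  lie_mem' {x y} hx hy := by
    have h := q.lie_mem hx hy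
    simpa using h

/-- The real part `ℂ ⊗ L → L`. -/
def complexRealPart (L : Type u) [AddCommGroup L] [Module ℝ L] : ℂ ⊗[ℝ] L →ₗ[ℝ] L :=
  (TensorProduct.lid ℝ L).toLinearMap ∘ₗ LinearMap.rTensor L Complex.reLm

/-- The real subspace `{Re Z | Z ∈ q} = (q + q̄) ∩ L` of `L`. -/
def realParts {L : Type u} [LieRing L] [LieAlgebra ℝ L] (q : LieSubalgebra ℂ (ℂ ⊗[ℝ] L)) :
    Submodule ℝ L :=
  (q.toSubmodule.restrictScalars ℝ).map (complexRealPart L)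

/-- A CR algebra `(𝔤, q)`: `q` is a closed complex Lie subalgebra of the complexification of the
linearly compact real Lie algebra `𝔤`, and `(𝔤, q ∩ q̄ ∩ 𝔤)` is a transitive pair. The
complexification `ℂ ⊗ 𝔤 = 𝔤 ⊕ i𝔤` carries the topology of `𝔤 × 𝔤`. -/
structure CRAlgebra : Type (u + 1) where
  𝔤 : Type u
  [lieRing : LieRing 𝔤]
  [lieAlgebra : LieAlgebra ℝ 𝔤]
  [topology : TopologicalSpace 𝔤]
  q : LieSubalgebra ℂ (ℂ ⊗[ℝ] 𝔤)
  isClosed : IsClosed {p : 𝔤 × 𝔤 | (1 : ℂ) ⊗ₜ[ℝ] p.1 + Complex.I ⊗ₜ[ℝ] p.2 ∈ q}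
  transitivePair : IsTransitivePair 𝔤 (realPoints q)

attribute [instance] CRAlgebra.lieRing CRAlgebra.lieAlgebra CRAlgebra.topology

namespace CRAlgebra

/-- The CR algebra is fundamental: `(𝔤, (q + q̄) ∩ 𝔤)` is a contact pair. -/
def IsFundamental (T : CRAlgebra.{u}) : Prop :=
  IsContactPair T.𝔤 (realParts T.q)

/-- `φ` exhibits `T'` as an extension of `T`. -/
structure IsExtension (T T' : CRAlgebra.{u}) (φ : T.𝔤 →ₗ⁅ℝ⁆ T'.𝔤) : Prop where
  injective : Function.Injective φ
  q_le : T.q.toSubmodule ≤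
    T'.q.toSubmodule.comap (LinearMap.baseChange ℂ (φ : T.𝔤 →ₗ[ℝ] T'.𝔤))
  realPoints_le : (realPoints T.q).toSubmodule ≤
    (realPoints T'.q).toSubmodule.comap (φ : T.𝔤 →ₗ[ℝ] T'.𝔤)
  bijective_quot_realPoints : Function.Bijective
    (Submodule.mapQ (realPoints T.q).toSubmodule (realPoints T'.q).toSubmodule
      (φ : T.𝔤 →ₗ[ℝ] T'.𝔤) realPoints_le)
  bijective_quot_q : Function.Bijective
    (Submodule.mapQ T.q.toSubmodule T'.q.toSubmodule
      (LinearMap.baseChange ℂ (φ : T.𝔤 →ₗ[ℝ] T'.𝔤)) q_le)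

/-- `T` has no proper extension. -/
def IsMaximal (T : CRAlgebra.{u}) : Prop :=
  ∀ (T' : CRAlgebra.{u}) (φ : T.𝔤 →ₗ⁅ℝ⁆ T'.𝔤), T.IsExtension T' φ → Function.Bijective φ

/-- `e` is an isomorphism of CR algebras. -/
def IsIso (T T' : CRAlgebra.{u}) (e : T.𝔤 ≃ₗ⁅ℝ⁆ T'.𝔤) : Prop :=
  ∀ z, z ∈ T.q ↔ LinearMap.baseChange ℂ (e.toLinearEquiv : T.𝔤 →ₗ[ℝ] T'.𝔤) z ∈ T'.q

/-- The extension `φ : T → M` is the greatest one: every extension of `T` is extended by `M`,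
compatibly with the embeddings of `T`, in exactly one way, and that way is continuous. -/
def IsGreatest (T M : CRAlgebra.{u}) (φ : T.𝔤 →ₗ⁅ℝ⁆ M.𝔤) : Prop :=
  ∀ (T' : CRAlgebra.{u}) (φ' : T.𝔤 →ₗ⁅ℝ⁆ T'.𝔤), T.IsExtension T' φ' →
    ∃ ψ : T'.𝔤 →ₗ⁅ℝ⁆ M.𝔤, T'.IsExtension M ψ ∧ (∀ x, ψ (φ' x) = φ x) ∧ Continuous ψ ∧
      ∀ ψ' : T'.𝔤 →ₗ⁅ℝ⁆ M.𝔤, T'.IsExtension M ψ' → (∀ x, ψ' (φ' x) = φ x) → ψ' = ψ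

end CRAlgebra

/-- The coefficients `b_h` of `t / (1 - exp (-t)) = ∑ b_h t ^ h`; Mathlib's `bernoulli'` are the
Bernoulli numbers with `bernoulli' 1 = 1 / 2`. -/
def bchCoeff (h : ℕ) : ℝ := (bernoulli' h : ℝ) / (Nat.factorial h : ℝ)

/-- A finite dimensional linear complement `V` of the subalgebra `i` in `L`, with a basis. -/
structure FormalChart {L : Type u} [LieRing L] [LieAlgebra ℝ L] (i : LieSubalgebra ℝ L) :
    Type (u + 1) where
  V : Submodule ℝ L
  isCompl : IsCompl V i.toSubmodule
  ι : Type u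
  [fintype : Fintype ι]
  basis : Module.Basis ι ℝ V

attribute [instance] FormalChart.fintype

namespace FormalChart

variable {L : Type u} [LieRing L] [LieAlgebra ℝ L] {i : LieSubalgebra ℝ L} (c : FormalChart i)

/-- The ring `∏_h Sym^h(V)` of real formal power series on `V`, written in the coordinates of the
basis. -/
abbrev F : Type u := MvPowerSeries c.ι ℝ

/-- The Lie algebra and `F`-module `Der(F) = F ⊗ V` of formal vector fields on `V`. -/
abbrev Der : Type u := Derivation ℝ c.F c.F

/-- Polynomial maps `V → L`. -/
abbrev PolyMap : Type u := MvPolynomial c.ι ℝ ⊗[ℝ] L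

/-- The generic point `𝐯` of `V`, that is the inclusion `V → L` as a polynomial map. -/
def generic : c.PolyMap := ∑ k, MvPolynomial.X k ⊗ₜ[ℝ] (c.basis k : L)

/-- `ad(𝐯)` on polynomial maps `V → L`. -/
def adGeneric : c.PolyMap →ₗ[ℝ] c.PolyMap := LieAlgebra.ad ℝ c.PolyMap c.generic

/-- The `V`-coordinates of the projection `L → V` along `i`. -/
def coord (k : c.ι) : L →ₗ[ℝ] ℝ :=
  c.basis.coord k ∘ₗ c.V.projectionOnto i.toSubmodule c.isCompl

/-- The `i`-component `x ↦ x - π x` of elements of `L`, where `π` is the projection onto `V`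
along `i`. -/
def isotPart : L →ₗ[ℝ] L :=
  LinearMap.id - c.V.subtype ∘ₗ c.V.projectionOnto i.toSubmodule c.isCompl

/-- The homogeneous terms `T_n(X) = x_n + h_n`, with `x_n ∈ Sym^n(V, V)` and
`h_n ∈ Sym^n(V, i)`, given by `T_0(X) = X` and
`T_n(X) = ε^n b_n ad(𝐯)^n X - ∑_{r < n} b_{r + 1} ad(𝐯)^{r + 1} h_{n - 1 - r}`. -/
def term (ε : ℝ) : ℕ → (L →ₗ[ℝ] c.PolyMap)
  | n => (ε ^ n * bchCoeff n) • ((c.adGeneric ^ n) ∘ₗ TensorProduct.mk ℝ (MvPolynomial c.ι ℝ) L 1)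
      - ∑ r : Fin n, bchCoeff (r + 1) •
          ((c.adGeneric ^ ((r : ℕ) + 1)) ∘ₗ
            LinearMap.lTensor (MvPolynomial c.ι ℝ) c.isotPart ∘ₗ term ε (n - 1 - r))
  termination_by n => n
  decreasing_by omega

/-- The `k`-th coordinate, as a polynomial, of the `V`-component `x_n` of `T_n(X)`. -/
def termCoord (ε : ℝ) (k : c.ι) (n : ℕ) : L →ₗ[ℝ] MvPolynomial c.ι ℝ :=
  (TensorProduct.rid ℝ (MvPolynomial c.ι ℝ)).toLinearMap ∘ₗ
    LinearMap.lTensor (MvPolynomial c.ι ℝ) (c.coord k) ∘ₗ c.term ε n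

/-- The `k`-th coordinate of the formal series `∑_n x_n`; the polynomial `x_n` being homogeneous of
degree `n`, the coefficient of a monomial `d` comes from `n = |d|`. -/
def series (ε : ℝ) (k : c.ι) (X : L) : c.F :=
  fun d => MvPolynomial.coeff d (c.termCoord ε k d.degree X)

/-- The formal vector field `∑_n x_n` attached to `X`. -/
def field (ε : ℝ) : L →ₗ[ℝ] c.Der where
  toFun X := ∑ k, c.series ε k X • MvPowerSeries.pderiv ℝ k
  map_add' X Y := by
    rw [← Finset.sum_add_distrib]
    refine Finset.sum_congr rfl fun k _ => ?_
    rw [← add_smul]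
    congr 1
    funext d
    simp only [series, map_add, MvPolynomial.coeff_add]
    rfl
  map_smul' r X := by
    rw [RingHom.id_apply, Finset.smul_sum]
    refine Finset.sum_congr rfl fun k _ => ?_
    rw [← smul_assoc]
    congr 1
    funext d
    simp only [series, map_smul, MvPolynomial.coeff_smul]
    rfl

/-- `L*_X`, defined by `exp(v) exp(tX) = exp(v + t L*_X(v) + O(t²)) exp(t H(v) + O(t²))`. -/
def leftField : L →ₗ[ℝ] c.Der := c.field 1

/-- `R*_X`, defined by `exp(tX) exp(v) = exp(v + t R*_X(v) + O(t²)) exp(t H'(v) + O(t²))`. -/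
def rightField : L →ₗ[ℝ] c.Der := c.field (-1)

/-- The value at `0 ∈ V` of a formal vector field, as an element of `V ⊆ L`. -/
def value : c.Der →ₗ[ℝ] L where
  toFun D := ∑ k, MvPowerSeries.constantCoeff (D (MvPowerSeries.X k)) • (c.basis k : L)
  map_add' D E := by simp [add_smul, Finset.sum_add_distrib]
  map_smul' r D := by simp [Finset.smul_sum, mul_smul]

/-- The formal module `l* = F ⊗ ⟨L*_w | w ∈ V ∩ l⟩` of a real subspace `l` of `L`. -/
def formalModule (l : Submodule ℝ L) : Submodule c.F c.Der :=
  Submodule.span c.F (c.leftField '' {w | w ∈ c.V ∧ w ∈ l})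

/-- The formal module `q* = (ℂ ⊗ F) ⊗ ⟨L*_w | w ∈ V_ℂ ∩ q⟩` of a complex subspace `q` of `ℂ ⊗ L`,
with `L*` extended by `ℂ`-linearity: the `ℂ`-span in `ℂ ⊗ Der(F)` of all `f L*_w` with `f ∈ F`,
which is the `ℂ ⊗ F`-submodule generated by the `L*_w`. -/
def complexFormalModule (q : Submodule ℂ (ℂ ⊗[ℝ] L)) : Submodule ℂ (ℂ ⊗[ℝ] c.Der) :=
  Submodule.span ℂ {Θ | ∃ (f : c.F) (w : ℂ ⊗[ℝ] L), w ∈ c.V.baseChange ℂ ∧ w ∈ q ∧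
    Θ = LinearMap.baseChange ℂ ((LinearMap.lsmul c.F c.Der f).restrictScalars ℝ) (LinearMap.baseChange ℂ c.leftField w)}

/-- The stabilizer in `Der(F)` of a module of formal vector fields. -/
def stabilizer (m : Submodule c.F c.Der) : LieSubalgebra ℝ c.Der where
  carrier := {D | ∀ Θ ∈ m, ⁅D, Θ⁆ ∈ m}
  zero_mem' Θ _ := by
    rw [show ⁅(0 : c.Der), Θ⁆ = 0 from zero_lie Θ]
    exact m.zero_mem
  add_mem' {D E} hD hE Θ hΘ := by
    rw [show ⁅D + E, Θ⁆ = ⁅D, Θ⁆ + ⁅E, Θ⁆ from add_lie D E Θ]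
    exact m.add_mem (hD Θ hΘ) (hE Θ hΘ)
  smul_mem' r D hD Θ hΘ := by
    rw [show ⁅r • D, Θ⁆ = r • ⁅D, Θ⁆ from smul_lie r D Θ]
    exact m.smul_of_tower_mem r (hD Θ hΘ)
  lie_mem' {D E} hD hE Θ hΘ := by
    rw [show ⁅⁅D, E⁆, Θ⁆ = ⁅D, ⁅E, Θ⁆⁆ - ⁅E, ⁅D, Θ⁆⁆ from lie_lie D E Θ]
    exact m.sub_mem (hD _ (hE Θ hΘ)) (hE _ (hD Θ hΘ))

/-- The Lie bracket `Θ ↦ [D, Θ]` of formal vector fields, as a linear map depending linearly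
on `D`. -/
def bracket : c.Der →ₗ[ℝ] c.Der →ₗ[ℝ] c.Der :=
  LinearMap.mk₂ ℝ (fun D Θ => ⁅D, Θ⁆)
    (fun D E Θ => add_lie D E Θ) (fun r D Θ => smul_lie r D Θ)
    (fun D Θ Ψ => lie_add D Θ Ψ) (fun r D Θ => lie_smul r D Θ)

/-- The stabilizer in `Der(F)` of a complex subspace `m` of `ℂ ⊗ Der(F)`: those `D` for which the
`ℂ`-linear extension of `[D, ·]` maps `m` into itself. -/
def complexStabilizer (m : Submodule ℂ (ℂ ⊗[ℝ] c.Der)) : LieSubalgebra ℝ c.Der where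
  carrier := {D | ∀ Θ ∈ m, LinearMap.baseChange ℂ (c.bracket D) Θ ∈ m}
  zero_mem' Θ _ := by simp
  add_mem' {D E} hD hE Θ hΘ := by
    rw [map_add, LinearMap.baseChange_add]
    exact m.add_mem (hD Θ hΘ) (hE Θ hΘ)
  smul_mem' r D hD Θ hΘ := by
    rw [map_smul, LinearMap.baseChange_smul]
    exact m.smul_of_tower_mem r (hD Θ hΘ)
  lie_mem' {D E} hD hE Θ hΘ := by
    have h : c.bracket ⁅D, E⁆ =
        c.bracket D ∘ₗ c.bracket E - c.bracket E ∘ₗ c.bracket D :=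
      LinearMap.ext fun Ψ => lie_lie D E Ψ
    rw [h, LinearMap.baseChange_sub, LinearMap.baseChange_comp, LinearMap.baseChange_comp]
    exact m.sub_mem (hD _ (hE Θ hΘ)) (hE _ (hD Θ hΘ))

/-- `e` identifies the topological Lie algebra `M` with the opposite of the Lie algebra `S` of
formal vector fields, topologized by convergence of all the coefficients. -/
structure IsOpposite (S : LieSubalgebra ℝ c.Der) {M : Type u} [LieRing M] [LieAlgebra ℝ M]
    [TopologicalSpace M] (e : M →ₗ[ℝ] c.Der) : Prop where
  injective : Function.Injective e
  range_eq : LinearMap.range e = S.toSubmodule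
  map_lie : ∀ x y, e ⁅x, y⁆ = ⁅e y, e x⁆
  isInducing : Topology.IsInducing fun (x : M) (p : c.ι × (c.ι →₀ ℕ)) =>
    MvPowerSeries.coeff p.2 (e x (MvPowerSeries.X p.1))

end FormalChart

end

noncomputable section

set_option linter.unusedSectionVars false

/-! Think of V as a formal slice v ↦ exp(v) of the homogeneous space of cosets of the isotropy
subalgebra i. Its left Maurer–Cartan form is θ = α(ad v)dv with α(t) = (1 - e^{-t})/t. The recursion
for T_n says precisely that x + β(ad v)h = β(ε ad v)X, where x and h are the V- and i-parts of ∑ T_n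
and β(t) = t/(1 - e^{-t}). Since α(t)β(t) = 1 and α(t)β(-t) = e^{-t}, this gives θ(L*_X) = X and
θ(R*_X) = e^{-ad v}X up to i-valued series (`thetaOf_leftField`, `thetaOf_rightField`). So L*_X is
the trace of a left-invariant field and R*_X that of a right-invariant one.

The V-part ω of θ is a formal coframe (`eq_zero_of_omega_eq_zero`). The formal module of a subspace
consists of the fields on which ω takes values in that subspace. The structure equation
`thetaOf_lie` then shows that X ↦ R*_X reverses brackets and that ω[R*_X, L*_w] is, up to sign, the
projection of the bracket of an i-valued series with w. As [i, l] ⊆ l (respectively, as q is a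
subalgebra containing i), every R*_X stabilizes the formal module. The kernel of R* is an ideal
inside i, so R* is injective by transitivity.

The opposite of the stabilizer is again an object of the same kind. It is closed in the product of
lines Der(F), hence linearly compact. It is transitive because a family of fields vanishing at 0 and
stable under bracket with all R*_X vanishes to infinite order (`eq_zero_of_lie_rightField_mem`). It
is an extension because R*_X(0) = πX.

Universality comes from naturality. An extension carries the chart V to a chart of the larger object
with the same coordinates, and the formal fields, formal module and stabilizer do not change
(`transport_field`, `IsModel.push`). So one model serves every extension T', and y ↦ R*_y embeds T'
in it. Any other compatible embedding must produce the same formal fields and therefore agrees with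
this one (`hom_ext`). A greatest extension is maximal by formal nonsense, and every maximal
extension maps bijectively to it, which yields uniqueness.

The CR case is the same argument after complexification. The one new point is that q' is closed
under brackets (`complexValue_ad_mem`). -/

/-- Formal power series in the variables `ι` with coefficients in a vector space `M`. -/
def VSeries (ι : Type*) (M : Type*) := (ι →₀ ℕ) → M

/-! ### Formal power series with coefficients in a vector space or a Lie algebra. -/

namespace VSeries

open Finset hiding antidiagonal mem_antidiagonal
open Finset.HasAntidiagonal (antidiagonal mem_antidiagonal)
open scoped Classical

variable {ι M N P Q : Type*} [AddCommGroup M] [Module ℝ M] [AddCommGroup N] [Module ℝ N]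
  [AddCommGroup P] [Module ℝ P] [AddCommGroup Q] [Module ℝ Q]

instance : AddCommGroup (VSeries ι M) := inferInstanceAs (AddCommGroup ((ι →₀ ℕ) → M))

instance : Module ℝ (VSeries ι M) := inferInstanceAs (Module ℝ ((ι →₀ ℕ) → M))

/-- The power series with given coefficients. -/
def mk (f : (ι →₀ ℕ) → M) : VSeries ι M := f

@[ext] theorem ext {a b : VSeries ι M} (h : ∀ d, a d = b d) : a = b := funext h

@[simp] theorem mk_apply (f : (ι →₀ ℕ) → M) (d) : mk f d = f d := rfl
@[simp] theorem add_apply (a b : VSeries ι M) (d) : (a + b) d = a d + b d := rfl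
@[simp] theorem sub_apply (a b : VSeries ι M) (d) : (a - b) d = a d - b d := rfl
@[simp] theorem neg_apply (a : VSeries ι M) (d) : (-a) d = -a d := rfl
@[simp] theorem zero_apply (d) : (0 : VSeries ι M) d = 0 := rfl
@[simp] theorem smul_apply (r : ℝ) (a : VSeries ι M) (d) : (r • a) d = r • a d := rfl

/-- The coefficient of a monomial. -/
def coeff (d : ι →₀ ℕ) : VSeries ι M →ₗ[ℝ] M where
  toFun a := a d
  map_add' _ _ := rfl
  map_smul' _ _ := rfl

@[simp] theorem coeff_apply (d : ι →₀ ℕ) (a : VSeries ι M) : coeff d a = a d := rfl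

@[simp] theorem sum_apply {κ : Type*} (s : Finset κ) (a : κ → VSeries ι M) (d) :
    (∑ k ∈ s, a k) d = ∑ k ∈ s, a k d :=
  map_sum (coeff d) a s

/-- Coefficientwise application of a linear map. -/
def map (f : M →ₗ[ℝ] N) : VSeries ι M →ₗ[ℝ] VSeries ι N where
  toFun a := mk fun d => f (a d)
  map_add' a b := by ext d; simp
  map_smul' r a := by ext d; simp

@[simp] theorem map_apply (f : M →ₗ[ℝ] N) (a : VSeries ι M) (d) : map f a d = f (a d) := rfl

/-- A power series with real coefficients. -/
def ofMv : MvPowerSeries ι ℝ →ₗ[ℝ] VSeries ι ℝ where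
  toFun f := mk fun d => MvPowerSeries.coeff d f
  map_add' a b := by ext d; simp
  map_smul' r a := by ext d; simp

@[simp] theorem ofMv_apply (f : MvPowerSeries ι ℝ) (d) : ofMv f d = MvPowerSeries.coeff d f := rfl

section Conv

/-- The product of power series induced by a bilinear map of the coefficients. -/
def conv (B : M →ₗ[ℝ] N →ₗ[ℝ] P) : VSeries ι M →ₗ[ℝ] VSeries ι N →ₗ[ℝ] VSeries ι P :=
  LinearMap.mk₂ ℝ (fun a b => mk fun d => ∑ p ∈ antidiagonal d, B (a p.1) (b p.2))
    (fun a a' b => by ext d; simp [sum_add_distrib])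
    (fun r a b => by ext d; simp [smul_sum])
    (fun a b b' => by ext d; simp [sum_add_distrib])
    (fun r a b => by ext d; simp [smul_sum])

theorem conv_apply (B : M →ₗ[ℝ] N →ₗ[ℝ] P) (a : VSeries ι M) (b : VSeries ι N) (d) :
    conv B a b d = ∑ p ∈ antidiagonal d, B (a p.1) (b p.2) := rfl

theorem conv_flip (B : M →ₗ[ℝ] N →ₗ[ℝ] P) (a : VSeries ι M) (b : VSeries ι N) :
    conv B.flip b a = conv B a b := by
  ext d
  rw [conv_apply, conv_apply]
  exact sum_nbij' Prod.swap Prod.swap (by simp [add_comm]) (by simp [add_comm]) (by simp)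
    (by simp) (by simp)

theorem sum_antidiagonal_fst (d : ι →₀ ℕ) (g : (ι →₀ ℕ) → (ι →₀ ℕ) → (ι →₀ ℕ) → P) :
    ∑ p ∈ antidiagonal d, ∑ q ∈ antidiagonal p.1, g q.1 q.2 p.2 =
      ∑ p ∈ antidiagonal d, ∑ q ∈ antidiagonal p.2, g p.1 q.1 q.2 := by
  rw [sum_sigma', sum_sigma']
  refine sum_nbij' (fun x => ⟨(x.2.1, x.2.2 + x.1.2), (x.2.2, x.1.2)⟩)
    (fun x => ⟨(x.1.1 + x.2.1, x.2.2), (x.1.1, x.2.1)⟩) ?_ ?_ ?_ ?_ ?_ <;>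
    rintro ⟨⟨a, b⟩, ⟨e, f⟩⟩ h <;> simp only [mem_sigma, mem_antidiagonal] at h <;>
    obtain ⟨h1, h2⟩ := h <;> subst h1 <;> subst h2 <;> simp [add_assoc]

theorem sum_antidiagonal_swap (d : ι →₀ ℕ)
    (g : (ι →₀ ℕ) → (ι →₀ ℕ) → (ι →₀ ℕ) → P) :
    ∑ p ∈ antidiagonal d, ∑ q ∈ antidiagonal p.2, g q.1 p.1 q.2 =
      ∑ p ∈ antidiagonal d, ∑ q ∈ antidiagonal p.2, g p.1 q.1 q.2 := by
  rw [sum_sigma', sum_sigma']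
  refine sum_nbij' (fun x => ⟨(x.2.1, x.1.1 + x.2.2), (x.1.1, x.2.2)⟩)
    (fun x => ⟨(x.2.1, x.1.1 + x.2.2), (x.1.1, x.2.2)⟩) ?_ ?_ ?_ ?_ ?_ <;>
    rintro ⟨⟨a, b⟩, ⟨e, f⟩⟩ h <;> simp only [mem_sigma, mem_antidiagonal] at h <;>
    obtain ⟨h1, h2⟩ := h <;> subst h1 <;> subst h2 <;> simp [add_left_comm]

variable {R : Type*} [AddCommGroup R] [Module ℝ R]

theorem conv_conv_right (B : M →ₗ[ℝ] Q →ₗ[ℝ] P) (B₁ : N →ₗ[ℝ] R →ₗ[ℝ] Q)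
    (a : VSeries ι M) (b : VSeries ι N) (c : VSeries ι R) (d) :
    conv B a (conv B₁ b c) d =
      ∑ p ∈ antidiagonal d, ∑ q ∈ antidiagonal p.2, B (a p.1) (B₁ (b q.1) (c q.2)) := by
  simp only [conv_apply, map_sum]

theorem conv_conv_left (B : Q →ₗ[ℝ] R →ₗ[ℝ] P) (B₁ : M →ₗ[ℝ] N →ₗ[ℝ] Q)
    (a : VSeries ι M) (b : VSeries ι N) (c : VSeries ι R) (d) :
    conv B (conv B₁ a b) c d =
      ∑ p ∈ antidiagonal d, ∑ q ∈ antidiagonal p.2, B (B₁ (a p.1) (b q.1)) (c q.2) := by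
  rw [← sum_antidiagonal_fst d fun x y z => B (B₁ (a x) (b y)) (c z)]
  simp only [conv_apply, map_sum, LinearMap.sum_apply]

theorem conv_conv_mid (B : N →ₗ[ℝ] Q →ₗ[ℝ] P) (B₁ : M →ₗ[ℝ] R →ₗ[ℝ] Q)
    (a : VSeries ι M) (b : VSeries ι N) (c : VSeries ι R) (d) :
    conv B b (conv B₁ a c) d =
      ∑ p ∈ antidiagonal d, ∑ q ∈ antidiagonal p.2, B (b q.1) (B₁ (a p.1) (c q.2)) := by
  rw [conv_conv_right, ← sum_antidiagonal_swap d fun x y z => B (b y) (B₁ (a x) (c z))]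

/-- An associativity-type identity between bilinear maps of coefficients passes to the products of
series. This lemma and `conv_left_comm` give the module axiom and the linearity of all products over
scalar series. -/
theorem conv_assoc {Q' : Type*} [AddCommGroup Q'] [Module ℝ Q'] {B : Q →ₗ[ℝ] R →ₗ[ℝ] P}
    {B₁ : M →ₗ[ℝ] N →ₗ[ℝ] Q} {B₂ : M →ₗ[ℝ] Q' →ₗ[ℝ] P} {B₃ : N →ₗ[ℝ] R →ₗ[ℝ] Q'}
    (h : ∀ x y z, B (B₁ x y) z = B₂ x (B₃ y z))
    (a : VSeries ι M) (b : VSeries ι N) (c : VSeries ι R) :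
    conv B (conv B₁ a b) c = conv B₂ a (conv B₃ b c) := by
  ext d
  simp only [conv_conv_left, conv_conv_right, h]

theorem conv_left_comm {Q' : Type*} [AddCommGroup Q'] [Module ℝ Q'] {B : M →ₗ[ℝ] Q →ₗ[ℝ] P}
    {B₁ : N →ₗ[ℝ] R →ₗ[ℝ] Q} {B₂ : N →ₗ[ℝ] Q' →ₗ[ℝ] P} {B₃ : M →ₗ[ℝ] R →ₗ[ℝ] Q'}
    (h : ∀ x y z, B x (B₁ y z) = B₂ y (B₃ x z))
    (a : VSeries ι M) (b : VSeries ι N) (c : VSeries ι R) :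
    conv B a (conv B₁ b c) = conv B₂ b (conv B₃ a c) := by
  ext d
  simp only [conv_conv_right B, conv_conv_mid B₂, h]

end Conv

section Monomial

/-- The monomial with a given coefficient. -/
def monomial (e : ι →₀ ℕ) (x : M) : VSeries ι M := mk (Pi.single e x)

theorem monomial_apply (e : ι →₀ ℕ) (x : M) (d) : monomial e x d = if d = e then x else 0 := by
  simp [monomial, Pi.single_apply]

/-- The constant power series. -/
def const : M →ₗ[ℝ] VSeries ι M where
  toFun := monomial 0
  map_add' x y := by ext d; simp only [monomial_apply, add_apply]; split_ifs <;> simp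
  map_smul' r x := by ext d; simp [monomial_apply]

@[simp] theorem const_zero_apply (x : M) : const (ι := ι) x 0 = x := by
  simp [const, monomial_apply]

theorem const_apply_of_ne (x : M) {d : ι →₀ ℕ} (h : d ≠ 0) : const x d = 0 := by
  simp [const, monomial_apply, h]

@[simp] theorem conv_const_left (B : M →ₗ[ℝ] N →ₗ[ℝ] P) (x : M) (b : VSeries ι N) :
    conv B (const x) b = map (B x) b := by
  ext d
  rw [conv_apply, sum_eq_single (0, d)]
  · simp
  · rintro ⟨p, q⟩ h hne
    rw [const_apply_of_ne, map_zero, LinearMap.zero_apply]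
    rintro rfl
    simp_all
  · simp

end Monomial

section Module

instance : SMul (MvPowerSeries ι ℝ) (VSeries ι M) :=
  ⟨fun f a => conv (LinearMap.lsmul ℝ M) (ofMv f) a⟩

theorem mv_smul_def (f : MvPowerSeries ι ℝ) (a : VSeries ι M) :
    f • a = conv (LinearMap.lsmul ℝ M) (ofMv f) a := rfl

theorem mv_smul_apply (f : MvPowerSeries ι ℝ) (a : VSeries ι M) (d) :
    (f • a) d = ∑ p ∈ antidiagonal d, MvPowerSeries.coeff p.1 f • a p.2 := by
  rfl

theorem ofMv_mul (f g : MvPowerSeries ι ℝ) :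
    ofMv (f * g) = conv (LinearMap.mul ℝ ℝ) (ofMv f) (ofMv g) := by
  ext d
  rw [ofMv_apply, MvPowerSeries.coeff_mul, conv_apply]
  rfl

theorem ofMv_one : ofMv (1 : MvPowerSeries ι ℝ) = const 1 := by
  ext d
  simp [MvPowerSeries.coeff_one, const, monomial_apply]

instance : Module (MvPowerSeries ι ℝ) (VSeries ι M) where
  one_smul a := by rw [mv_smul_def, ofMv_one, conv_const_left]; ext d; simp
  mul_smul f g a := by
    simp only [mv_smul_def, ofMv_mul]
    exact conv_assoc (fun x y z => mul_smul x y z) _ _ _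
  smul_zero f := by simp [mv_smul_def]
  smul_add f a b := by simp [mv_smul_def]
  add_smul f g a := by simp [mv_smul_def]
  zero_smul a := by simp [mv_smul_def]

theorem conv_smul_left (B : M →ₗ[ℝ] N →ₗ[ℝ] P) (f : MvPowerSeries ι ℝ) (a : VSeries ι M)
    (b : VSeries ι N) : conv B (f • a) b = f • conv B a b :=
  conv_assoc (fun x y z => by simp) _ _ _

theorem conv_smul_right (B : M →ₗ[ℝ] N →ₗ[ℝ] P) (f : MvPowerSeries ι ℝ) (a : VSeries ι M)
    (b : VSeries ι N) : conv B a (f • b) = f • conv B a b :=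
  conv_left_comm (fun x y z => by simp) _ _ _

theorem map_mv_smul (g : M →ₗ[ℝ] N) (f : MvPowerSeries ι ℝ) (a : VSeries ι M) :
    map g (f • a) = f • map g a := by
  ext d
  simp [mv_smul_apply]

theorem mv_smul_const (f : MvPowerSeries ι ℝ) (x : M) (d) :
    (f • const x : VSeries ι M) d = MvPowerSeries.coeff d f • x := by
  rw [mv_smul_def, ← conv_flip, conv_const_left]
  simp

instance : IsScalarTower ℝ (MvPowerSeries ι ℝ) (VSeries ι M) where
  smul_assoc r f a := by simp [mv_smul_def]

instance : SMulCommClass ℝ (MvPowerSeries ι ℝ) (VSeries ι M) where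
  smul_comm r f a := by simp [mv_smul_def]

end Module

section Derivatives

/-- The partial derivatives. -/
def deriv (k : ι) : VSeries ι M →ₗ[ℝ] VSeries ι M where
  toFun a := mk fun d => (d k + 1 : ℝ) • a (d + Finsupp.single k 1)
  map_add' a b := by ext d; simp
  map_smul' r a := by ext d; simp [smul_comm r]

theorem deriv_apply (k : ι) (a : VSeries ι M) (d) :
    deriv k a d = (d k + 1 : ℝ) • a (d + Finsupp.single k 1) := rfl

/-- Raising the first exponent by one is a bijection onto the pairs whose k-th exponent is nonzero,
and the remaining pairs carry the factor zero. With it, the Leibniz rule reduces to additivity of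
the k-th exponent. -/
theorem sum_antidiagonal_add_single (k : ι) (d : ι →₀ ℕ)
    (g : (ι →₀ ℕ) → (ι →₀ ℕ) → M) :
    ∑ p ∈ antidiagonal (d + Finsupp.single k 1), ((p.1 : ι →₀ ℕ) k : ℝ) • g p.1 p.2 =
      ∑ p ∈ antidiagonal d, ((p.1 : ι →₀ ℕ) k + 1 : ℝ) • g (p.1 + Finsupp.single k 1) p.2 := by
  symm
  refine sum_of_injOn (fun p => (p.1 + Finsupp.single k 1, p.2)) ?_ ?_ ?_ ?_
  · rintro ⟨p, q⟩ _ ⟨p', q'⟩ _ h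
    simpa using h
  · rintro ⟨p, q⟩ h
    simp only [mem_coe, mem_antidiagonal] at h ⊢
    rw [← h]; abel
  · rintro ⟨p, q⟩ h hn
    by_cases hp : p k = 0
    · simp [hp]
    · exfalso
      apply hn
      have hle : Finsupp.single k 1 ≤ p := by
        rw [Finsupp.single_le_iff]; omega
      refine ⟨(p - Finsupp.single k 1, q), ?_, ?_⟩
      · simp only [mem_coe, mem_antidiagonal] at h ⊢
        have : p - Finsupp.single k 1 + q + Finsupp.single k 1 = d + Finsupp.single k 1 := by
          rw [← h, add_right_comm, tsub_add_cancel_of_le hle]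
        exact add_right_cancel this
      · simp [tsub_add_cancel_of_le hle]
  · rintro ⟨p, q⟩ _
    simp

theorem conv_deriv_left_apply (B : M →ₗ[ℝ] N →ₗ[ℝ] P) (k : ι) (a : VSeries ι M)
    (b : VSeries ι N) (d : ι →₀ ℕ) :
    conv B (deriv k a) b d =
      ∑ p ∈ antidiagonal (d + Finsupp.single k 1), ((p.1 : ι →₀ ℕ) k : ℝ) • B (a p.1) (b p.2) := by
  rw [sum_antidiagonal_add_single k d fun x y => B (a x) (b y), conv_apply]
  simp only [deriv_apply, map_smul, LinearMap.smul_apply]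

theorem deriv_conv (B : M →ₗ[ℝ] N →ₗ[ℝ] P) (k : ι) (a : VSeries ι M) (b : VSeries ι N) :
    deriv k (conv B a b) = conv B (deriv k a) b + conv B a (deriv k b) := by
  ext d
  rw [add_apply, ← conv_flip B a (deriv k b), conv_deriv_left_apply, conv_deriv_left_apply,
    deriv_apply, conv_apply]
  have : ∑ p ∈ antidiagonal (d + Finsupp.single k 1), ((p.1 : ι →₀ ℕ) k : ℝ) • B.flip (b p.1) (a p.2) =
      ∑ p ∈ antidiagonal (d + Finsupp.single k 1), ((p.2 : ι →₀ ℕ) k : ℝ) • B (a p.1) (b p.2) :=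
    sum_nbij' Prod.swap Prod.swap (by simp [add_comm]) (by simp [add_comm]) (by simp)
      (by simp) (by simp)
  rw [this, ← sum_add_distrib, smul_sum]
  refine sum_congr rfl ?_
  rintro ⟨p, q⟩ h
  rw [mem_antidiagonal] at h
  rw [← add_smul]
  congr 1
  have := DFunLike.congr_fun h k
  simp only [Finsupp.add_apply, Finsupp.single_eq_same] at this
  exact_mod_cast this.symm

/-- The Euler derivation, multiplying each monomial by its degree. -/
def euler : VSeries ι M →ₗ[ℝ] VSeries ι M where
  toFun a := mk fun d => (d.degree : ℝ) • a d
  map_add' a b := by ext d; simp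
  map_smul' r a := by ext d; simp [smul_comm r]

@[simp] theorem euler_apply (a : VSeries ι M) (d) : euler a d = (d.degree : ℝ) • a d := rfl

theorem euler_conv (B : M →ₗ[ℝ] N →ₗ[ℝ] P) (a : VSeries ι M) (b : VSeries ι N) :
    euler (conv B a b) = conv B (euler a) b + conv B a (euler b) := by
  ext d
  simp only [euler_apply, conv_apply, add_apply, smul_sum, ← sum_add_distrib]
  refine sum_congr rfl ?_
  rintro ⟨p, q⟩ h
  rw [mem_antidiagonal] at h
  subst h
  simp [add_smul]

theorem euler_deriv (k : ι) (a : VSeries ι M) :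
    euler (deriv k a) = deriv k (euler a) - deriv k a := by
  ext d
  simp only [euler_apply, deriv_apply, sub_apply, map_add, Finsupp.degree_single, Nat.cast_add,
    Nat.cast_one, smul_smul, ← sub_smul]
  congr 1
  ring

theorem ofMv_pderiv (k : ι) (f : MvPowerSeries ι ℝ) :
    ofMv (MvPowerSeries.pderiv ℝ k f) = deriv k (ofMv f) := by
  ext d
  simp [deriv_apply, MvPowerSeries.coeff_pderiv, mul_comm]

theorem deriv_mv_smul (k : ι) (f : MvPowerSeries ι ℝ) (a : VSeries ι M) :
    deriv k (f • a) = MvPowerSeries.pderiv ℝ k f • a + f • deriv k a := by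
  simp only [mv_smul_def, deriv_conv, ofMv_pderiv]

theorem deriv_map (k : ι) (f : M →ₗ[ℝ] N) (a : VSeries ι M) : deriv k (map f a) = map f (deriv k a) := by
  ext d
  simp [deriv_apply]

theorem deriv_const (k : ι) (x : M) : deriv k (const x) = 0 := by
  ext d
  rw [deriv_apply, const_apply_of_ne, smul_zero, zero_apply]
  intro h
  have := DFunLike.congr_fun h k
  simp at this

end Derivatives

section Lie

variable {L : Type*} [LieRing L] [LieAlgebra ℝ L]

/-- The Lie bracket of a Lie algebra as a bilinear map. -/
def bracketHom (L : Type*) [LieRing L] [LieAlgebra ℝ L] : L →ₗ[ℝ] L →ₗ[ℝ] L :=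
  (LieAlgebra.ad ℝ L : L →ₗ[ℝ] Module.End ℝ L)

@[simp] theorem bracketHom_apply (x y : L) : bracketHom L x y = ⁅x, y⁆ := rfl

instance : Bracket (VSeries ι L) (VSeries ι L) := ⟨fun a b => conv (bracketHom L) a b⟩

theorem lie_def (a b : VSeries ι L) : ⁅a, b⁆ = conv (bracketHom L) a b := rfl

theorem lie_apply (a b : VSeries ι L) (d) :
    ⁅a, b⁆ d = ∑ p ∈ antidiagonal d, ⁅a p.1, b p.2⁆ := by
  rfl

instance : LieRing (VSeries ι L) where
  add_lie a b c := by simp [lie_def]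
  lie_add a b c := by simp [lie_def]
  lie_self a := by
    have h : ⁅a, a⁆ = -⁅a, a⁆ := by
      conv_lhs => rw [lie_def, ← conv_flip]
      have : (bracketHom L).flip = -bracketHom L := by
        ext x y
        simp
      rw [this]
      ext d
      simp only [lie_def, conv_apply, neg_apply, LinearMap.neg_apply, sum_neg_distrib]
    have h2 : (2 : ℝ) • ⁅a, a⁆ = 0 := by
      rw [two_smul]; nth_rewrite 1 [h]; simp
    exact (smul_eq_zero.mp h2).resolve_left two_ne_zero
  leibniz_lie a b c := by
    ext d
    simp only [lie_def, add_apply]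
    rw [conv_conv_right, conv_conv_left, conv_conv_mid]
    simp

instance : LieAlgebra ℝ (VSeries ι L) where
  lie_smul r a b := by simp [lie_def]

theorem mv_smul_lie (f : MvPowerSeries ι ℝ) (a b : VSeries ι L) : ⁅f • a, b⁆ = f • ⁅a, b⁆ :=
  conv_smul_left _ f a b

theorem lie_mv_smul (f : MvPowerSeries ι ℝ) (a b : VSeries ι L) : ⁅a, f • b⁆ = f • ⁅a, b⁆ :=
  conv_smul_right _ f a b

theorem deriv_lie (k : ι) (a b : VSeries ι L) : deriv k ⁅a, b⁆ = ⁅deriv k a, b⁆ + ⁅a, deriv k b⁆ :=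
  deriv_conv _ k a b

theorem euler_lie (a b : VSeries ι L) : euler ⁅a, b⁆ = ⁅euler a, b⁆ + ⁅a, euler b⁆ :=
  euler_conv _ a b

theorem const_lie (x : L) (b : VSeries ι L) (d) : ⁅(const x : VSeries ι L), b⁆ d = ⁅x, b d⁆ := by
  rw [lie_def, conv_const_left]; rfl

theorem lie_const (b : VSeries ι L) (x : L) (d) : ⁅b, (const x : VSeries ι L)⁆ d = ⁅b d, x⁆ := by
  rw [← lie_skew, neg_apply, const_lie, lie_skew]

theorem lie_zero_coeff (a b : VSeries ι L) : ⁅a, b⁆ 0 = ⁅a 0, b 0⁆ := by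
  simp [lie_apply]

end Lie

end VSeries

/-! ### Functional calculus for operators that raise the degree by one. -/

namespace VSeries

open Finset hiding antidiagonal mem_antidiagonal
open Finset.HasAntidiagonal (antidiagonal mem_antidiagonal)
open scoped Classical

section Calculus

variable {ι M : Type*} [AddCommGroup M] [Module ℝ M]

/-- The operator raises the degree by one. -/
def IsDegOne (N : Module.End ℝ (VSeries ι M)) : Prop :=
  ∀ (a b : VSeries ι M) (d : ι →₀ ℕ),
    (∀ e : ι →₀ ℕ, e.degree + 1 = d.degree → a e = b e) → N a d = N b d

variable {N : Module.End ℝ (VSeries ι M)}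

theorem IsDegOne.pow_congr (hN : IsDegOne N) (m : ℕ) (a b : VSeries ι M) (d : ι →₀ ℕ)
    (h : ∀ e : ι →₀ ℕ, e.degree + m = d.degree → a e = b e) : (N ^ m) a d = (N ^ m) b d := by
  induction m generalizing a b with
  | zero => exact h d rfl
  | succ m ih =>
    rw [pow_succ]
    exact ih _ _ fun e he => hN _ _ _ fun f hf => h f (by omega)

theorem IsDegOne.pow_apply_eq_zero (hN : IsDegOne N) {m : ℕ} (a : VSeries ι M) {d : ι →₀ ℕ}
    (h : d.degree < m) : (N ^ m) a d = 0 := by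
  rw [hN.pow_congr m a 0 d fun e he => by omega, map_zero, zero_apply]

theorem IsDegOne.pow_const_apply (hN : IsDegOne N) {m : ℕ} (x : M) {d : ι →₀ ℕ}
    (h : d.degree ≠ m) : (N ^ m) (const x) d = 0 := by
  rw [hN.pow_congr m (const x) 0 d, map_zero, zero_apply]
  intro e he
  refine const_apply_of_ne x ?_
  rintro rfl
  simp at he
  omega

variable (N) in
/-- The operator `p(N)`, for a power series `p` in one variable. -/
def opSeries (p : PowerSeries ℝ) : VSeries ι M →ₗ[ℝ] VSeries ι M where
  toFun a := mk fun d => ∑ m ∈ range (d.degree + 1), PowerSeries.coeff m p • (N ^ m) a d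
  map_add' a b := by ext d; simp [sum_add_distrib]
  map_smul' r a := by ext d; simp [smul_sum, smul_comm r]

theorem opSeries_apply (p : PowerSeries ℝ) (a : VSeries ι M) (d) :
    opSeries N p a d = ∑ m ∈ range (d.degree + 1), PowerSeries.coeff m p • (N ^ m) a d := rfl

theorem IsDegOne.aeval_apply (hN : IsDegOne N) (P : Polynomial ℝ) (a : VSeries ι M) (d) :
    (Polynomial.aeval N P) a d = ∑ m ∈ range (d.degree + 1), P.coeff m • (N ^ m) a d := by
  induction P using Polynomial.induction_on' with
  | add p q hp hq => simp [hp, hq, add_smul, sum_add_distrib]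
  | monomial n c =>
    rw [Polynomial.aeval_monomial]
    simp only [Polynomial.coeff_monomial, ite_smul, zero_smul, sum_ite_eq, mem_range]
    split_ifs with h
    · simp [Algebra.algebraMap_eq_smul_one]
    · simp [Algebra.algebraMap_eq_smul_one, hN.pow_apply_eq_zero a (show d.degree < n by omega)]

theorem IsDegOne.opSeries_apply_of_le (hN : IsDegOne N) (p : PowerSeries ℝ) (a : VSeries ι M)
    {d : ι →₀ ℕ} {n : ℕ} (h : d.degree ≤ n) :
    opSeries N p a d = (Polynomial.aeval N (PowerSeries.trunc (n + 1) p)) a d := by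
  rw [hN.aeval_apply, opSeries_apply]
  refine sum_congr rfl fun m hm => ?_
  rw [PowerSeries.coeff_trunc, if_pos (by simp at hm; omega)]

theorem IsDegOne.opSeries_congr (hN : IsDegOne N) (p : PowerSeries ℝ) (a b : VSeries ι M)
    (d : ι →₀ ℕ) (h : ∀ e : ι →₀ ℕ, e.degree ≤ d.degree → a e = b e) :
    opSeries N p a d = opSeries N p b d := by
  simp only [opSeries_apply]
  exact sum_congr rfl fun m _ => by rw [hN.pow_congr m a b d fun e he => h e (by omega)]

/-- In a given degree only finitely many powers of N survive, so p(N) coincides there with a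
truncated polynomial in N, and polynomial evaluation is multiplicative. -/
theorem IsDegOne.opSeries_mul (hN : IsDegOne N) (p q : PowerSeries ℝ) (a : VSeries ι M) :
    opSeries N (p * q) a = opSeries N p (opSeries N q a) := by
  ext d
  rw [hN.opSeries_congr p (opSeries N q a)
      (Polynomial.aeval N (PowerSeries.trunc (d.degree + 1) q) a) d
      fun e he => hN.opSeries_apply_of_le q a he,
    hN.opSeries_apply_of_le _ _ le_rfl, hN.opSeries_apply_of_le _ _ le_rfl, ← Module.End.mul_apply,
    ← map_mul, ← PowerSeries.trunc_trunc_mul_trunc, hN.aeval_apply, hN.aeval_apply]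
  refine sum_congr rfl fun m hm => ?_
  rw [PowerSeries.coeff_trunc, if_pos (by simpa using hm), ← Polynomial.coe_mul,
    Polynomial.coeff_coe]

theorem opSeries_add (p q : PowerSeries ℝ) (a : VSeries ι M) :
    opSeries N (p + q) a = opSeries N p a + opSeries N q a := by
  ext d; simp [opSeries_apply, add_smul, sum_add_distrib]

theorem opSeries_sub (p q : PowerSeries ℝ) (a : VSeries ι M) :
    opSeries N (p - q) a = opSeries N p a - opSeries N q a := by
  ext d; simp [opSeries_apply, sub_smul, sum_sub_distrib]

theorem opSeries_one (a : VSeries ι M) : opSeries N 1 a = a := by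
  ext d
  rw [opSeries_apply, sum_eq_single 0]
  · simp
  · intro m _ hm; simp [PowerSeries.coeff_one, hm]
  · simp

theorem IsDegOne.opSeries_X (hN : IsDegOne N) (a : VSeries ι M) : opSeries N PowerSeries.X a = N a := by
  ext d
  rw [hN.opSeries_apply_of_le _ _ (le_max_left _ 1), PowerSeries.trunc_X_of (by omega)]
  simp

theorem IsDegOne.opSeries_const_apply (hN : IsDegOne N) (p : PowerSeries ℝ) (x : M) (d) :
    opSeries N p (const x) d = PowerSeries.coeff d.degree p • (N ^ d.degree) (const x) d := by
  rw [opSeries_apply, sum_eq_single d.degree]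
  · intro m _ hm
    rw [hN.pow_const_apply x (Ne.symm hm), smul_zero]
  · simp

/-- N^m x is homogeneous of degree m, so the Euler operator acts on p(N)x as t d/dt acts on p.
Differential equations of p thus become Euler equations of p(N)x. -/
theorem IsDegOne.euler_opSeries_const (hN : IsDegOne N) (p : PowerSeries ℝ) (x : M) :
    euler (opSeries N p (const x)) =
      opSeries N (PowerSeries.X * PowerSeries.derivative ℝ p) (const x) := by
  ext d
  rw [euler_apply, hN.opSeries_const_apply, hN.opSeries_const_apply, smul_smul]
  congr 1
  cases d.degree with
  | zero => simp
  | succ n => rw [PowerSeries.coeff_succ_X_mul, PowerSeries.coeff_derivative]; push_cast; ring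

/-- Each power of N is linear over scalar series. The two truncation bounds, the degree of the
product and that of one factor, differ only by powers of N that vanish on the relevant coefficient.
-/
theorem opSeries_mv_smul (hF : ∀ (f : MvPowerSeries ι ℝ) (a : VSeries ι M), N (f • a) = f • N a)
    (hN : IsDegOne N) (p : PowerSeries ℝ) (f : MvPowerSeries ι ℝ) (a : VSeries ι M) :
    opSeries N p (f • a) = f • opSeries N p a := by
  have hF' (m : ℕ) : (N ^ m) (f • a) = f • (N ^ m) a := by
    induction m with
    | zero => rfl
    | succ m ih => rw [pow_succ', Module.End.mul_apply, ih, hF, Module.End.mul_apply]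
  ext d
  rw [mv_smul_apply, opSeries_apply]
  simp only [hF', mv_smul_apply, smul_sum]
  rw [sum_comm]
  refine sum_congr rfl ?_
  rintro ⟨p', q'⟩ h
  rw [mem_antidiagonal] at h
  have hd : q'.degree ≤ d.degree := by rw [← h]; simp
  simp only
  rw [hN.opSeries_apply_of_le p a hd, hN.aeval_apply, smul_sum]
  symm
  refine sum_subset_zero_on_sdiff (by simpa using hd) ?_ ?_
  · intro m hm
    rw [hN.pow_apply_eq_zero, smul_zero, smul_zero]
    simp at hm; omega
  · intro m hm
    rw [PowerSeries.coeff_trunc, if_pos (by simp at hm; omega), smul_comm]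

end Calculus

/-! ### Identities between the exponential and Bernoulli series. -/

section PowerSeriesIdentities

open PowerSeries

/-- The power series of `(1 - exp (-t)) / t`. -/
def alphaSeries : PowerSeries ℝ := PowerSeries.mk fun n => (-1) ^ n / (n + 1).factorial

/-- The power series of `exp (-t)`. -/
def expNegSeries : PowerSeries ℝ := PowerSeries.mk fun n => (-1) ^ n / n.factorial

/-- The power series of `β (ε t)`, where `β t = t / (1 - exp (-t))`. -/
def betaSeries (ε : ℝ) : PowerSeries ℝ := PowerSeries.mk fun n => ε ^ n * bchCoeff n

theorem expNegSeries_mul_exp : expNegSeries * exp ℝ = 1 := by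
  rw [mul_comm, ← exp_mul_exp_neg_eq_one (A := ℝ)]
  congr 1
  ext n
  simp [expNegSeries, evalNegHom, coeff_rescale, coeff_exp, div_eq_mul_inv]

theorem X_mul_alphaSeries : X * alphaSeries = 1 - expNegSeries := by
  ext n
  cases n with
  | zero => simp [expNegSeries]
  | succ n =>
    rw [coeff_succ_X_mul]
    simp [alphaSeries, expNegSeries, coeff_one, pow_succ]
    ring

theorem betaSeries_one : betaSeries 1 * (exp ℝ - 1) = X * exp ℝ := by
  rw [← bernoulli'PowerSeries_mul_exp_sub_one]
  congr 1
  ext n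
  simp [betaSeries, bchCoeff, bernoulli'PowerSeries]

theorem betaSeries_neg_one : betaSeries (-1) * (exp ℝ - 1) = X := by
  rw [← bernoulliPowerSeries_mul_exp_sub_one]
  congr 1
  ext n
  simp [betaSeries, bchCoeff, bernoulliPowerSeries, bernoulli]
  ring

theorem exp_mul_X_mul_alphaSeries : exp ℝ * X * alphaSeries = exp ℝ - 1 := by
  rw [mul_assoc, X_mul_alphaSeries, mul_sub, mul_one, mul_comm _ expNegSeries,
    expNegSeries_mul_exp]

theorem exp_mul_X_ne_zero : exp ℝ * X ≠ 0 :=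
  mul_ne_zero (fun h => by
    have h1 := congrArg (PowerSeries.coeff 0) h
    rw [PowerSeries.coeff_exp, map_zero] at h1
    simp at h1) X_ne_zero

theorem alphaSeries_mul_betaSeries_one : alphaSeries * betaSeries 1 = 1 := by
  -- Multiplying by t e^t clears denominators: α becomes e^t - 1, the factor in the generating
  -- functions of the Bernoulli numbers.
  refine mul_left_cancel₀ exp_mul_X_ne_zero ?_
  rw [← mul_assoc, exp_mul_X_mul_alphaSeries, mul_comm, betaSeries_one]
  ring

/-- The asymmetry with `alphaSeries_mul_betaSeries_one` is what separates R* from L*: the form θ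
returns e^{-ad v}X for one and X for the other. -/
theorem alphaSeries_mul_betaSeries_neg_one : alphaSeries * betaSeries (-1) = expNegSeries := by
  refine mul_left_cancel₀ exp_mul_X_ne_zero ?_
  rw [← mul_assoc, exp_mul_X_mul_alphaSeries, mul_comm, betaSeries_neg_one, mul_right_comm,
    mul_comm (exp ℝ), expNegSeries_mul_exp, one_mul]

/-- Both sides are e^{-t}, the left one being the derivative of tα(t). This is the source of the
Euler equation of θ. -/
theorem X_mul_derivative_alphaSeries :
    X * derivative ℝ alphaSeries + alphaSeries = 1 - X * alphaSeries := by
  ext n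
  cases n with
  | zero => simp [alphaSeries]
  | succ n =>
    rw [map_add, map_sub, coeff_succ_X_mul, coeff_succ_X_mul, coeff_derivative]
    have h : ((n + 1).factorial : ℝ) ≠ 0 := by positivity
    simp [alphaSeries, coeff_one, Nat.factorial_succ (n + 1), pow_succ]
    field_simp
    ring

theorem derivative_expNegSeries : derivative ℝ expNegSeries = -expNegSeries := by
  ext n
  have h : (n.factorial : ℝ) ≠ 0 := by positivity
  rw [coeff_derivative]
  simp only [expNegSeries, coeff_mk, Nat.factorial_succ, pow_succ, map_neg]
  push_cast
  field_simp

end PowerSeriesIdentities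

/-! ### The Maurer–Cartan form in exponential coordinates. -/

section Generic

variable {ι L : Type*} [Fintype ι] [LieRing L] [LieAlgebra ℝ L]

/-- The generic linear combination of a family of vectors. -/
def gen (b : ι → L) : VSeries ι L := ∑ k, monomial (Finsupp.single k 1) (b k)

theorem gen_apply_of_degree_ne (b : ι → L) {d : ι →₀ ℕ} (h : d.degree ≠ 1) : gen b d = 0 := by
  rw [gen, sum_apply]
  refine sum_eq_zero fun k _ => ?_
  rw [monomial_apply, if_neg]
  rintro rfl
  simp at h

theorem gen_single (b : ι → L) (k : ι) : gen b (Finsupp.single k 1) = b k := by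
  rw [gen, sum_apply, sum_eq_single k]
  · simp [monomial_apply]
  · intro j _ hj
    rw [monomial_apply, if_neg]
    intro h
    exact hj (Finsupp.single_left_injective one_ne_zero h).symm
  · simp

theorem deriv_gen (b : ι → L) (k : ι) : deriv k (gen b) = const (b k) := by
  ext d
  rw [deriv_apply]
  by_cases h : d = 0
  · subst h
    simp [gen_single]
  · rw [gen_apply_of_degree_ne, smul_zero, const_apply_of_ne _ h]
    simpa [Finsupp.degree_eq_zero_iff] using h

/-- The adjoint action of the generic element. -/
def adGen (b : ι → L) : Module.End ℝ (VSeries ι L) := LieAlgebra.ad ℝ (VSeries ι L) (gen b)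

theorem adGen_apply (b : ι → L) (a : VSeries ι L) : adGen b a = ⁅gen b, a⁆ := rfl

theorem isDegOne_adGen (b : ι → L) : IsDegOne (adGen b) := by
  intro a a' d h
  rw [adGen_apply, adGen_apply, lie_apply, lie_apply]
  refine sum_congr rfl ?_
  rintro ⟨p, q⟩ hp
  rw [mem_antidiagonal] at hp
  by_cases h1 : p.degree = 1
  · rw [h q]
    rw [← hp, map_add, h1, add_comm]
  · simp [gen_apply_of_degree_ne b h1]

theorem adGen_mv_smul (b : ι → L) (f : MvPowerSeries ι ℝ) (a : VSeries ι L) :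
    adGen b (f • a) = f • adGen b a :=
  lie_mv_smul f _ a

/-- The left side multiplies the degree n part by n + c, while the bracket with the generic element
raises the degree by one. So the coefficients vanish one degree after another, except that for c = 0
the constant term must be given. This radial uniqueness takes the place of integrating along rays:
the identities below hold because their defects solve such an equation. -/
theorem eq_zero_of_euler (b : ι → L) (c : ℝ) (Z : VSeries ι L)
    (hc : 0 < c ∨ (c = 0 ∧ Z 0 = 0)) (h : euler Z + c • Z = -⁅gen b, Z⁆) : Z = 0 := by
  have key (n : ℕ) : ∀ d : ι →₀ ℕ, d.degree = n → Z d = 0 := by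
    induction n with
    | zero =>
      intro d hd
      rw [Finsupp.degree_eq_zero_iff] at hd
      subst hd
      rcases hc with hc | hc
      · have := congrFun h 0
        rw [add_apply, euler_apply, smul_apply, neg_apply, lie_zero_coeff,
          gen_apply_of_degree_ne b (by simp)] at this
        simpa [hc.ne'] using this
      · exact hc.2
    | succ n ih =>
      intro d hd
      have h1 : ⁅gen b, Z⁆ d = 0 := by
        have := isDegOne_adGen b Z 0 d fun e he => by
          rw [ih e (by omega), zero_apply]
        rwa [map_zero] at this
      have := congrFun h d
      rw [add_apply, euler_apply, smul_apply, neg_apply, h1, neg_zero, ← add_smul, hd] at this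
      refine (smul_eq_zero.mp this).resolve_left ?_
      have : 0 ≤ c := by rcases hc with hc | hc; exacts [hc.le, hc.1.ge]
      positivity
  ext d
  exact key _ d rfl

/-- The components of the left Maurer-Cartan form in exponential coordinates. -/
def theta (b : ι → L) (k : ι) : VSeries ι L := opSeries (adGen b) alphaSeries (const (b k))

/-- The series `exp (-ad v) X`. -/
def conj (b : ι → L) : L →ₗ[ℝ] VSeries ι L := opSeries (adGen b) expNegSeries ∘ₗ const

theorem theta_zero (b : ι → L) (k : ι) : theta b k 0 = b k := by
  simp [theta, opSeries_apply, alphaSeries]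

theorem conj_zero (b : ι → L) (x : L) : conj b x 0 = x := by
  simp [conj, opSeries_apply, expNegSeries]

theorem euler_theta (b : ι → L) (k : ι) :
    euler (theta b k) + theta b k = const (b k) - ⁅gen b, theta b k⁆ := by
  rw [theta, (isDegOne_adGen b).euler_opSeries_const, ← opSeries_add, X_mul_derivative_alphaSeries,
    opSeries_sub, opSeries_one, (isDegOne_adGen b).opSeries_mul, (isDegOne_adGen b).opSeries_X]
  rfl

theorem euler_conj (b : ι → L) (x : L) : euler (conj b x) = -⁅gen b, conj b x⁆ := by
  rw [conj, LinearMap.comp_apply, (isDegOne_adGen b).euler_opSeries_const, derivative_expNegSeries,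
    (isDegOne_adGen b).opSeries_mul, (isDegOne_adGen b).opSeries_X, adGen_apply]
  have : opSeries (adGen b) (-expNegSeries) (const x) = -opSeries (adGen b) expNegSeries (const x) := by
    ext d; simp [opSeries_apply]
  rw [this, lie_neg]

theorem euler_theta' (b : ι → L) (k : ι) :
    euler (theta b k) = const (b k) - ⁅gen b, theta b k⁆ - theta b k :=
  eq_sub_of_add_eq (euler_theta b k)

/-- By the Euler equation of θ, the defect satisfies the radial equation with c = 2: each derivative
and each factor θ contributes a degree shift of one, and the inhomogeneous terms involving the basis
vectors cancel. -/
theorem maurer_cartan (b : ι → L) (j k : ι) :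
    deriv j (theta b k) - deriv k (theta b j) + ⁅theta b j, theta b k⁆ = 0 := by
  refine eq_zero_of_euler b 2 _ (Or.inl two_pos) ?_
  simp only [map_add, map_sub, euler_deriv, euler_lie, euler_theta', deriv_lie, deriv_gen,
    deriv_const, lie_sub, sub_lie, lie_add, two_smul, leibniz_lie (gen b)]
  rw [← lie_skew (theta b j) (const (b k))]
  abel

/-- Here c = 1: e^{-ad v}x has no shift of its own, and one comes from the derivative or from θ. -/
theorem deriv_conj (b : ι → L) (k : ι) (x : L) :
    deriv k (conj b x) = -⁅theta b k, conj b x⁆ := by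
  rw [← add_eq_zero_iff_eq_neg]
  refine eq_zero_of_euler b 1 _ (Or.inl one_pos) ?_
  simp only [map_add, map_neg, euler_deriv, euler_lie, euler_theta', euler_conj, deriv_lie,
    deriv_gen, sub_lie, lie_add, lie_neg, one_smul, leibniz_lie (gen b)]
  abel

/-- Here c = 0, since no derivative and no θ occurs, so the constant terms must also be compared. -/
theorem conj_lie (b : ι → L) (x y : L) : ⁅conj b x, conj b y⁆ = conj b ⁅x, y⁆ := by
  rw [← sub_eq_zero]
  refine eq_zero_of_euler b 0 _ (Or.inr ⟨rfl, ?_⟩) ?_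
  · simp [lie_zero_coeff, conj_zero]
  · simp only [map_sub, euler_lie, euler_conj, lie_sub, neg_lie, lie_neg, zero_smul,
      leibniz_lie (gen b)]
    abel

end Generic

end VSeries

/-! ### Derivations of the power series ring and the structure equation. -/

namespace VSeries

open Finset hiding antidiagonal mem_antidiagonal
open Finset.HasAntidiagonal (antidiagonal mem_antidiagonal)
open scoped Classical

section Derivations

open MvPowerSeries (X pderiv)

variable {ι : Type*} [Fintype ι]

theorem exists_eq_sum_X_mul (n : ℕ) (f : MvPowerSeries ι ℝ)
    (hf : ∀ e : ι →₀ ℕ, e.degree < n + 1 → MvPowerSeries.coeff e f = 0) :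
    ∃ g : ι → MvPowerSeries ι ℝ, f = ∑ k, X k * g k ∧
      ∀ k, ∀ e : ι →₀ ℕ, e.degree < n → MvPowerSeries.coeff e (g k) = 0 := by
  -- Each nonconstant monomial is assigned one variable dividing it; the k-th summand of f collects
  -- the monomials assigned to the variable k.
  have hκ (e : ι →₀ ℕ) : ∃ k : Option ι, (e = 0 → k = none) ∧ (e ≠ 0 → ∃ j, k = some j ∧ e j ≠ 0) := by
    by_cases h : e = 0
    · exact ⟨none, by simp [h]⟩
    · obtain ⟨j, hj⟩ := Finsupp.ne_iff.mp h
      exact ⟨some j, by simp [h], fun _ => ⟨j, rfl, by simpa using hj⟩⟩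
  choose κ hκ0 hκ1 using hκ
  let f' (k : ι) : MvPowerSeries ι ℝ :=
    fun e => if κ e = some k then MvPowerSeries.coeff e f else 0
  have hf' (k : ι) (e : ι →₀ ℕ) : MvPowerSeries.coeff e (f' k) =
      if κ e = some k then MvPowerSeries.coeff e f else 0 := rfl
  have hdvd (k : ι) : X k ∣ f' k := by
    rw [MvPowerSeries.X_dvd_iff]
    intro e he
    rw [hf', if_neg]
    intro hk
    have h0 : e ≠ 0 := by rintro rfl; simp [hκ0 0 rfl] at hk
    obtain ⟨j, hj, hj'⟩ := hκ1 e h0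
    rw [hk, Option.some_inj] at hj
    subst hj
    exact hj' he
  choose g hg using hdvd
  refine ⟨g, ?_, ?_⟩
  · ext e
    simp only [← hg, map_sum, hf']
    by_cases h : e = 0
    · subst h
      simp [hκ0 0 rfl, hf 0 (by simp)]
    · obtain ⟨j, hj, -⟩ := hκ1 e h
      simp [hj]
  · intro k e he
    have h1 : MvPowerSeries.coeff (Finsupp.single k 1 + e) (X k * g k) =
        MvPowerSeries.coeff e (g k) := by
      rw [MvPowerSeries.X, MvPowerSeries.coeff_add_monomial_mul, one_mul]
    rw [← h1, ← hg, hf']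
    split_ifs
    · exact hf _ (by simp; omega)
    · rfl

theorem coeff_derivation_eq_zero (D : Derivation ℝ (MvPowerSeries ι ℝ) (MvPowerSeries ι ℝ))
    (hD : ∀ k, D (X k) = 0) (n : ℕ) (f : MvPowerSeries ι ℝ)
    (hf : ∀ e : ι →₀ ℕ, e.degree < n → MvPowerSeries.coeff e f = 0) :
    ∀ e : ι →₀ ℕ, e.degree < n → MvPowerSeries.coeff e (D f) = 0 := by
  induction n generalizing f with
  | zero => intro e he; omega
  | succ n ih =>
    intro e he
    obtain ⟨g, rfl, hg⟩ := exists_eq_sum_X_mul n f hf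
    rw [map_sum, map_sum]
    refine sum_eq_zero fun k _ => ?_
    rw [Derivation.leibniz, hD, smul_zero, add_zero, smul_eq_mul, MvPowerSeries.coeff_mul]
    refine sum_eq_zero ?_
    rintro ⟨p, q⟩ hpq
    rw [mem_antidiagonal] at hpq
    by_cases hp : p = Finsupp.single k 1
    · rw [ih (g k) (hg k) q, mul_zero]
      rw [← hpq, hp, map_add, Finsupp.degree_single] at he
      exact Nat.lt_of_add_lt_add_left (he.trans_eq (Nat.add_comm n 1))
    · rw [MvPowerSeries.coeff_X, if_neg hp, zero_mul]

/-- No continuity is needed. A derivation killing the variables kills polynomials and, by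
`coeff_derivation_eq_zero`, does not lower the order of vanishing; every series is a polynomial plus
a remainder of arbitrarily high order. -/
theorem derivation_ext {D E : Derivation ℝ (MvPowerSeries ι ℝ) (MvPowerSeries ι ℝ)}
    (h : ∀ k, D (X k) = E (X k)) : D = E := by
  rw [← sub_eq_zero]
  ext f e
  have key (n : ℕ) : ∃ P Q : MvPowerSeries ι ℝ, f = P + Q ∧ (D - E) P = 0 ∧
      ∀ e : ι →₀ ℕ, e.degree < n → MvPowerSeries.coeff e Q = 0 := by
    let S : Finset (ι →₀ ℕ) := (Finsupp.finite_of_degree_lt n).toFinset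
    have hS (e : ι →₀ ℕ) : e ∈ S ↔ e.degree < n := by simp [S]
    let p : MvPolynomial ι ℝ := ∑ e ∈ S, MvPolynomial.monomial e (MvPowerSeries.coeff e f)
    refine ⟨p, f - p, by ring, ?_, ?_⟩
    · have : ((D - E).toLinearMap.comp (MvPolynomial.coeToMvPowerSeries.algHom
          (σ := ι) (R := ℝ) ℝ).toLinearMap) p = 0 := by
        induction p using MvPolynomial.induction_on with
        | C a =>
          have : (MvPolynomial.coeToMvPowerSeries.algHom ℝ) (MvPolynomial.C a : MvPolynomial ι ℝ)
            = algebraMap ℝ (MvPowerSeries ι ℝ) a := by simp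
          simp only [LinearMap.comp_apply, AlgHom.toLinearMap_apply, this]
          exact (D - E).map_algebraMap a
        | add p q hp hq => rw [map_add, hp, hq, add_zero]
        | mul_X p k hp =>
          simp only [LinearMap.comp_apply, AlgHom.toLinearMap_apply] at hp ⊢
          have h1 : (D - E).toLinearMap ((MvPolynomial.coeToMvPowerSeries.algHom ℝ) p) =
            (D - E) ((MvPolynomial.coeToMvPowerSeries.algHom ℝ) p) := rfl
          rw [h1] at hp
          rw [map_mul]
          change (D - E) (_ * _) = 0
          rw [Derivation.leibniz, hp, smul_zero, add_zero]
          simp [h]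
      simpa using this
    · intro e he
      rw [map_sub, MvPolynomial.coeff_coe, MvPolynomial.coeff_sum]
      simp only [MvPolynomial.coeff_monomial, sum_ite_eq', hS, he, if_true, sub_self]
  obtain ⟨P, Q, hf, hP, hQ⟩ := key (e.degree + 1)
  rw [hf, map_add, hP, zero_add]
  rw [coeff_derivation_eq_zero (D - E) (fun k => by simp [h k]) _ Q hQ e (by omega)]
  simp

theorem derivation_sum_apply {κ : Type*} (s : Finset κ)
    (D : κ → Derivation ℝ (MvPowerSeries ι ℝ) (MvPowerSeries ι ℝ)) (f : MvPowerSeries ι ℝ) :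
    (∑ k ∈ s, D k) f = ∑ k ∈ s, D k f := by
  induction s using Finset.induction_on with
  | empty => simp
  | insert a s ha ih => simp [sum_insert ha, ih]

theorem sum_smul_pderiv_X (g : ι → MvPowerSeries ι ℝ) (j : ι) :
    (∑ k, g k • pderiv ℝ k) (X j) = g j := by
  rw [derivation_sum_apply, sum_eq_single j]
  · simp [MvPowerSeries.pderiv_X_self]
  · intro k _ hk
    simp [MvPowerSeries.pderiv_X_of_ne (Ne.symm hk)]
  · simp

theorem derivation_eq_sum (D : Derivation ℝ (MvPowerSeries ι ℝ) (MvPowerSeries ι ℝ)) :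
    D = ∑ k, D (X k) • pderiv ℝ k :=
  derivation_ext fun j => (sum_smul_pderiv_X (fun k => D (X k)) j).symm

theorem derivation_apply (D : Derivation ℝ (MvPowerSeries ι ℝ) (MvPowerSeries ι ℝ))
    (f : MvPowerSeries ι ℝ) : D f = ∑ k, D (X k) * pderiv ℝ k f := by
  conv_lhs => rw [derivation_eq_sum D]
  rw [derivation_sum_apply]
  rfl

variable {M M' : Type*} [AddCommGroup M] [Module ℝ M] [AddCommGroup M'] [Module ℝ M']

/-- The action of a formal vector field on formal power series with values in a vector space. -/
def act (D : Derivation ℝ (MvPowerSeries ι ℝ) (MvPowerSeries ι ℝ)) :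
    VSeries ι M →ₗ[ℝ] VSeries ι M where
  toFun a := ∑ k, D (X k) • deriv k a
  map_add' a b := by simp [sum_add_distrib]
  map_smul' r a := by simp [smul_sum, smul_comm r]

variable (D E : Derivation ℝ (MvPowerSeries ι ℝ) (MvPowerSeries ι ℝ))

theorem act_def (a : VSeries ι M) : act D a = ∑ k, D (X k) • deriv k a := rfl

theorem act_mv_smul (f : MvPowerSeries ι ℝ) (a : VSeries ι M) :
    act D (f • a) = D f • a + f • act D a := by
  simp only [act_def, deriv_mv_smul, smul_add, sum_add_distrib, derivation_apply D f, sum_smul,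
    smul_smul, smul_sum, mul_comm f]

theorem act_map (f : M →ₗ[ℝ] M') (a : VSeries ι M) : act D (map f a) = map f (act D a) := by
  simp only [act_def, deriv_map, map_sum, map_mv_smul]

theorem act_const (x : M) : act D (const x) = 0 := by
  simp [act_def, deriv_const]

variable {L : Type*} [LieRing L] [LieAlgebra ℝ L]

/-- The value of the left Maurer-Cartan form on a formal vector field. -/
def thetaOf (b : ι → L) :
    Derivation ℝ (MvPowerSeries ι ℝ) (MvPowerSeries ι ℝ) →ₗ[MvPowerSeries ι ℝ] VSeries ι L where
  toFun D := ∑ k, D (X k) • theta b k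
  map_add' D E := by simp [add_smul, sum_add_distrib]
  map_smul' f D := by simp [smul_sum, mul_smul]

theorem thetaOf_def (b : ι → L) : thetaOf b D = ∑ k, D (X k) • theta b k := rfl

/-- In the expansion over the basis, the terms that differentiate the components of the fields give
θ of the commutator. The others form a double sum of Maurer–Cartan defects, which vanish. -/
theorem thetaOf_lie (b : ι → L) :
    thetaOf b ⁅D, E⁆ = act D (thetaOf b E) - act E (thetaOf b D) + ⁅thetaOf b D, thetaOf b E⁆ := by
  have h1 (D E : Derivation ℝ (MvPowerSeries ι ℝ) (MvPowerSeries ι ℝ)) :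
      act D (thetaOf b E) = ∑ k, D (E (X k)) • theta b k +
        ∑ j, ∑ k, (D (X j) * E (X k)) • deriv j (theta b k) := by
    rw [thetaOf_def, map_sum]
    simp only [act_mv_smul, sum_add_distrib]
    congr 1
    rw [sum_comm]
    simp only [act_def, smul_sum, smul_smul]
    exact sum_congr rfl fun k _ => sum_congr rfl fun j _ => by rw [mul_comm]
  have h2 : ⁅thetaOf b D, thetaOf b E⁆ =
      ∑ j, ∑ k, (D (X j) * E (X k)) • ⁅theta b j, theta b k⁆ := by
    simp only [thetaOf_def, sum_lie_sum, mv_smul_lie, lie_mv_smul, smul_smul]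
    exact sum_congr rfl fun j _ => sum_congr rfl fun k _ => by rw [mul_comm]
  have h3 : ∑ j, ∑ k, (E (X j) * D (X k)) • deriv j (theta b k) =
      ∑ j, ∑ k, (D (X j) * E (X k)) • deriv k (theta b j) := by
    rw [sum_comm]
    exact sum_congr rfl fun k _ => sum_congr rfl fun j _ => by rw [mul_comm]
  have h4 : ∑ j, ∑ k, (D (X j) * E (X k)) • deriv j (theta b k) -
      ∑ j, ∑ k, (D (X j) * E (X k)) • deriv k (theta b j) +
      ∑ j, ∑ k, (D (X j) * E (X k)) • ⁅theta b j, theta b k⁆ = 0 := by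
    simp only [← sum_sub_distrib, ← sum_add_distrib, ← smul_sub, ← smul_add, maurer_cartan,
      smul_zero, sum_const_zero]
  have h5 : thetaOf b ⁅D, E⁆ = ∑ k, D (E (X k)) • theta b k - ∑ k, E (D (X k)) • theta b k := by
    simp only [thetaOf_def, Derivation.commutator_apply, sub_smul, sum_sub_distrib]
  rw [h5, h1, h1, h2, h3, add_sub_add_comm, add_assoc, h4, add_zero]

theorem act_conj (b : ι → L) (x : L) : act D (conj b x) = -⁅thetaOf b D, conj b x⁆ := by
  simp only [act_def, deriv_conj, thetaOf_def, sum_lie, mv_smul_lie, smul_neg,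
    sum_neg_distrib]

theorem thetaOf_zero (b : ι → L) :
    thetaOf b D 0 = ∑ k, MvPowerSeries.constantCoeff (D (X k)) • b k := by
  rw [thetaOf_def, sum_apply]
  refine sum_congr rfl fun k _ => ?_
  rw [mv_smul_apply]
  simp [theta_zero]

end Derivations

end VSeries

/-! ### Maurer–Cartan values and brackets of the fields L* and R*. -/

namespace FormalChart

open VSeries hiding add_apply sub_apply neg_apply zero_apply smul_apply sum_apply

variable {L : Type u} [LieRing L] [LieAlgebra ℝ L] {i : LieSubalgebra ℝ L} (c : FormalChart i)

/-- The basis vectors of the complement, as elements of the Lie algebra. -/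
def vec (k : c.ι) : L := c.basis k

/-- The projection onto the complement `V` along `i`. -/
def proj : L →ₗ[ℝ] L := c.V.subtype ∘ₗ c.V.projectionOnto i.toSubmodule c.isCompl

theorem proj_mem (x : L) : c.proj x ∈ c.V := Subtype.property _

theorem vec_mem (k : c.ι) : c.vec k ∈ c.V := Subtype.property _

theorem proj_of_mem {x : L} (h : x ∈ c.V) : c.proj x = x := by
  rw [proj, LinearMap.comp_apply, Submodule.projectionOnto_apply_of_mem_left _ h]
  rfl

theorem proj_eq_zero_iff {x : L} : c.proj x = 0 ↔ x ∈ i := by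
  rw [proj, LinearMap.comp_apply, Submodule.subtype_apply, Submodule.coe_eq_zero,
    Submodule.projectionOnto_apply_eq_zero_iff]
  rfl

theorem proj_of_mem_isot {x : L} (h : x ∈ i) : c.proj x = 0 := c.proj_eq_zero_iff.mpr h

theorem proj_vec (k : c.ι) : c.proj (c.vec k) = c.vec k := c.proj_of_mem (c.vec_mem k)

theorem isotPart_apply (x : L) : c.isotPart x = x - c.proj x := rfl

theorem sub_proj_mem (x : L) : x - c.proj x ∈ i := by
  rw [← c.proj_eq_zero_iff, map_sub, c.proj_of_mem (c.proj_mem x), sub_self]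

theorem isotPart_mem (x : L) : c.isotPart x ∈ i := c.sub_proj_mem x

theorem proj_eq_sum (x : L) : c.proj x = ∑ k, c.coord k x • c.vec k := by
  have h := c.basis.sum_repr (c.V.projectionOnto i.toSubmodule c.isCompl x)
  conv_lhs => rw [proj, LinearMap.comp_apply, ← h]
  rw [map_sum]
  rfl

theorem coord_proj (k : c.ι) (x : L) : c.coord k (c.proj x) = c.coord k x := by
  rw [coord, LinearMap.comp_apply, LinearMap.comp_apply]
  congr 1
  exact Submodule.projectionOnto_apply_left _ _

theorem coord_vec (k j : c.ι) [DecidableEq c.ι] : c.coord k (c.vec j) = if j = k then 1 else 0 := by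
  rw [coord, LinearMap.comp_apply, vec, Submodule.projectionOnto_apply_left]
  simp [Finsupp.single_apply]

theorem eq_zero_of_sum_smul_vec {a : c.ι → ℝ} (h : ∑ k, a k • c.vec k = 0) (k : c.ι) : a k = 0 := by
  classical
  have := congrArg (c.coord k) h
  simpa [coord_vec] using this

/-- The formal power series with values in `L` of a polynomial map. -/
def toVSeries : c.PolyMap →ₗ[ℝ] VSeries c.ι L :=
  TensorProduct.lift (LinearMap.mk₂ ℝ (fun p x => VSeries.mk fun d => MvPolynomial.coeff d p • x)
    (fun p q x => by ext d; simp [add_smul]) (fun r p x => by ext d; simp [mul_smul])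
    (fun p x y => by ext d; simp) (fun r p x => by ext d; simp [smul_comm r]))

theorem toVSeries_tmul (p : MvPolynomial c.ι ℝ) (x : L) (d) :
    c.toVSeries (p ⊗ₜ x) d = MvPolynomial.coeff d p • x := rfl

theorem toVSeries_lie (a b : c.PolyMap) :
    c.toVSeries (LieAlgebra.ad ℝ c.PolyMap a b) = ⁅c.toVSeries a, c.toVSeries b⁆ := by
  classical
  induction a using TensorProduct.induction_on with
  | zero => simp only [map_zero, LinearMap.zero_apply, zero_lie]
  | add a a' h h' => rw [map_add, LinearMap.add_apply, map_add, h, h', map_add, add_lie]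
  | tmul p x =>
    induction b using TensorProduct.induction_on with
    | zero => simp only [map_zero, lie_zero]
    | add b b' h h' => rw [map_add, map_add, h, h', map_add, lie_add]
    | tmul q y =>
      ext d
      change c.toVSeries ((p * q) ⊗ₜ ⁅x, y⁆) d = _
      rw [toVSeries_tmul, MvPolynomial.coeff_mul, Finset.sum_smul, lie_apply]
      simp only [toVSeries_tmul, smul_lie, lie_smul, smul_smul]
      refine Finset.sum_congr (by congr!) fun p _ => by rw [mul_comm]

theorem toVSeries_generic : c.toVSeries c.generic = gen c.vec := by
  classical
  rw [generic, gen, map_sum]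
  refine Finset.sum_congr rfl fun k _ => ?_
  ext d
  rw [toVSeries_tmul, monomial_apply, MvPolynomial.coeff_X, vec]
  by_cases h : d = Finsupp.single k 1
  · simp [h]
  · rw [if_neg (Ne.symm h), if_neg h, zero_smul]

theorem toVSeries_adGeneric (a : c.PolyMap) :
    c.toVSeries (c.adGeneric a) = adGen c.vec (c.toVSeries a) := by
  rw [adGeneric, toVSeries_lie, toVSeries_generic]
  rfl

theorem toVSeries_adGeneric_pow (n : ℕ) (a : c.PolyMap) :
    c.toVSeries ((c.adGeneric ^ n) a) = (adGen c.vec ^ n) (c.toVSeries a) := by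
  induction n with
  | zero => rfl
  | succ n ih =>
    rw [pow_succ', Module.End.mul_apply, toVSeries_adGeneric, ih, pow_succ', Module.End.mul_apply]

theorem toVSeries_one_tmul (x : L) : c.toVSeries (1 ⊗ₜ x) = const x := by
  classical
  ext d
  rw [toVSeries_tmul, MvPolynomial.coeff_one]
  by_cases h : d = 0
  · simp [h]
  · rw [const_apply_of_ne x h, if_neg (Ne.symm h), zero_smul]

theorem toVSeries_lTensor (f : L →ₗ[ℝ] L) (a : c.PolyMap) :
    c.toVSeries (LinearMap.lTensor (MvPolynomial c.ι ℝ) f a) = VSeries.map f (c.toVSeries a) := by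
  induction a using TensorProduct.induction_on with
  | zero => simp
  | add a a' h h' => simp [h, h']
  | tmul p x =>
    ext d
    rw [LinearMap.lTensor_tmul, toVSeries_tmul, map_apply, toVSeries_tmul, map_smul]

theorem coeff_rid_lTensor (f : L →ₗ[ℝ] ℝ) (a : c.PolyMap) (d) :
    MvPolynomial.coeff d (TensorProduct.rid ℝ (MvPolynomial c.ι ℝ)
      (LinearMap.lTensor (MvPolynomial c.ι ℝ) f a)) = f (c.toVSeries a d) := by
  induction a using TensorProduct.induction_on with
  | zero => simp
  | add a a' h h' => simp [h, h']
  | tmul p x => simp [toVSeries_tmul, mul_comm]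

/-- The formal series `∑_n T_n(X)`. -/
def termSeries (ε : ℝ) (X : L) : VSeries c.ι L :=
  VSeries.mk fun d => c.toVSeries (c.term ε d.degree X) d

theorem coeff_series (ε : ℝ) (k : c.ι) (X : L) (d) :
    MvPowerSeries.coeff d (c.series ε k X) = c.coord k (c.termSeries ε X d) :=
  c.coeff_rid_lTensor _ _ _

/-- The `i`-component of the formal series `∑_n T_n(X)`. -/
def isotSeries (ε : ℝ) (X : L) : VSeries c.ι L := VSeries.map c.isotPart (c.termSeries ε X)

/-- This is the recursion for the T_n summed over all n: T = β(ε ad v)X - (β(ad v) - 1)h. -/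
theorem termSeries_eq (ε : ℝ) (X : L) : c.termSeries ε X =
    opSeries (adGen c.vec) (betaSeries ε) (const X) -
      opSeries (adGen c.vec) (betaSeries 1 - 1) (c.isotSeries ε X) := by
  have hN := isDegOne_adGen c.vec
  ext d
  rw [termSeries, mk_apply, term, LinearMap.sub_apply, map_sub, VSeries.sub_apply, VSeries.sub_apply]
  congr 1
  · rw [hN.opSeries_const_apply, LinearMap.smul_apply, map_smul, VSeries.smul_apply, LinearMap.comp_apply,
      toVSeries_adGeneric_pow, TensorProduct.mk_apply, toVSeries_one_tmul]
    simp [betaSeries]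
  -- As b_0 = 1, the series β - 1 has no constant term, so its sum starts with the first power and
  -- matches the shifted index r + 1 of the recursion.
  · rw [opSeries_apply, Finset.sum_range_succ']
    have h0 : PowerSeries.coeff 0 (betaSeries 1 - 1) = 0 := by simp [betaSeries, bchCoeff]
    rw [h0, zero_smul, add_zero, LinearMap.sum_apply, map_sum, VSeries.sum_apply,
      ← Fin.sum_univ_eq_sum_range
        (fun r => PowerSeries.coeff (r + 1) (betaSeries 1 - 1) •
          (adGen c.vec ^ (r + 1)) (c.isotSeries ε X) d)]
    refine Finset.sum_congr rfl fun r _ => ?_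
    rw [LinearMap.smul_apply, map_smul, VSeries.smul_apply, LinearMap.comp_apply,
      toVSeries_adGeneric_pow, LinearMap.comp_apply, toVSeries_lTensor]
    have h1 : PowerSeries.coeff ((r : ℕ) + 1) (betaSeries 1 - 1) = bchCoeff (r + 1) := by
      simp [betaSeries, PowerSeries.coeff_one]
    rw [h1]
    congr 1
    refine hN.pow_congr _ _ _ _ fun e he => ?_
    rw [isotSeries, map_apply, map_apply, termSeries, mk_apply,
      show e.degree = d.degree - 1 - r by omega]

theorem field_X (ε : ℝ) (X : L) (k : c.ι) :
    c.field ε X (MvPowerSeries.X k) = c.series ε k X :=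
  sum_smul_pderiv_X (fun k => c.series ε k X) k

/-- Splitting T = x + h turns the summed recursion into x + β(ad v)h = β(ε ad v)X. The operator α(ad
v) inverts β(ad v) and sends x to the value of θ on the field. -/
theorem thetaOf_field_add (ε : ℝ) (X : L) : thetaOf c.vec (c.field ε X) + c.isotSeries ε X =
    opSeries (adGen c.vec) (alphaSeries * betaSeries ε) (const X) := by
  have hN := isDegOne_adGen c.vec
  have hx : VSeries.map c.proj (c.termSeries ε X) = ∑ k, c.series ε k X • const (c.vec k) := by
    ext d
    rw [map_apply, proj_eq_sum, VSeries.sum_apply]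
    simp only [mv_smul_const, coeff_series]
  have h1 : thetaOf c.vec (c.field ε X) =
      opSeries (adGen c.vec) alphaSeries (VSeries.map c.proj (c.termSeries ε X)) := by
    rw [hx, map_sum, thetaOf_def]
    refine Finset.sum_congr rfl fun k _ => ?_
    rw [opSeries_mv_smul (adGen_mv_smul c.vec) hN, field_X, theta]
  have h2 : VSeries.map c.proj (c.termSeries ε X) + c.isotSeries ε X = c.termSeries ε X := by
    ext d
    simp [isotSeries, isotPart_apply]
  have h3 := c.termSeries_eq ε X
  rw [opSeries_sub, opSeries_one, ← h2] at h3
  have h4 : VSeries.map c.proj (c.termSeries ε X) +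
      opSeries (adGen c.vec) (betaSeries 1) (c.isotSeries ε X) =
      opSeries (adGen c.vec) (betaSeries ε) (const X) := by
    rw [sub_sub_eq_add_sub, eq_sub_iff_add_eq, add_right_comm, add_left_inj] at h3
    exact h3
  rw [hN.opSeries_mul, ← h4, map_add, ← h1, ← hN.opSeries_mul, alphaSeries_mul_betaSeries_one,
    opSeries_one]

theorem thetaOf_leftField (X : L) :
    thetaOf c.vec (c.leftField X) = const X - c.isotSeries 1 X := by
  rw [eq_sub_iff_add_eq, leftField, thetaOf_field_add, alphaSeries_mul_betaSeries_one, opSeries_one]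

theorem thetaOf_rightField (X : L) :
    thetaOf c.vec (c.rightField X) = conj c.vec X - c.isotSeries (-1) X := by
  rw [eq_sub_iff_add_eq, rightField, thetaOf_field_add, alphaSeries_mul_betaSeries_neg_one]
  rfl

theorem value_eq_thetaOf (D : c.Der) : c.value D = thetaOf c.vec D 0 := (thetaOf_zero D c.vec).symm

theorem value_mem (D : c.Der) : c.value D ∈ c.V :=
  Submodule.sum_mem _ fun k _ => c.V.smul_mem _ (c.vec_mem k)

theorem value_eq_zero_iff (D : c.Der) :
    c.value D = 0 ↔ ∀ k, MvPowerSeries.constantCoeff (D (MvPowerSeries.X k)) = 0 := by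
  constructor
  · intro h k
    exact c.eq_zero_of_sum_smul_vec (a := fun k =>
      MvPowerSeries.constantCoeff (D (MvPowerSeries.X k))) h k
  · intro h
    exact Finset.sum_eq_zero fun k _ => by rw [h k, zero_smul]

theorem value_leftField (X : L) : c.value (c.leftField X) = c.proj X := by
  rw [← c.proj_of_mem (c.value_mem _), value_eq_thetaOf, thetaOf_leftField, VSeries.sub_apply,
    const_zero_apply, map_sub, c.proj_of_mem_isot (x := c.isotSeries 1 X 0) (c.isotPart_mem _),
    sub_zero]

theorem value_rightField (X : L) : c.value (c.rightField X) = c.proj X := by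
  rw [← c.proj_of_mem (c.value_mem _), value_eq_thetaOf, thetaOf_rightField, VSeries.sub_apply,
    conj_zero, map_sub, c.proj_of_mem_isot (x := c.isotSeries (-1) X 0) (c.isotPart_mem _),
    sub_zero]

/-- The `V`-valued coefficients of the left Maurer-Cartan form on formal vector fields. -/
def omega (d : c.ι →₀ ℕ) : c.Der →ₗ[ℝ] L :=
  c.proj ∘ₗ VSeries.coeff d ∘ₗ (thetaOf c.vec).restrictScalars ℝ

theorem omega_apply (d) (D : c.Der) : c.omega d D = c.proj (thetaOf c.vec D d) := rfl

theorem omega_mem (d) (D : c.Der) : c.omega d D ∈ c.V := c.proj_mem _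

theorem omega_zero (D : c.Der) : c.omega 0 D = c.value D := by
  rw [omega_apply, ← value_eq_thetaOf, c.proj_of_mem (c.value_mem D)]

theorem map_proj_eq_zero {a : VSeries c.ι L} (h : ∀ d, a d ∈ i) : VSeries.map c.proj a = 0 := by
  ext d
  exact c.proj_of_mem_isot (h d)

theorem omega_smul_leftField (d) (f : c.F) (X : L) :
    c.omega d (f • c.leftField X) = MvPowerSeries.coeff d f • c.proj X := by
  rw [omega_apply, map_smul, thetaOf_leftField, ← map_apply, map_mv_smul, map_sub,
    c.map_proj_eq_zero (a := c.isotSeries 1 X) (fun d => c.isotPart_mem _), sub_zero, ← map_mv_smul,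
    map_apply, mv_smul_const, map_smul]

/-- The map from D to its ω-coefficients is triangular with respect to the degree: as θ_k(0) is the
k-th basis vector, the coefficient of ω at d is that of D plus terms in coefficients of D of lower
degree. -/
theorem eq_zero_of_omega_eq_zero {D : c.Der} (h : ∀ d, c.omega d D = 0) : D = 0 := by
  classical
  have key (n : ℕ) : ∀ d : c.ι →₀ ℕ, d.degree = n → ∀ k,
      MvPowerSeries.coeff d (D (MvPowerSeries.X k)) = 0 := by
    induction n using Nat.strong_induction_on with
    | _ n ih =>
      intro d hd
      have h1 := h d
      rw [omega_apply, thetaOf_def, VSeries.sum_apply] at h1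
      have h2 (k : c.ι) : (D (MvPowerSeries.X k) • theta c.vec k) d =
          MvPowerSeries.coeff d (D (MvPowerSeries.X k)) • c.vec k := by
        rw [mv_smul_apply, Finset.sum_eq_single (d, 0)]
        · rw [theta_zero]
        · rintro ⟨p, q⟩ hpq hne
          rw [Finset.HasAntidiagonal.mem_antidiagonal] at hpq
          have hq : q ≠ 0 := by
            rintro rfl
            exact hne (by rw [← hpq, add_zero])
          have : p.degree < n := by
            have := Finsupp.degree_eq_zero_iff q |>.not.mpr hq
            rw [← hd, ← hpq, map_add]
            exact Nat.lt_add_of_pos_right (Nat.pos_of_ne_zero this)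
          rw [ih _ this p rfl k, zero_smul]
        · simp
      rw [Finset.sum_congr rfl fun k _ => h2 k, map_sum] at h1
      simp only [map_smul, proj_vec] at h1
      exact c.eq_zero_of_sum_smul_vec h1
  refine derivation_ext fun k => ?_
  ext d
  rw [key _ d rfl k]
  simp

theorem act_mem {a : VSeries c.ι L} (D : c.Der) (h : ∀ d, a d ∈ i) (d) : act D a d ∈ i := by
  rw [← c.proj_eq_zero_iff, ← map_apply, ← act_map, c.map_proj_eq_zero h, map_zero, VSeries.zero_apply]

theorem lie_mem {a b : VSeries c.ι L} (ha : ∀ d, a d ∈ i) (hb : ∀ d, b d ∈ i) (d) :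
    ⁅a, b⁆ d ∈ i := by
  classical
  rw [lie_apply]
  exact sum_mem fun p _ => i.lie_mem (ha _) (hb _)

theorem isotSeries_mem (ε : ℝ) (X : L) (d) : c.isotSeries ε X d ∈ i := c.isotPart_mem _

/-- Right- and left-invariant fields commute: in the structure equation the terms containing e^{-ad
v}X cancel. Only i-valued series remain, closed under brackets and under the action of fields,
together with the bracket of w with the i-part of R*_X. -/
theorem omega_rightField_leftField (d) (X w : L) :
    c.omega d ⁅c.rightField X, c.leftField w⁆ = -c.proj ⁅c.isotSeries (-1) X d, w⁆ := by
  have h : thetaOf c.vec ⁅c.rightField X, c.leftField w⁆ + ⁅c.isotSeries (-1) X, const w⁆ =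
      ⁅c.isotSeries (-1) X, c.isotSeries 1 w⁆ + act (c.leftField w) (c.isotSeries (-1) X) -
        act (c.rightField X) (c.isotSeries 1 w) := by
    rw [thetaOf_lie]
    nth_rewrite 1 [thetaOf_leftField]
    nth_rewrite 1 [thetaOf_rightField]
    rw [map_sub, map_sub, act_const, act_conj, thetaOf_rightField, sub_lie,
      ← lie_skew (conj c.vec X), thetaOf_leftField, lie_sub (c.isotSeries (-1) X)]
    abel
  rw [omega_apply, ← lie_const, eq_neg_iff_add_eq_zero, ← map_add, ← VSeries.add_apply, h,
    c.proj_eq_zero_iff]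
  exact sub_mem (add_mem (c.lie_mem (c.isotSeries_mem _ _) (c.isotSeries_mem _ _) d)
    (c.act_mem _ (c.isotSeries_mem _ _) d)) (c.act_mem _ (c.isotSeries_mem _ _) d)

/-- The terms with e^{-ad v} cancel in θ of the defect because e^{-ad v} preserves brackets and is
differentiated through θ. What is left is i-valued, hence invisible to ω, and ω detects every field.
-/
theorem rightField_lie (X Y : L) : c.rightField ⁅X, Y⁆ = ⁅c.rightField Y, c.rightField X⁆ := by
  rw [← lie_skew (c.rightField Y), ← add_eq_zero_iff_eq_neg]
  refine c.eq_zero_of_omega_eq_zero fun d => ?_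
  have h : thetaOf c.vec (c.rightField ⁅X, Y⁆ + ⁅c.rightField X, c.rightField Y⁆) =
      ⁅c.isotSeries (-1) X, c.isotSeries (-1) Y⁆ + act (c.rightField Y) (c.isotSeries (-1) X) -
        act (c.rightField X) (c.isotSeries (-1) Y) - c.isotSeries (-1) ⁅X, Y⁆ := by
    rw [map_add, thetaOf_lie]
    simp only [thetaOf_rightField, map_sub, act_conj, sub_lie, lie_sub, conj_lie]
    rw [← lie_skew Y X, map_neg, ← lie_skew (conj c.vec X) (c.isotSeries (-1) Y)]
    abel
  rw [omega_apply, h, c.proj_eq_zero_iff]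
  exact sub_mem (sub_mem (add_mem (c.lie_mem (c.isotSeries_mem _ _) (c.isotSeries_mem _ _) d)
    (c.act_mem _ (c.isotSeries_mem _ _) d)) (c.act_mem _ (c.isotSeries_mem _ _) d))
    (c.isotSeries_mem _ _ d)

theorem value_lie_leftField {w w' : L} (hw : w ∈ c.V) (hw' : w' ∈ c.V) :
    c.value ⁅c.leftField w, c.leftField w'⁆ = c.proj ⁅w, w'⁆ := by
  have h0 {w : L} (hw : w ∈ c.V) : thetaOf c.vec (c.leftField w) 0 = w := by
    rw [← value_eq_thetaOf, value_leftField, c.proj_of_mem hw]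
  rw [← omega_zero, omega_apply, thetaOf_lie, VSeries.add_apply, lie_zero_coeff, h0 hw, h0 hw', map_add,
    thetaOf_leftField, thetaOf_leftField, map_sub, map_sub, act_const, act_const, zero_sub, zero_sub,
    VSeries.sub_apply, VSeries.neg_apply, VSeries.neg_apply, c.proj_of_mem_isot, zero_add]
  exact sub_mem (neg_mem (c.act_mem _ (c.isotSeries_mem _ _) 0))
    (neg_mem (c.act_mem _ (c.isotSeries_mem _ _) 0))

theorem ker_rightField_le {X : L} (h : c.rightField X = 0) : X ∈ i := by
  rw [← c.proj_eq_zero_iff, ← value_rightField, h, map_zero]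

end FormalChart

/-! ### Naturality of the formal fields under homomorphisms. -/

namespace FormalChart

variable {L L' : Type u} [LieRing L] [LieAlgebra ℝ L] {i : LieSubalgebra ℝ L}
  [LieRing L'] [LieAlgebra ℝ L'] {i' : LieSubalgebra ℝ L'} (c : FormalChart i)

/-- The chart with the same index set given by a basis of another complement. -/
abbrev transport (V' : Submodule ℝ L') (hV' : IsCompl V' i'.toSubmodule)
    (b' : Module.Basis c.ι ℝ V') : FormalChart i' where
  V := V'
  isCompl := hV'
  ι := c.ι
  basis := b'

section Naturality

variable {V' : Submodule ℝ L'} {hV' : IsCompl V' i'.toSubmodule} {b' : Module.Basis c.ι ℝ V'}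
  {f : L →ₗ⁅ℝ⁆ L'}

theorem transport_proj (hb : ∀ k, (b' k : L') = f (c.basis k)) (hi : ∀ x ∈ i, f x ∈ i') (x : L) :
    (c.transport V' hV' b').proj (f x) = f (c.proj x) := by
  have h1 : f (c.proj x) ∈ V' := by
    rw [proj_eq_sum, map_sum]
    refine Submodule.sum_mem _ fun k _ => ?_
    rw [map_smul, vec, ← hb]
    exact V'.smul_mem _ (b' k).2
  rw [← (c.transport V' hV' b').proj_of_mem h1, ← sub_eq_zero, ← map_sub, ← map_sub,
    proj_eq_zero_iff]
  exact hi _ (c.sub_proj_mem x)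

theorem transport_coord (hb : ∀ k, (b' k : L') = f (c.basis k)) (hi : ∀ x ∈ i, f x ∈ i') (k : c.ι)
    (x : L) : (c.transport V' hV' b').coord k (f x) = c.coord k x := by
  classical
  rw [← coord_proj, c.transport_proj hb hi, proj_eq_sum, map_sum, map_sum,
    Finset.sum_eq_single k]
  · have := (c.transport V' hV' b').coord_vec k k
    rw [if_pos rfl] at this
    rw [map_smul, map_smul, vec, ← hb, smul_eq_mul]
    exact (congrArg _ this).trans (mul_one _)
  · intro j _ hj
    have := (c.transport V' hV' b').coord_vec k j
    rw [if_neg hj] at this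
    rw [map_smul, map_smul, vec, ← hb, smul_eq_mul]
    exact (congrArg _ this).trans (mul_zero _)
  · simp

/-- Composition of polynomial maps with a homomorphism of Lie algebras. -/
def compPoly (f : L →ₗ⁅ℝ⁆ L') :
    MvPolynomial c.ι ℝ ⊗[ℝ] L →ₗ[ℝ] MvPolynomial c.ι ℝ ⊗[ℝ] L' :=
  LinearMap.lTensor (MvPolynomial c.ι ℝ) (f : L →ₗ[ℝ] L')

theorem adGeneric_tmul (p : MvPolynomial c.ι ℝ) (x : L) :
    c.adGeneric (p ⊗ₜ x) = ∑ k, (MvPolynomial.X k * p) ⊗ₜ[ℝ] ⁅c.vec k, x⁆ := by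
  rw [adGeneric, generic, map_sum, LinearMap.sum_apply]
  rfl

theorem transport_adGeneric (hb : ∀ k, (b' k : L') = f (c.basis k)) (z : c.PolyMap) :
    (c.transport V' hV' b').adGeneric (c.compPoly f z) = c.compPoly f (c.adGeneric z) := by
  induction z using TensorProduct.induction_on with
  | zero => simp only [map_zero]
  | add a a' h h' => simp only [map_add, h, h']
  | tmul p x =>
    rw [adGeneric_tmul, map_sum, compPoly, LinearMap.lTensor_tmul, adGeneric_tmul]
    refine Finset.sum_congr rfl fun k _ => ?_
    rw [LinearMap.lTensor_tmul, vec, vec, hb]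
    simp

theorem transport_adGeneric_pow (hb : ∀ k, (b' k : L') = f (c.basis k)) (n : ℕ) (z : c.PolyMap) :
    ((c.transport V' hV' b').adGeneric ^ n) (c.compPoly f z) =
      c.compPoly f ((c.adGeneric ^ n) z) := by
  induction n with
  | zero => rfl
  | succ n ih =>
    rw [pow_succ', Module.End.mul_apply, ih, c.transport_adGeneric hb, pow_succ',
      Module.End.mul_apply]

theorem transport_isotPart (hb : ∀ k, (b' k : L') = f (c.basis k)) (hi : ∀ x ∈ i, f x ∈ i')
    (z : c.PolyMap) :
    LinearMap.lTensor (MvPolynomial c.ι ℝ) (c.transport V' hV' b').isotPart (c.compPoly f z) =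
      c.compPoly f (LinearMap.lTensor (MvPolynomial c.ι ℝ) c.isotPart z) := by
  rw [compPoly, ← LinearMap.comp_apply, ← LinearMap.comp_apply, ← LinearMap.lTensor_comp,
    ← LinearMap.lTensor_comp]
  congr 2
  ext x
  simp [isotPart_apply, c.transport_proj hb hi]

/-- The recursion uses only ad(v), the projection along the isotropy and rational constants. All of
these are respected by a homomorphism sending basis to basis and isotropy into isotropy. -/
theorem transport_term (hb : ∀ k, (b' k : L') = f (c.basis k)) (hi : ∀ x ∈ i, f x ∈ i') (ε : ℝ)
    (n : ℕ) (X : L) :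
    (c.transport V' hV' b').term ε n (f X) = c.compPoly f (c.term ε n X) := by
  induction n using Nat.strong_induction_on with
  | _ n ih =>
    rw [term, term, LinearMap.sub_apply, LinearMap.sub_apply, map_sub]
    congr 1
    · rw [LinearMap.smul_apply, LinearMap.smul_apply, map_smul, LinearMap.comp_apply,
        LinearMap.comp_apply, ← c.transport_adGeneric_pow hb]
      rfl
    · rw [LinearMap.sum_apply, LinearMap.sum_apply, map_sum]
      refine Finset.sum_congr rfl fun r _ => ?_
      rw [LinearMap.smul_apply, LinearMap.smul_apply, map_smul, LinearMap.comp_apply,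
        LinearMap.comp_apply, LinearMap.comp_apply, LinearMap.comp_apply,
        ih (n - 1 - r) (by omega), ← c.transport_adGeneric_pow hb, ← c.transport_isotPart hb hi]

theorem transport_series (hb : ∀ k, (b' k : L') = f (c.basis k)) (hi : ∀ x ∈ i, f x ∈ i') (ε : ℝ)
    (k : c.ι) (X : L) :
    (c.transport V' hV' b').series ε k (f X) = c.series ε k X := by
  ext d
  change MvPolynomial.coeff d ((c.transport V' hV' b').termCoord ε k d.degree (f X)) =
    MvPolynomial.coeff d (c.termCoord ε k d.degree X)
  congr 1
  rw [termCoord, termCoord, LinearMap.comp_apply, LinearMap.comp_apply, LinearMap.comp_apply,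
    LinearMap.comp_apply, c.transport_term hb hi, compPoly, ← LinearMap.comp_apply
      (LinearMap.lTensor _ ((c.transport V' hV' b').coord k)), ← LinearMap.lTensor_comp]
  congr 3
  ext x
  exact c.transport_coord hb hi k x

/-- Both charts have the same variables, so the two fields live in the same Lie algebra and can be
compared as elements. All uniqueness and universality below rests on this equality. -/
theorem transport_field (hb : ∀ k, (b' k : L') = f (c.basis k)) (hi : ∀ x ∈ i, f x ∈ i') (ε : ℝ)
    (X : L) : ((c.transport V' hV' b').field ε (f X) : c.Der) = c.field ε X :=
  Finset.sum_congr rfl fun k _ => by rw [c.transport_series hb hi]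

theorem transport_value (hb : ∀ k, (b' k : L') = f (c.basis k)) (D : c.Der) :
    (c.transport V' hV' b').value D = f (c.value D) := by
  change ∑ k, _ = f (∑ k, _)
  rw [map_sum]
  refine Finset.sum_congr rfl fun k _ => ?_
  rw [map_smul]
  exact congrArg _ (hb k)

end Naturality

section Push

variable (f : L →ₗ⁅ℝ⁆ L') (hi : i.toSubmodule ≤ i'.toSubmodule.comap (f : L →ₗ[ℝ] L'))

theorem mem_isot_iff
    (hbij : Function.Bijective (Submodule.mapQ i.toSubmodule i'.toSubmodule (f : L →ₗ[ℝ] L') hi))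
    {x : L} : f x ∈ i' ↔ x ∈ i := by
  refine ⟨fun h => ?_, fun h => hi h⟩
  have : Submodule.mapQ i.toSubmodule i'.toSubmodule (f : L →ₗ[ℝ] L') hi
      (Submodule.Quotient.mk x) = 0 := by
    rw [Submodule.mapQ_apply, Submodule.Quotient.mk_eq_zero]
    exact h
  have h1 := hbij.1 (this.trans (map_zero _).symm)
  rwa [Submodule.Quotient.mk_eq_zero] at h1

theorem exists_sub_mem_isot
    (hbij : Function.Bijective (Submodule.mapQ i.toSubmodule i'.toSubmodule (f : L →ₗ[ℝ] L') hi))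
    (y : L') : ∃ x, y - f x ∈ i' := by
  obtain ⟨q, hq⟩ := hbij.2 (Submodule.Quotient.mk y)
  obtain ⟨x, rfl⟩ := Submodule.Quotient.mk_surjective _ q
  rw [Submodule.mapQ_apply, eq_comm, Submodule.Quotient.eq] at hq
  exact ⟨x, hq⟩

theorem isCompl_map
    (hbij : Function.Bijective (Submodule.mapQ i.toSubmodule i'.toSubmodule (f : L →ₗ[ℝ] L') hi)) :
    IsCompl (c.V.map (f : L →ₗ[ℝ] L')) i'.toSubmodule := by
  constructor
  · rw [Submodule.disjoint_def]
    rintro _ ⟨v, hv, rfl⟩ h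
    have h1 : v ∈ i := (mem_isot_iff f hi hbij).mp h
    rw [← c.proj_of_mem hv, c.proj_of_mem_isot h1, map_zero]
  · rw [codisjoint_iff, eq_top_iff]
    intro y _
    obtain ⟨x, hx⟩ := exists_sub_mem_isot f hi hbij y
    rw [Submodule.mem_sup]
    refine ⟨f (c.proj x), ⟨_, c.proj_mem x, rfl⟩, y - f (c.proj x), ?_, by abel⟩
    have : y - f (c.proj x) = (y - f x) + f (x - c.proj x) := by rw [map_sub]; abel
    rw [this]
    exact add_mem hx (hi (c.sub_proj_mem x))

end Push

/-- The image of a chart under an injective homomorphism inducing a bijection modulo the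
isotropy subalgebras. -/
abbrev push (f : L →ₗ⁅ℝ⁆ L') (hf : Function.Injective f)
    (hi : i.toSubmodule ≤ i'.toSubmodule.comap (f : L →ₗ[ℝ] L'))
    (hbij : Function.Bijective (Submodule.mapQ i.toSubmodule i'.toSubmodule (f : L →ₗ[ℝ] L') hi)) :
    FormalChart i' :=
  c.transport (c.V.map (f : L →ₗ[ℝ] L')) (c.isCompl_map f hi hbij)
    (c.basis.map (Submodule.equivMapOfInjective (f : L →ₗ[ℝ] L') hf c.V))

theorem push_basis (f : L →ₗ⁅ℝ⁆ L') (hf : Function.Injective f)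
    (hi : i.toSubmodule ≤ i'.toSubmodule.comap (f : L →ₗ[ℝ] L'))
    (hbij : Function.Bijective (Submodule.mapQ i.toSubmodule i'.toSubmodule (f : L →ₗ[ℝ] L') hi))
    (k : c.ι) : ((c.push f hf hi hbij).basis k : L') = f (c.basis k) := by
  simp [push]

theorem exists_formalChart (i : LieSubalgebra ℝ L) [FiniteDimensional ℝ (L ⧸ i.toSubmodule)] :
    Nonempty (FormalChart i) := by
  obtain ⟨V, hV⟩ := Submodule.exists_isCompl i.toSubmodule
  have e := Submodule.quotientEquivOfIsCompl _ _ hV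
  have : FiniteDimensional ℝ V := e.finiteDimensional
  exact ⟨⟨V, hV.symm, ULift (Fin (Module.finrank ℝ V)),
    (Module.finBasis ℝ V).reindex Equiv.ulift.symm⟩⟩

end FormalChart

/-! ### Linear compactness of products of lines. -/

section LinearCompactness

/-- A closed affine subspace of `ℝ^κ` not containing a point is contained in a hyperplane given by
finitely many coordinates that does not contain the point. -/
theorem exists_linearCombination_separating {κ : Type*} (A : AffineSubspace ℝ (κ → ℝ))
    (hA : IsClosed (A : Set (κ → ℝ))) (hne : (A : Set (κ → ℝ)).Nonempty) {x : κ → ℝ}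
    (hx : x ∉ A) : ∃ (f : κ →₀ ℝ) (r : ℝ), (∀ a ∈ A, f.sum (fun k s => s * a k) = r) ∧
      f.sum (fun k s => s * x k) ≠ r := by
  obtain ⟨g, s, hg, hgx⟩ := geometric_hahn_banach_closed_point A.convex hA hx
  obtain ⟨a₀, ha₀⟩ := hne
  -- A linear functional bounded above on an affine space is constant there, since it would be
  -- unbounded along a line on which it varies.
  have hconst : ∀ a ∈ A, g a = g a₀ := by
    intro a ha
    by_contra hne
    have h1 (t : ℝ) : g a₀ + t * (g a - g a₀) < s := by
      have := hg _ (AffineMap.lineMap_mem t ha₀ ha)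
      rw [AffineMap.lineMap_apply_module'] at this
      simp only [map_add, map_smul, map_sub, smul_eq_mul] at this
      linarith
    have h2 := h1 ((s - g a₀) / (g a - g a₀))
    rw [div_mul_cancel₀ _ (sub_ne_zero.mpr hne)] at h2
    linarith
  -- A functional continuous for the product topology is a finite combination of coordinates.
  have hspan : (g : (κ → ℝ) →ₗ[ℝ] ℝ) ∈ Submodule.span ℝ (Set.range fun k : κ =>
      (LinearMap.proj k : (κ → ℝ) →ₗ[ℝ] ℝ)) := by
    rw [LinearMap.mem_span_iff_continuous]
    exact g.continuous
  rw [Finsupp.mem_span_range_iff_exists_finsupp] at hspan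
  obtain ⟨f, hf⟩ := hspan
  have hf' (y : κ → ℝ) : f.sum (fun k s => s * y k) = g y := by
    have := LinearMap.congr_fun hf y
    rw [Finsupp.sum, LinearMap.sum_apply] at this
    exact this
  refine ⟨f, g a₀, fun a ha => by rw [hf', hconst a ha], ?_⟩
  rw [hf']
  exact ((hg _ ha₀).trans hgx).ne'

/-- The product `ℝ^κ` is linearly compact. -/
theorem pi_nonempty_sInter {κ : Type*} (𝒜 : Set (AffineSubspace ℝ (κ → ℝ)))
    (hcl : ∀ A ∈ 𝒜, IsClosed (A : Set (κ → ℝ)))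
    (hfip : ∀ S : Finset (AffineSubspace ℝ (κ → ℝ)), (S : Set (AffineSubspace ℝ (κ → ℝ))) ⊆ 𝒜 →
      (⋂ A ∈ S, (A : Set (κ → ℝ))).Nonempty) :
    (⋂ A ∈ 𝒜, (A : Set (κ → ℝ))).Nonempty := by
  classical
  -- G is the space of linear equations f = r that hold on some finite intersection of members. The
  -- finite intersection property says that the contradictory equation 0 = 1 is not among them.
  let G : Submodule ℝ ((κ →₀ ℝ) × ℝ) :=
    { carrier := {p | ∃ S : Finset (AffineSubspace ℝ (κ → ℝ)),
        (S : Set (AffineSubspace ℝ (κ → ℝ))) ⊆ 𝒜 ∧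
        ∀ x ∈ ⋂ A ∈ S, (A : Set (κ → ℝ)), p.1.sum (fun k s => s * x k) = p.2}
      zero_mem' := ⟨∅, by simp, by simp⟩
      add_mem' := by
        rintro p q ⟨S, hS, hp⟩ ⟨S', hS', hq⟩
        refine ⟨S ∪ S', by simp [hS, hS'], fun x hx => ?_⟩
        simp only [Set.mem_iInter, Finset.mem_union] at hx hp hq
        rw [Prod.fst_add, Finsupp.sum_add_index' (by simp) (by intros; ring),
          hp x fun A hA => hx A (Or.inl hA), hq x fun A hA => hx A (Or.inr hA), Prod.snd_add]
      smul_mem' := by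
        rintro r p ⟨S, hS, hp⟩
        refine ⟨S, hS, fun x hx => ?_⟩
        rw [Prod.smul_fst, Finsupp.sum_smul_index' (by simp), Prod.smul_snd, ← hp x hx,
          Finsupp.smul_sum]
        simp [mul_assoc] }
  have hG : ((0, 1) : (κ →₀ ℝ) × ℝ) ∉ G := by
    rintro ⟨S, hS, h⟩
    obtain ⟨x, hx⟩ := hfip S hS
    simpa using h x hx
  obtain ⟨φ, hφ, hle⟩ := Submodule.exists_le_ker_of_notMem hG
  -- The point is normalized so that the vanishing of φ at (f, r) means exactly f(x) = r; thus x
  -- solves every equation in G.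
  let x : κ → ℝ := fun k => -φ (Finsupp.single k 1, 0) / φ (0, 1)
  have hx (f : κ →₀ ℝ) : f.sum (fun k s => s * x k) = -φ (f, 0) / φ (0, 1) := by
    have h1 : φ (f, 0) = f.sum fun k s => s * φ (Finsupp.single k 1, 0) := by
      have h2 : (f, (0 : ℝ)) = LinearMap.inl ℝ (κ →₀ ℝ) ℝ f := rfl
      conv_lhs => rw [h2, ← Finsupp.sum_single f]
      rw [Finsupp.sum, map_sum, map_sum]
      refine Finset.sum_congr rfl fun k _ => ?_
      rw [← mul_one (f k), ← smul_eq_mul (f k) 1, ← Finsupp.smul_single, map_smul, map_smul]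
      simp
    rw [h1, Finsupp.sum, Finsupp.sum, ← Finset.sum_neg_distrib, Finset.sum_div]
    exact Finset.sum_congr rfl fun k _ => by simp only [x]; ring
  refine ⟨x, ?_⟩
  simp only [Set.mem_iInter]
  intro A hA
  by_contra hxA
  have hsub : ((({A} : Finset (AffineSubspace ℝ (κ → ℝ))) : Set (AffineSubspace ℝ (κ → ℝ)))) ⊆ 𝒜 := by
    simpa using hA
  have hne := hfip {A} hsub
  simp only [Finset.mem_singleton, Set.iInter_iInter_eq_left] at hne
  obtain ⟨f, r, hf, hr⟩ := exists_linearCombination_separating A (hcl A hA) hne hxA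
  have hmem : (f, r) ∈ G := ⟨{A}, hsub, fun y hy => hf y (by simpa using hy)⟩
  have h0 : φ (f, r) = 0 := hle hmem
  have h1 : (f, r) = (f, (0 : ℝ)) + r • ((0, 1) : (κ →₀ ℝ) × ℝ) := by ext <;> simp
  rw [h1, map_add, map_smul, smul_eq_mul] at h0
  apply hr
  rw [hx, div_eq_iff hφ]
  linarith

variable {M : Type*} [AddCommGroup M] [Module ℝ M] [TopologicalSpace M] {κ : Type*}
  (T : M →ₗ[ℝ] (κ → ℝ))

theorem nonempty_sInter_of_closed_range (hT : Topology.IsInducing T)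
    (hinj : Function.Injective T) (hcl : IsClosed (Set.range T))
    (𝒜 : Set (AffineSubspace ℝ M)) (hA : ∀ A ∈ 𝒜, IsClosed (A : Set M))
    (hfip : ∀ S : Finset (AffineSubspace ℝ M), (S : Set (AffineSubspace ℝ M)) ⊆ 𝒜 →
      (⋂ A ∈ S, (A : Set M)).Nonempty) :
    (⋂ A ∈ 𝒜, (A : Set M)).Nonempty := by
  classical
  -- A member is needed to know that the common point found in the product lies in the range of T.
  rcases 𝒜.eq_empty_or_nonempty with rfl | ⟨A₀, hA₀⟩
  · simp
  have hemb : Topology.IsClosedEmbedding T := ⟨⟨hT, hinj⟩, hcl⟩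
  have hcoe (A : AffineSubspace ℝ M) :
      ((A.map T.toAffineMap : AffineSubspace ℝ (κ → ℝ)) : Set (κ → ℝ)) = T '' A := by
    simp
  obtain ⟨y, hy⟩ := pi_nonempty_sInter ((fun A => A.map T.toAffineMap) '' 𝒜)
    (by
      rintro _ ⟨A, hA', rfl⟩
      simp only [hcoe]
      exact hemb.isClosedMap _ (hA A hA'))
    (by
      intro S hS
      obtain ⟨S', hS', rfl⟩ := (Finset.subset_set_image_iff).mp hS
      obtain ⟨x, hx⟩ := hfip S' hS'
      refine ⟨T x, ?_⟩
      simp only [Set.mem_iInter, Finset.mem_image] at hx ⊢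
      rintro _ ⟨A, hAS, rfl⟩
      rw [hcoe]
      exact ⟨x, hx A hAS, rfl⟩)
  simp only [Set.mem_iInter] at hy
  have h0 := hy _ ⟨A₀, hA₀, rfl⟩
  rw [hcoe] at h0
  obtain ⟨x, -, rfl⟩ := h0
  refine ⟨x, ?_⟩
  simp only [Set.mem_iInter]
  intro A hA'
  have h1 := hy _ ⟨A, hA', rfl⟩
  rw [hcoe] at h1
  obtain ⟨x', hx', h2⟩ := h1
  rwa [← hinj h2]

end LinearCompactness

/-! ### Closed subspaces of finite codimension. -/

section FiniteCodimension

variable {M : Type*} [AddCommGroup M] [Module ℝ M] [TopologicalSpace M]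
  [IsTopologicalAddGroup M] [ContinuousSMul ℝ M] {p : Submodule ℝ M}

/-- The map factors through the quotient by p, which is finite dimensional and Hausdorff, so that
every linear map on it is continuous. -/
theorem continuous_of_le_ker {N : Type*} [AddCommGroup N] [Module ℝ N] [TopologicalSpace N]
    [IsTopologicalAddGroup N] [ContinuousSMul ℝ N] (hp : IsClosed (p : Set M))
    [FiniteDimensional ℝ (M ⧸ p)] (f : M →ₗ[ℝ] N) (hf : p ≤ LinearMap.ker f) :
    Continuous f := by
  have : IsClosed (p : Set M) := hp
  have : T3Space (M ⧸ p) := inferInstance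
  have h1 : Continuous (p.liftQ f hf) := LinearMap.continuous_of_finiteDimensional _
  exact h1.comp continuous_quot_mk

theorem isClosed_of_le (hp : IsClosed (p : Set M)) [FiniteDimensional ℝ (M ⧸ p)]
    {q : Submodule ℝ M} (h : p ≤ q) : IsClosed (q : Set M) := by
  have : T3Space (M ⧸ p) := inferInstance
  have h1 : IsClosed ((q.map p.mkQ : Submodule ℝ (M ⧸ p)) : Set (M ⧸ p)) :=
    Submodule.closed_of_finiteDimensional _
  have h2 : (q : Set M) = p.mkQ ⁻¹' (q.map p.mkQ : Submodule ℝ (M ⧸ p)) := by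
    rw [← Submodule.comap_coe, Submodule.comap_map_mkQ, sup_eq_right.mpr h]
  rw [h2]
  exact h1.preimage continuous_quot_mk

theorem finiteDimensional_quotient_of_le [FiniteDimensional ℝ (M ⧸ p)] {q : Submodule ℝ M}
    (h : p ≤ q) : FiniteDimensional ℝ (M ⧸ q) :=
  Module.Finite.of_surjective (Submodule.factor h) (Submodule.factor_surjective h)

end FiniteCodimension

/-! ### The coefficientwise topology on formal vector fields. -/

namespace VSeries

open scoped MvPowerSeries.WithPiTopology

open MvPowerSeries (X pderiv)

variable {ι : Type*} [Fintype ι]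

/-- The coefficients of a formal vector field. -/
def derCoeff : Derivation ℝ (MvPowerSeries ι ℝ) (MvPowerSeries ι ℝ) →ₗ[ℝ]
    (ι × (ι →₀ ℕ) → ℝ) where
  toFun D p := MvPowerSeries.coeff p.2 (D (X p.1))
  map_add' D E := by ext p; simp
  map_smul' r D := by ext p; simp

theorem derCoeff_injective : Function.Injective (derCoeff (ι := ι)) := fun _ _ h =>
  derivation_ext fun k => MvPowerSeries.ext fun d => congrFun h (k, d)

theorem derCoeff_surjective : Function.Surjective (derCoeff (ι := ι)) := fun g => by
  refine ⟨∑ k, (show MvPowerSeries ι ℝ from fun d => g (k, d)) • pderiv ℝ k, ?_⟩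
  ext ⟨k, d⟩
  change MvPowerSeries.coeff d ((∑ k, _ • pderiv ℝ k) (X k)) = _
  rw [sum_smul_pderiv_X]
  rfl

/-- Convergence of all the coefficients of formal vector fields. -/
instance : TopologicalSpace (Derivation ℝ (MvPowerSeries ι ℝ) (MvPowerSeries ι ℝ)) :=
  TopologicalSpace.induced derCoeff inferInstance

theorem isInducing_derCoeff : Topology.IsInducing (derCoeff (ι := ι)) := ⟨rfl⟩

instance : IsTopologicalAddGroup (Derivation ℝ (MvPowerSeries ι ℝ) (MvPowerSeries ι ℝ)) :=
  topologicalAddGroup_induced _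

instance : ContinuousSMul ℝ (Derivation ℝ (MvPowerSeries ι ℝ) (MvPowerSeries ι ℝ)) :=
  isInducing_derCoeff.continuousSMul continuous_id (map_smul _ _ _)

instance : T2Space (Derivation ℝ (MvPowerSeries ι ℝ) (MvPowerSeries ι ℝ)) :=
  (⟨isInducing_derCoeff, derCoeff_injective⟩ : Topology.IsEmbedding _).t2Space

theorem isClosedEmbedding_derCoeff : Topology.IsClosedEmbedding (derCoeff (ι := ι)) where
  toIsInducing := isInducing_derCoeff
  injective := derCoeff_injective
  isClosed_range := by rw [derCoeff_surjective.range_eq]; exact isClosed_univ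

theorem continuous_der_iff {Y : Type*} [TopologicalSpace Y]
    {g : Y → Derivation ℝ (MvPowerSeries ι ℝ) (MvPowerSeries ι ℝ)} :
    Continuous g ↔ ∀ k d, Continuous fun y => MvPowerSeries.coeff d (g y (X k)) := by
  rw [isInducing_derCoeff.continuous_iff, continuous_pi_iff]
  exact ⟨fun h k d => h (k, d), fun h p => h p.1 p.2⟩

theorem continuous_coeff_der (k : ι) (d) : Continuous fun
    D : Derivation ℝ (MvPowerSeries ι ℝ) (MvPowerSeries ι ℝ) => MvPowerSeries.coeff d (D (X k)) :=
  continuous_der_iff.mp continuous_id k d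

theorem continuous_der_X (k : ι) : Continuous fun
    D : Derivation ℝ (MvPowerSeries ι ℝ) (MvPowerSeries ι ℝ) => D (X k) :=
  continuous_pi fun d => continuous_coeff_der k d

theorem continuous_pderiv (k : ι) :
    Continuous (pderiv ℝ k : MvPowerSeries ι ℝ → MvPowerSeries ι ℝ) := by
  refine continuous_pi fun d => ?_
  change Continuous fun f => MvPowerSeries.coeff d (pderiv ℝ k f)
  simp only [MvPowerSeries.coeff_pderiv]
  exact (MvPowerSeries.WithPiTopology.continuous_coeff ℝ _).mul continuous_const

theorem continuous_der_apply : Continuous fun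
    p : Derivation ℝ (MvPowerSeries ι ℝ) (MvPowerSeries ι ℝ) × MvPowerSeries ι ℝ => p.1 p.2 := by
  simp only [fun p : Derivation ℝ (MvPowerSeries ι ℝ) (MvPowerSeries ι ℝ) × MvPowerSeries ι ℝ =>
    derivation_apply p.1 p.2]
  exact continuous_finsetSum _ fun k _ => ((continuous_der_X k).comp continuous_fst).mul
    ((continuous_pderiv k).comp continuous_snd)

theorem continuous_der_lie : Continuous fun
    p : Derivation ℝ (MvPowerSeries ι ℝ) (MvPowerSeries ι ℝ) ×
      Derivation ℝ (MvPowerSeries ι ℝ) (MvPowerSeries ι ℝ) => ⁅p.1, p.2⁆ := by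
  rw [continuous_der_iff]
  intro k d
  simp only [Derivation.commutator_apply]
  refine (MvPowerSeries.WithPiTopology.continuous_coeff ℝ d).comp (Continuous.sub ?_ ?_)
  · exact continuous_der_apply.comp
      (continuous_fst.prodMk ((continuous_der_X k).comp continuous_snd))
  · exact continuous_der_apply.comp
      (continuous_snd.prodMk ((continuous_der_X k).comp continuous_fst))

/-- A coefficient of θ(D) is a finite combination, with fixed vectors, of finitely many coefficients
of D. No topology on L is involved. -/
theorem continuous_linear_thetaOf {L : Type*} [LieRing L] [LieAlgebra ℝ L] (b : ι → L)
    (ℓ : L →ₗ[ℝ] ℝ) (d) : Continuous fun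
    D : Derivation ℝ (MvPowerSeries ι ℝ) (MvPowerSeries ι ℝ) => ℓ (thetaOf b D d) := by
  classical
  simp only [thetaOf_def, sum_apply, mv_smul_apply, map_sum, map_smul, smul_eq_mul]
  exact continuous_finsetSum _ fun k _ => continuous_finsetSum _ fun p _ =>
    (continuous_coeff_der k _).mul continuous_const

section Values

variable {Y L : Type*} [TopologicalSpace Y] [LieRing L] [LieAlgebra ℝ L] [TopologicalSpace L]

theorem continuous_adGen_pow [IsTopologicalAddGroup L]
    (hL : Continuous fun p : L × L => ⁅p.1, p.2⁆) (b : ι → L) (n : ℕ) {a : Y → VSeries ι L}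
    (ha : ∀ d, Continuous fun y => a y d) (d) :
    Continuous fun y => (adGen b ^ n) (a y) d := by
  classical
  induction n generalizing d with
  | zero => exact ha d
  | succ n ih =>
    simp only [pow_succ', Module.End.mul_apply, adGen_apply, lie_apply]
    exact continuous_finsetSum _ fun p _ => hL.comp (continuous_const.prodMk (ih _))

end Values

end VSeries

/-! ### Continuity of the formal fields in X. -/

namespace FormalChart

open VSeries hiding add_apply sub_apply neg_apply zero_apply smul_apply sum_apply

variable {L : Type u} [LieRing L] [LieAlgebra ℝ L] {i : LieSubalgebra ℝ L} (c : FormalChart i)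

theorem continuous_coord_omega (k : c.ι) (d) : Continuous fun D : c.Der => c.coord k (c.omega d D) :=
  continuous_linear_thetaOf c.vec (c.coord k ∘ₗ c.proj) d

variable [TopologicalSpace L] [FiniteDimensional ℝ (L ⧸ i.toSubmodule)]

theorem continuous_coord (hL : IsLinearlyCompactLieAlgebra L)
    (hi : IsClosed (i : Set L)) (k : c.ι) : Continuous (c.coord k) := by
  have := hL.isTopologicalAddGroup
  have := hL.continuousSMul
  refine continuous_of_le_ker (p := i.toSubmodule) hi (c.coord k) fun x hx => ?_
  rw [LinearMap.mem_ker, ← coord_proj, c.proj_of_mem_isot hx, map_zero]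

theorem continuous_isotPart (hL : IsLinearlyCompactLieAlgebra L)
    (hi : IsClosed (i : Set L)) : Continuous c.isotPart := by
  have := hL.isTopologicalAddGroup
  have := hL.continuousSMul
  have h (x : L) : c.isotPart x = x - ∑ k, c.coord k x • c.vec k := by
    rw [isotPart_apply, proj_eq_sum]
  rw [funext h]
  exact continuous_id.sub (continuous_finsetSum _ fun k _ =>
    (c.continuous_coord hL hi k).smul continuous_const)

/-- Induction along the recursion: ad(v) acts by continuous brackets with fixed vectors, and the
projection along the closed isotropy is continuous by finite codimension. -/
theorem continuous_term (hL : IsLinearlyCompactLieAlgebra L)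
    (hi : IsClosed (i : Set L)) (ε : ℝ) (n : ℕ) (d) :
    Continuous fun X => c.toVSeries (c.term ε n X) d := by
  have := hL.isTopologicalAddGroup
  have := hL.continuousSMul
  induction n using Nat.strong_induction_on generalizing d with
  | _ n ih =>
    have h (X : L) : c.toVSeries (c.term ε n X) d =
        (ε ^ n * bchCoeff n) • (adGen c.vec ^ n) (const X) d -
          ∑ r : Fin n, bchCoeff (r + 1) • (adGen c.vec ^ ((r : ℕ) + 1))
            (VSeries.map c.isotPart (c.toVSeries (c.term ε (n - 1 - r) X))) d := by
      rw [term]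
      simp only [LinearMap.sub_apply, LinearMap.sum_apply, LinearMap.smul_apply, map_sub,
        map_sum, map_smul, LinearMap.comp_apply, toVSeries_adGeneric_pow, VSeries.sub_apply,
        VSeries.sum_apply, VSeries.smul_apply, toVSeries_lTensor, TensorProduct.mk_apply,
        toVSeries_one_tmul]
    simp only [h]
    refine Continuous.sub (.const_smul ?_ _) (continuous_finsetSum _ fun r _ => .const_smul ?_ _)
    · refine continuous_adGen_pow hL.continuous_lie c.vec n (fun d => ?_) d
      by_cases h : d = 0
      · subst h
        simp only [const_zero_apply]
        exact continuous_id
      · simp only [const_apply_of_ne _ h]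
        exact continuous_const
    · refine continuous_adGen_pow hL.continuous_lie c.vec _ (fun d => ?_) d
      exact (c.continuous_isotPart hL hi).comp (ih _ (by omega) d)

theorem continuous_field (hL : IsLinearlyCompactLieAlgebra L)
    (hi : IsClosed (i : Set L)) (ε : ℝ) : Continuous (c.field ε) := by
  rw [continuous_der_iff]
  intro k d
  simp only [field_X, coeff_series]
  exact (c.continuous_coord hL hi k).comp (c.continuous_term hL hi ε _ d)

end FormalChart

/-! ### The opposite of a closed Lie algebra of formal vector fields. -/

/-- The opposite of a Lie algebra of formal vector fields. -/
def OppositeLie {A : Type u} [LieRing A] [LieAlgebra ℝ A] (S : LieSubalgebra ℝ A) : Type u := S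

namespace OppositeLie

variable {A : Type u} [LieRing A] [LieAlgebra ℝ A] (S : LieSubalgebra ℝ A)

instance : AddCommGroup (OppositeLie S) := inferInstanceAs (AddCommGroup S)

instance : Module ℝ (OppositeLie S) := inferInstanceAs (Module ℝ S)

/-- The inclusion. -/
def incl : OppositeLie S →ₗ[ℝ] A := S.toSubmodule.subtype

theorem incl_injective : Function.Injective (incl S) := Subtype.val_injective

theorem incl_mem (x : OppositeLie S) : incl S x ∈ S := Subtype.property x

theorem range_incl : LinearMap.range (incl S) = S.toSubmodule := Submodule.range_subtype _

theorem exists_incl_eq {a : A} (h : a ∈ S) : ∃ x, incl S x = a := ⟨⟨a, h⟩, rfl⟩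

instance : Bracket (OppositeLie S) (OppositeLie S) :=
  ⟨fun x y => (⟨⁅incl S y, incl S x⁆, S.lie_mem (incl_mem S y) (incl_mem S x)⟩ : S)⟩

theorem incl_lie (x y : OppositeLie S) : incl S ⁅x, y⁆ = ⁅incl S y, incl S x⁆ := rfl

instance : LieRing (OppositeLie S) where
  add_lie x y z := incl_injective S (by simp [incl_lie])
  lie_add x y z := incl_injective S (by simp [incl_lie])
  lie_self x := incl_injective S (by simp [incl_lie])
  leibniz_lie x y z := incl_injective S (by
    rw [map_add]
    simp only [incl_lie]
    rw [leibniz_lie (incl S z) (incl S y), ← lie_skew (incl S y) ⁅incl S z, incl S x⁆]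
    abel)

instance : LieAlgebra ℝ (OppositeLie S) where
  lie_smul r x y := incl_injective S (by simp [incl_lie])

section Topology

open VSeries

variable {ι : Type u} [Fintype ι]
  {S : LieSubalgebra ℝ (Derivation ℝ (MvPowerSeries ι ℝ) (MvPowerSeries ι ℝ))}

instance : TopologicalSpace (OppositeLie S) := TopologicalSpace.induced (incl S) inferInstance

theorem isInducing_incl : Topology.IsInducing (incl S) := ⟨rfl⟩

theorem isLinearlyCompactLieAlgebra
    (hS : IsClosed (S : Set (Derivation ℝ (MvPowerSeries ι ℝ) (MvPowerSeries ι ℝ)))) :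
    IsLinearlyCompactLieAlgebra (OppositeLie S) where
  t2 := (⟨isInducing_incl, incl_injective S⟩ : Topology.IsEmbedding _).t2Space
  isTopologicalAddGroup := topologicalAddGroup_induced _
  continuousSMul := isInducing_incl.continuousSMul continuous_id (map_smul _ _ _)
  continuous_lie := by
    rw [isInducing_incl.continuous_iff]
    exact continuous_der_lie.comp ((isInducing_incl.continuous.comp continuous_snd).prodMk
      (isInducing_incl.continuous.comp continuous_fst))
  nonempty_sInter := by
    refine nonempty_sInter_of_closed_range (derCoeff ∘ₗ incl S)
      (isInducing_derCoeff.comp isInducing_incl)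
      (derCoeff_injective.comp (incl_injective S)) ?_
    rw [LinearMap.coe_comp, Set.range_comp]
    refine isClosedEmbedding_derCoeff.isClosedMap _ ?_
    rw [show Set.range (incl S) = (S : Set (Derivation ℝ (MvPowerSeries ι ℝ) (MvPowerSeries ι ℝ)))
      from Subtype.range_val]
    exact hS

end Topology

end OppositeLie

/-! ### Transitivity, lifting and uniqueness of homomorphisms. -/

namespace FormalChart

open MvPowerSeries (X constantCoeff pderiv)

variable {L : Type u} [LieRing L] [LieAlgebra ℝ L] {i : LieSubalgebra ℝ L} (c : FormalChart i)

/-- The kernel is an ideal because R* reverses brackets, and it lies in i because R*_X(0) = πX. -/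
theorem rightField_injective
    (hi : ∀ J : LieIdeal ℝ L, (J : Set L) ⊆ (i : Set L) → J = ⊥) :
    Function.Injective c.rightField := by
  let J : LieIdeal ℝ L :=
    { LinearMap.ker c.rightField with
      lie_mem := by
        intro x y hy
        change c.rightField ⁅x, y⁆ = 0
        have hy : c.rightField y = 0 := hy
        rw [rightField_lie, hy]
        exact zero_lie (c.rightField x) }
  have hJ : J = ⊥ := hi J fun x hx => c.ker_rightField_le hx
  rw [← LinearMap.ker_eq_bot, eq_bot_iff]
  intro x hx
  have h1 : x ∈ J := hx
  rw [hJ] at h1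
  exact h1

theorem coord_value (k : c.ι) (D : c.Der) :
    c.coord k (c.value D) = constantCoeff (D (X k)) := by
  classical
  change c.coord k (∑ j, _ • c.vec j) = _
  simp [coord_vec]

theorem constantCoeff_apply_of_value_eq_zero {D : c.Der} (h : c.value D = 0) (f : c.F) :
    constantCoeff (D f) = 0 := by
  rw [value_eq_zero_iff] at h
  rw [VSeries.derivation_apply, map_sum]
  exact Finset.sum_eq_zero fun k _ => by rw [map_mul, h, zero_mul]

theorem value_lie_eq_zero {D E : c.Der} (hD : c.value D = 0) (hE : c.value E = 0) :
    c.value ⁅D, E⁆ = 0 := by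
  rw [value_eq_zero_iff]
  intro k
  rw [Derivation.commutator_apply, map_sub, c.constantCoeff_apply_of_value_eq_zero hD,
    c.constantCoeff_apply_of_value_eq_zero hE, sub_zero]

theorem coeff_mul_of_order_le {ι : Type*} {f g : MvPowerSeries ι ℝ} {e : ι →₀ ℕ}
    (hg : ∀ d : ι →₀ ℕ, d.degree < e.degree → MvPowerSeries.coeff d g = 0) :
    MvPowerSeries.coeff e (f * g) = constantCoeff f * MvPowerSeries.coeff e g := by
  classical
  rw [MvPowerSeries.coeff_mul, Finset.sum_eq_single (0, e)]
  · simp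
  · rintro ⟨p, q⟩ hpq hne
    rw [Finset.HasAntidiagonal.mem_antidiagonal] at hpq
    simp only at hpq ⊢
    have hp : p ≠ 0 := by
      rintro rfl
      exact hne (by rw [← hpq, zero_add])
    have : q.degree < e.degree := by
      have h0 := (Finsupp.degree_eq_zero_iff p).not.mpr hp
      rw [← hpq, map_add]
      omega
    rw [hg q this, mul_zero]
  · simp

/-- The fields R*_X take every value of V at 0. So if all members of J vanish to order n, bracketing
with them differentiates the leading part in every direction; the derivatives vanish, and the order
increases. -/
theorem eq_zero_of_lie_rightField_mem (J : Set c.Der) (h0 : ∀ D ∈ J, c.value D = 0)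
    (hJ : ∀ D ∈ J, ∀ x, ⁅c.rightField x, D⁆ ∈ J) : ∀ D ∈ J, D = 0 := by
  classical
  have key (n : ℕ) : ∀ D ∈ J, ∀ k, ∀ d : c.ι →₀ ℕ, d.degree < n + 1 →
      MvPowerSeries.coeff d (D (X k)) = 0 := by
    induction n with
    | zero =>
      intro D hD k d hd
      have : d = 0 := (Finsupp.degree_eq_zero_iff d).mp (by omega)
      subst this
      exact (c.value_eq_zero_iff D).mp (h0 D hD) k
    | succ n ih =>
      intro D hD k d hd
      rcases Nat.lt_or_ge d.degree (n + 1) with h | h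
      · exact ih D hD k d h
      obtain ⟨j, hj⟩ : ∃ j, d j ≠ 0 := by
        by_contra! hcon
        have : d = 0 := Finsupp.ext hcon
        subst this
        simp at h
      obtain ⟨e, rfl⟩ : ∃ e, d = e + Finsupp.single j 1 :=
        ⟨d - Finsupp.single j 1, (tsub_add_cancel_of_le (by
          rw [Finsupp.single_le_iff]; omega)).symm⟩
      have he : e.degree = n := by
        rw [map_add, Finsupp.degree_single] at hd h
        omega
      have h1 := ih _ (hJ D hD (c.vec j)) k e (by omega)
      -- Applying D to a series does not lower the order below that of D, so this half of the
      -- commutator contributes nothing in degree n; only the derivative of D along R* remains.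
      have h2 : MvPowerSeries.coeff e (D (c.rightField (c.vec j) (X k))) = 0 := by
        rw [VSeries.derivation_apply, map_sum]
        refine Finset.sum_eq_zero fun l _ => ?_
        rw [mul_comm, coeff_mul_of_order_le (fun d hd => ih D hD l d (by omega)),
          ih D hD l e (by omega), mul_zero]
      have h3 (l : c.ι) : constantCoeff (c.rightField (c.vec j) (X l)) =
          if j = l then 1 else 0 := by
        rw [← coord_value, value_rightField, proj_vec, coord_vec]
      rw [Derivation.commutator_apply, map_sub, h2, sub_zero, VSeries.derivation_apply, map_sum,
        Finset.sum_eq_single j] at h1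
      · rw [coeff_mul_of_order_le, h3, if_pos rfl, one_mul, MvPowerSeries.coeff_pderiv] at h1
        · refine (mul_eq_zero.mp h1).resolve_right ?_
          positivity
        · intro d hd
          rw [MvPowerSeries.coeff_pderiv, ih D hD, zero_mul]
          rw [map_add, Finsupp.degree_single]
          omega
      · intro l _ hl
        rw [coeff_mul_of_order_le, h3, if_neg (Ne.symm hl), zero_mul]
        intro d hd
        rw [MvPowerSeries.coeff_pderiv, ih D hD, zero_mul]
        rw [map_add, Finsupp.degree_single]
        omega
      · simp
  intro D hD
  refine VSeries.derivation_ext fun k => ?_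
  ext d
  rw [key d.degree D hD k d (by omega)]
  simp

theorem bijective_mapQ {R N N' : Type*} [Ring R] [AddCommGroup N] [Module R N] [AddCommGroup N']
    [Module R N'] {p : Submodule R N} {p' : Submodule R N'} {f : N →ₗ[R] N'} (hf : p ≤ p'.comap f)
    (h1 : ∀ x, f x ∈ p' → x ∈ p) (h2 : ∀ y, ∃ x, y - f x ∈ p') :
    Function.Bijective (p.mapQ p' f hf) := by
  constructor
  · rw [← LinearMap.ker_eq_bot, eq_bot_iff]
    intro q hq
    obtain ⟨x, rfl⟩ := Submodule.Quotient.mk_surjective _ q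
    rw [LinearMap.mem_ker, Submodule.mapQ_apply, Submodule.Quotient.mk_eq_zero] at hq
    exact (Submodule.Quotient.mk_eq_zero _).mpr (h1 x hq)
  · intro q
    obtain ⟨y, rfl⟩ := Submodule.Quotient.mk_surjective _ q
    obtain ⟨x, hx⟩ := h2 y
    exact ⟨Submodule.Quotient.mk x, ((Submodule.Quotient.eq _).mpr hx).symm⟩

section Opposite

variable {c} {S : LieSubalgebra ℝ c.Der} {M : Type u} [LieRing M] [LieAlgebra ℝ M]
  [TopologicalSpace M] {e : M →ₗ[ℝ] c.Der}

/-- Both e and R* reverse brackets, so the lift of R* through e preserves them. -/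
theorem IsOpposite.exists_lift (h : c.IsOpposite S e) (hR : ∀ x, c.rightField x ∈ S) :
    ∃ φ : L →ₗ⁅ℝ⁆ M, ∀ x, e (φ x) = c.rightField x := by
  have h1 (x : L) : ∃ y, e y = c.rightField x := by
    have : c.rightField x ∈ LinearMap.range e := by rw [h.range_eq]; exact hR x
    exact this
  choose g hg using h1
  exact ⟨{ toFun := g
           map_add' := fun x y => h.injective (by simp only [hg, map_add])
           map_smul' := fun r x => h.injective (by simp only [hg, map_smul, RingHom.id_apply])
           map_lie' := fun {x y} => h.injective (by
            rw [h.map_lie, hg, hg, hg, rightField_lie]) }, hg⟩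

theorem IsOpposite.continuous_lift (h : c.IsOpposite S e) [TopologicalSpace L]
    (hi : IsTransitivePair L i) {φ : L →ₗ⁅ℝ⁆ M} (hφ : ∀ x, e (φ x) = c.rightField x) :
    Continuous φ := by
  have := hi.finite_codim
  have h1 := c.continuous_field hi.linearlyCompact hi.isClosed (-1)
  rw [h.isInducing.continuous_iff]
  refine continuous_pi fun p => ?_
  change Continuous fun x => MvPowerSeries.coeff p.2 (e (φ x) (X p.1))
  simp only [hφ]
  exact VSeries.continuous_der_iff.mp h1 p.1 p.2

theorem injective_lift (hi : ∀ J : LieIdeal ℝ L, (J : Set L) ⊆ (i : Set L) → J = ⊥)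
    {φ : L →ₗ⁅ℝ⁆ M} (hφ : ∀ x, e (φ x) = c.rightField x) : Function.Injective φ := by
  intro x y hxy
  refine c.rightField_injective hi ?_
  rw [← hφ, ← hφ, hxy]

theorem lift_mem_iff {φ : L →ₗ⁅ℝ⁆ M} (hφ : ∀ x, e (φ x) = c.rightField x) {j : LieSubalgebra ℝ M}
    (hj : ∀ x, x ∈ j ↔ c.value (e x) = 0) (x : L) : φ x ∈ j ↔ x ∈ i := by
  rw [hj, hφ, value_rightField, proj_eq_zero_iff]

/-- R* of the vector y(0) has the same value at 0 as y. Hence the lift is surjective modulo the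
fields vanishing at 0. -/
theorem sub_lift_mem {φ : L →ₗ⁅ℝ⁆ M} (hφ : ∀ x, e (φ x) = c.rightField x) {j : LieSubalgebra ℝ M}
    (hj : ∀ x, x ∈ j ↔ c.value (e x) = 0) (y : M) : y - φ (c.value (e y)) ∈ j := by
  rw [hj, map_sub, map_sub, hφ, value_rightField, c.proj_of_mem (c.value_mem _), sub_self]

end Opposite

theorem isOpposite_incl (S : LieSubalgebra ℝ c.Der) :
    c.IsOpposite S (OppositeLie.incl S) where
  injective := OppositeLie.incl_injective S
  range_eq := OppositeLie.range_incl S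
  map_lie := OppositeLie.incl_lie S
  isInducing := VSeries.isInducing_derCoeff.comp OppositeLie.isInducing_incl

/-- The subalgebra of the fields vanishing at the origin. -/
def vanishing (S : LieSubalgebra ℝ c.Der) : LieSubalgebra ℝ (OppositeLie S) where
  toSubmodule := LinearMap.ker (c.value ∘ₗ OppositeLie.incl S)
  lie_mem' {x y} hx hy := by
    change c.value (OppositeLie.incl S ⁅x, y⁆) = 0
    rw [OppositeLie.incl_lie]
    exact c.value_lie_eq_zero hy hx

theorem mem_vanishing {S : LieSubalgebra ℝ c.Der} (x : OppositeLie S) :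
    x ∈ c.vanishing S ↔ c.value (OppositeLie.incl S x) = 0 := Iff.rfl

theorem isClosed_vanishing (S : LieSubalgebra ℝ c.Der) :
    IsClosed (c.vanishing S : Set (OppositeLie S)) := by
  have : (c.vanishing S : Set (OppositeLie S)) =
      ⋂ k, {x | constantCoeff (OppositeLie.incl S x (X k)) = 0} := by
    ext x
    simp only [SetLike.mem_coe, mem_vanishing, value_eq_zero_iff, Set.mem_iInter, Set.mem_ofPred_eq]
  rw [this]
  refine isClosed_iInter fun k => isClosed_eq ?_ continuous_const
  exact (VSeries.continuous_coeff_der k 0).comp OppositeLie.isInducing_incl.continuous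

instance (S : LieSubalgebra ℝ c.Der) :
    FiniteDimensional ℝ (OppositeLie S ⧸ (c.vanishing S).toSubmodule) := by
  have : FiniteDimensional ℝ c.V := c.basis.finiteDimensional_of_finite
  let f : OppositeLie S →ₗ[ℝ] c.V :=
    (c.value ∘ₗ OppositeLie.incl S).codRestrict c.V fun x => c.value_mem _
  have h : LinearMap.ker f = (c.vanishing S).toSubmodule := LinearMap.ker_codRestrict _ _ _
  rw [← h]
  exact f.quotKerEquivRange.symm.finiteDimensional

theorem isTransitivePair_vanishing {S : LieSubalgebra ℝ c.Der} (hS : IsClosed (S : Set c.Der))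
    (hR : ∀ x, c.rightField x ∈ S) : IsTransitivePair (OppositeLie S) (c.vanishing S) where
  linearlyCompact := OppositeLie.isLinearlyCompactLieAlgebra hS
  isClosed := c.isClosed_vanishing S
  finite_codim := inferInstance
  ideal_eq_bot J hJ := by
    have := c.eq_zero_of_lie_rightField_mem (OppositeLie.incl S '' J) (by
      rintro _ ⟨x, hx, rfl⟩
      exact hJ hx) (by
      rintro _ ⟨x, hx, rfl⟩ y
      obtain ⟨z, hz⟩ := OppositeLie.exists_incl_eq S (hR y)
      refine ⟨⁅x, z⁆, lie_mem_left ℝ _ J x z hx, ?_⟩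
      rw [OppositeLie.incl_lie, hz])
    rw [eq_bot_iff]
    intro x hx
    exact OppositeLie.incl_injective S ((this _ ⟨x, hx, rfl⟩).trans (map_zero _).symm)

section Uniqueness

variable {L' M : Type u} [LieRing L'] [LieAlgebra ℝ L'] {i' : LieSubalgebra ℝ L'}
  [LieRing M] [LieAlgebra ℝ M] {j : LieSubalgebra ℝ M}

/-- In the charts carried over by f and g, naturality forces both ψ y and ψ' y to have the formal
field of y as their right field. The right field is injective on M by transitivity. -/
theorem hom_ext (c : FormalChart i) (hj : ∀ J : LieIdeal ℝ M, (J : Set M) ⊆ (j : Set M) → J = ⊥)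
    (f : L →ₗ⁅ℝ⁆ L') (hf : Function.Injective f)
    (hi : i.toSubmodule ≤ i'.toSubmodule.comap (f : L →ₗ[ℝ] L'))
    (hbij : Function.Bijective (Submodule.mapQ i.toSubmodule i'.toSubmodule (f : L →ₗ[ℝ] L') hi))
    (g : L →ₗ⁅ℝ⁆ M) (hg : Function.Injective g)
    (hgi : i.toSubmodule ≤ j.toSubmodule.comap (g : L →ₗ[ℝ] M))
    (hgbij : Function.Bijective (Submodule.mapQ i.toSubmodule j.toSubmodule (g : L →ₗ[ℝ] M) hgi))
    {ψ ψ' : L' →ₗ⁅ℝ⁆ M} (hψ : ∀ x ∈ i', ψ x ∈ j) (hψ' : ∀ x ∈ i', ψ' x ∈ j)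
    (h : ∀ x, ψ (f x) = g x) (h' : ∀ x, ψ' (f x) = g x) : ψ = ψ' := by
  let c' := c.push f hf hi hbij
  let d := c.push g hg hgi hgbij
  have key (χ : L' →ₗ⁅ℝ⁆ M) (hχ : ∀ x ∈ i', χ x ∈ j) (hχf : ∀ x, χ (f x) = g x) (y : L') :
      (d.rightField (χ y) : c.Der) = c'.rightField y :=
    c'.transport_field (V' := d.V) (hV' := d.isCompl) (b' := d.basis) (f := χ) (fun k => by
      exact (c.push_basis g hg hgi hgbij k).trans
        ((hχf _).symm.trans (congrArg χ (c.push_basis f hf hi hbij k).symm))) hχ (-1) y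
  ext y
  exact d.rightField_injective hj ((key ψ hψ h y).trans (key ψ' hψ' h' y).symm)

end Uniqueness

end FormalChart

/-! ### The real formal module and its stabilizer. -/

namespace FormalChart

variable {L : Type u} [LieRing L] [LieAlgebra ℝ L] {i : LieSubalgebra ℝ L} (c : FormalChart i)
  {l : Submodule ℝ L}

theorem omega_mem_of_mem_formalModule {D : c.Der}
    (hD : D ∈ c.formalModule l) (d) : c.omega d D ∈ l := by
  rw [formalModule, ← SetLike.mem_coe] at hD
  induction hD using Submodule.closure_induction with
  | zero => rw [map_zero]; exact l.zero_mem
  | add x y _ _ hx hy => rw [map_add]; exact l.add_mem hx hy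
  | smul_mem f x hx =>
    obtain ⟨w, ⟨hw, hwl⟩, rfl⟩ := hx
    rw [omega_smul_leftField, c.proj_of_mem hw]
    exact l.smul_mem _ hwl

theorem leftField_mem_formalModule {w : L} (hw : w ∈ c.V) (hwl : w ∈ l) :
    c.leftField w ∈ c.formalModule l :=
  Submodule.subset_span ⟨w, ⟨hw, hwl⟩, rfl⟩

/-- If all ω-coefficients lie in V ∩ l, their coordinates in a basis of V ∩ l assemble into series,
and the resulting combination of the L*_w has the same ω as D. Membership thus becomes a condition
on individual coefficients, from which closedness follows. -/
theorem mem_formalModule_iff {D : c.Der} :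
    D ∈ c.formalModule l ↔ ∀ d, c.omega d D ∈ l := by
  refine ⟨fun hD d => c.omega_mem_of_mem_formalModule hD d, fun h => ?_⟩
  have : FiniteDimensional ℝ c.V := c.basis.finiteDimensional_of_finite
  have : FiniteDimensional ℝ (c.V ⊓ l : Submodule ℝ L) :=
    Submodule.finiteDimensional_of_le inf_le_left
  let b := Module.finBasis ℝ (c.V ⊓ l : Submodule ℝ L)
  let f (j) : c.F := fun d => b.repr ⟨c.omega d D, c.omega_mem d D, h d⟩ j
  have hD : D = ∑ j, f j • c.leftField (b j : L) := by
    rw [← sub_eq_zero]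
    refine c.eq_zero_of_omega_eq_zero fun d => ?_
    rw [map_sub, map_sum, sub_eq_zero]
    have h1 := congrArg Subtype.val (b.sum_repr ⟨c.omega d D, c.omega_mem d D, h d⟩)
    rw [Submodule.coe_sum] at h1
    refine h1.symm.trans (Finset.sum_congr rfl fun j _ => ?_)
    rw [omega_smul_leftField, c.proj_of_mem (b j).2.1]
    rfl
  rw [hD]
  exact Submodule.sum_mem _ fun j _ => Submodule.smul_mem _ _
    (c.leftField_mem_formalModule (b j).2.1 (b j).2.2)

theorem exists_value_formalModule_iff {D : c.Der} :
    (∃ Θ ∈ c.formalModule l, c.value D = c.value Θ) ↔ c.value D ∈ l := by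
  constructor
  · rintro ⟨Θ, hΘ, h⟩
    rw [h, ← omega_zero]
    exact c.omega_mem_of_mem_formalModule hΘ 0
  · intro h
    exact ⟨_, c.leftField_mem_formalModule (c.value_mem D) h,
      by rw [value_leftField, c.proj_of_mem (c.value_mem D)]⟩

theorem lie_mv_smul_der (D E : c.Der) (f : c.F) : ⁅D, f • E⁆ = D f • E + f • ⁅D, E⁆ := by
  ext1 g
  simp only [Derivation.commutator_apply, Derivation.add_apply, Derivation.smul_apply,
    smul_eq_mul, Derivation.leibniz]
  ring

theorem mem_stabilizer_iff {D : c.Der} :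
    D ∈ c.stabilizer (c.formalModule l) ↔
      ∀ w ∈ c.V, w ∈ l → ∀ d, c.omega d ⁅D, c.leftField w⁆ ∈ l := by
  constructor
  · intro hD w hw hwl
    exact c.mem_formalModule_iff.mp (hD _ (c.leftField_mem_formalModule hw hwl))
  · intro h Θ hΘ
    change ⁅D, Θ⁆ ∈ c.formalModule l
    have hΘ' := hΘ
    rw [formalModule] at hΘ'
    induction hΘ' using Submodule.span_induction with
    | mem x hx =>
      obtain ⟨w, ⟨hw, hwl⟩, rfl⟩ := hx
      exact c.mem_formalModule_iff.mpr (h w hw hwl)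
    | zero => rw [show ⁅D, (0 : c.Der)⁆ = 0 from lie_zero D]; exact Submodule.zero_mem _
    | add x y hx hy ihx ihy =>
      rw [show ⁅D, x + y⁆ = ⁅D, x⁆ + ⁅D, y⁆ from lie_add D x y]
      exact Submodule.add_mem _ (ihx hx) (ihy hy)
    | smul f x hx ihx =>
      rw [lie_mv_smul_der]
      exact Submodule.add_mem _ (Submodule.smul_mem _ _ hx) (Submodule.smul_mem _ _ (ihx hx))

theorem proj_mem_of_mem (hl : i.toSubmodule ≤ l) {x : L} (hx : x ∈ l) : c.proj x ∈ l := by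
  rw [← sub_sub_cancel x (c.proj x)]
  exact l.sub_mem hx (hl (c.sub_proj_mem x))

theorem mem_of_proj_mem (hl : i.toSubmodule ≤ l) {x : L} (hx : c.proj x ∈ l) : x ∈ l := by
  rw [← sub_add_cancel x (c.proj x)]
  exact l.add_mem (hl (c.sub_proj_mem x)) hx

/-- The bracket of R*_X with a generator has ω-coefficients -π[h, w] with h in i, and both [i, l]
and π l stay in l. -/
theorem rightField_mem_stabilizer (hl : i.toSubmodule ≤ l)
    (hil : ∀ x ∈ i, ∀ y ∈ l, ⁅x, y⁆ ∈ l) (x : L) :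
    c.rightField x ∈ c.stabilizer (c.formalModule l) := by
  rw [c.mem_stabilizer_iff]
  intro w _ hwl d
  rw [omega_rightField_leftField]
  exact l.neg_mem (c.proj_mem_of_mem hl (hil _ (c.isotSeries_mem _ _ _) _ hwl))

/-- The coefficient lies in the finite dimensional V, so membership in l is a closed condition on
its finitely many continuous coordinates, whatever l is. -/
theorem isClosed_omega_mem (l : Submodule ℝ L) (d) : IsClosed {D : c.Der | c.omega d D ∈ l} := by
  let g : (c.ι → ℝ) →ₗ[ℝ] L := Fintype.linearCombination ℝ c.vec
  have h1 : IsClosed ((l.comap g : Submodule ℝ (c.ι → ℝ)) : Set (c.ι → ℝ)) :=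
    Submodule.closed_of_finiteDimensional _
  have h2 : Continuous fun (D : c.Der) k => c.coord k (c.omega d D) :=
    continuous_pi fun k => c.continuous_coord_omega k d
  convert h1.preimage h2 using 1
  ext D
  change _ ↔ g (fun k => c.coord k (c.omega d D)) ∈ l
  rw [Fintype.linearCombination_apply, ← proj_eq_sum, c.proj_of_mem (c.omega_mem d D)]
  rfl

theorem isClosed_stabilizer (l : Submodule ℝ L) :
    IsClosed (c.stabilizer (c.formalModule l) : Set c.Der) := by
  have : (c.stabilizer (c.formalModule l) : Set c.Der) = ⋂ (w : L) (_ : w ∈ c.V) (_ : w ∈ l) (d),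
      (fun D : c.Der => ⁅D, c.leftField w⁆) ⁻¹' {D : c.Der | c.omega d D ∈ l} := by
    ext D
    rw [SetLike.mem_coe, c.mem_stabilizer_iff]
    simp
  rw [this]
  refine isClosed_iInter fun w => isClosed_iInter fun _ => isClosed_iInter fun _ =>
    isClosed_iInter fun d => (c.isClosed_omega_mem l d).preimage ?_
  exact VSeries.continuous_der_lie.comp (continuous_id.prodMk continuous_const)

end FormalChart

/-! ### Contact triples: the model, its universality, uniqueness. -/

namespace ContactTriple

variable {T : ContactTriple.{u}}

/-- `M`, embedded by `e`, is the contact triple of formal vector fields attached to `T` and the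
chart `c`. -/
structure IsModel (c : FormalChart T.isot) (M : ContactTriple.{u}) (e : M.𝔤 →ₗ[ℝ] c.Der) :
    Prop where
  isOpposite : c.IsOpposite (c.stabilizer (c.formalModule T.dist)) e
  mem_isot_iff : ∀ x, x ∈ M.isot ↔ c.value (e x) = 0
  mem_dist_iff : ∀ x, x ∈ M.dist ↔ ∃ Θ ∈ c.formalModule T.dist, c.value (e x) = c.value Θ

variable {c : FormalChart T.isot} {M : ContactTriple.{u}} {e : M.𝔤 →ₗ[ℝ] c.Der}

theorem IsModel.exists_isExtension (h : IsModel c M e) :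
    ∃ φ : T.𝔤 →ₗ⁅ℝ⁆ M.𝔤, (∀ x, e (φ x) = c.rightField x) ∧ T.IsExtension M φ ∧ Continuous φ := by
  obtain ⟨φ, hφ⟩ := h.isOpposite.exists_lift
    (c.rightField_mem_stabilizer T.isot_le T.lie_mem)
  have hd (x : T.𝔤) : φ x ∈ M.dist ↔ x ∈ T.dist := by
    rw [h.mem_dist_iff, c.exists_value_formalModule_iff, hφ, c.value_rightField]
    exact ⟨c.mem_of_proj_mem T.isot_le, c.proj_mem_of_mem T.isot_le⟩
  have hi := FormalChart.lift_mem_iff hφ h.mem_isot_iff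
  have hs := FormalChart.sub_lift_mem hφ h.mem_isot_iff
  refine ⟨φ, hφ, ⟨FormalChart.injective_lift T.transitivePair.ideal_eq_bot hφ,
    fun x hx => (hd x).mpr hx, fun x hx => (hi x).mpr hx, ?_, ?_⟩,
    h.isOpposite.continuous_lift T.transitivePair hφ⟩
  · exact FormalChart.bijective_mapQ _ (fun x => (hd x).mp) fun y => ⟨_, M.isot_le (hs y)⟩
  · exact FormalChart.bijective_mapQ _ (fun x => (hi x).mp) fun y => ⟨_, hs y⟩

theorem IsExtension.mem_dist_iff {T' : ContactTriple.{u}} {φ : T.𝔤 →ₗ⁅ℝ⁆ T'.𝔤}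
    (h : T.IsExtension T' φ) (x : T.𝔤) : φ x ∈ T'.dist ↔ x ∈ T.dist := by
  refine ⟨fun hx => ?_, fun hx => h.dist_le hx⟩
  rw [← Submodule.Quotient.mk_eq_zero]
  refine h.bijective_quot_dist.1 ?_
  rw [Submodule.mapQ_apply, map_zero]
  exact (Submodule.Quotient.mk_eq_zero _).mpr hx

theorem IsExtension.mem_isot_iff {T' : ContactTriple.{u}} {φ : T.𝔤 →ₗ⁅ℝ⁆ T'.𝔤}
    (h : T.IsExtension T' φ) (x : T.𝔤) : φ x ∈ T'.isot ↔ x ∈ T.isot :=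
  FormalChart.mem_isot_iff φ h.isot_le h.bijective_quot_isot

/-- The image of a chart under an extension. -/
abbrev IsExtension.push {T' : ContactTriple.{u}} {φ : T.𝔤 →ₗ⁅ℝ⁆ T'.𝔤}
    (h : T.IsExtension T' φ) (c : FormalChart T.isot) : FormalChart T'.isot :=
  c.push φ h.injective h.isot_le h.bijective_quot_isot

section Push

variable {T' : ContactTriple.{u}} {φ : T.𝔤 →ₗ⁅ℝ⁆ T'.𝔤} (h : T.IsExtension T' φ)
  (c : FormalChart T.isot)

theorem IsExtension.push_field (ε : ℝ) (x : T.𝔤) :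
    ((h.push c).field ε (φ x) : c.Der) = c.field ε x :=
  c.transport_field (c.push_basis φ h.injective h.isot_le h.bijective_quot_isot)
    (fun _ hx => h.isot_le hx) ε x

theorem IsExtension.push_value (D : c.Der) : (h.push c).value D = φ (c.value D) :=
  c.transport_value (c.push_basis φ h.injective h.isot_le h.bijective_quot_isot) D

theorem IsExtension.push_formalModule :
    (h.push c).formalModule T'.dist = (c.formalModule T.dist : Submodule c.F c.Der) := by
  unfold FormalChart.formalModule
  congr 1
  ext D
  constructor
  · rintro ⟨_, ⟨⟨w, hw, rfl⟩, hl⟩, rfl⟩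
    exact ⟨w, ⟨hw, (h.mem_dist_iff w).mp hl⟩, (h.push_field c 1 w).symm⟩
  · rintro ⟨w, ⟨hw, hl⟩, rfl⟩
    exact ⟨φ w, ⟨⟨w, hw, rfl⟩, (h.mem_dist_iff w).mpr hl⟩, h.push_field c 1 w⟩

/-- The stabilizer is unchanged, and the values at 0 are only composed with the injective φ. So the
same M is a model for every extension of T. -/
theorem IsModel.push {c : FormalChart T.isot} {M : ContactTriple.{u}} {e : M.𝔤 →ₗ[ℝ] c.Der}
    (hM : IsModel c M e) : IsModel (h.push c) M e where
  isOpposite := by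
    rw [h.push_formalModule c]
    exact ⟨hM.isOpposite.injective, hM.isOpposite.range_eq, hM.isOpposite.map_lie,
      hM.isOpposite.isInducing⟩
  mem_isot_iff x := by
    rw [hM.mem_isot_iff, h.push_value c]
    exact ((map_eq_zero_iff φ h.injective)).symm
  mem_dist_iff x := by
    rw [hM.mem_dist_iff, h.push_formalModule c]
    simp only [h.push_value c, h.injective.eq_iff]

end Push

/-- M is also a model for T', so T' embeds by its own right fields. On T these are the right fields
of T by naturality, and `hom_ext` gives uniqueness. -/
theorem IsModel.isGreatest (h : IsModel c M e) {φ : T.𝔤 →ₗ⁅ℝ⁆ M.𝔤} (hφ : T.IsExtension M φ)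
    (hφe : ∀ x, e (φ x) = c.rightField x) : T.IsGreatest M φ := by
  intro T' φ' hφ'
  obtain ⟨ψ, hψe, hψ, hψc⟩ := (h.push hφ').exists_isExtension
  have hψφ (x : T.𝔤) : ψ (φ' x) = φ x :=
    h.isOpposite.injective ((hψe _).trans ((hφ'.push_field c (-1) x).trans (hφe x).symm))
  refine ⟨ψ, hψ, hψφ, hψc, fun ψ' hψ' hψφ' => ?_⟩
  exact c.hom_ext M.transitivePair.ideal_eq_bot φ' hφ'.injective hφ'.isot_le
    hφ'.bijective_quot_isot φ hφ.injective hφ.isot_le hφ.bijective_quot_isot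
    (fun x hx => hψ'.isot_le hx) (fun x hx => hψ.isot_le hx) hψφ' hψφ

theorem IsExtension.id (T : ContactTriple.{u}) : T.IsExtension T LieHom.id where
  injective := Function.injective_id
  dist_le _ h := h
  isot_le _ h := h
  bijective_quot_dist := FormalChart.bijective_mapQ _ (fun _ h => h) fun y =>
    ⟨y, by simp⟩
  bijective_quot_isot := FormalChart.bijective_mapQ _ (fun _ h => h) fun y =>
    ⟨y, by simp⟩

theorem IsExtension.comp {T' T'' : ContactTriple.{u}} {φ : T.𝔤 →ₗ⁅ℝ⁆ T'.𝔤} {ψ : T'.𝔤 →ₗ⁅ℝ⁆ T''.𝔤}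
    (hψ : T'.IsExtension T'' ψ) (hφ : T.IsExtension T' φ) : T.IsExtension T'' (ψ.comp φ) where
  injective := hψ.injective.comp hφ.injective
  dist_le _ h := hψ.dist_le (hφ.dist_le h)
  isot_le _ h := hψ.isot_le (hφ.isot_le h)
  bijective_quot_dist := by
    convert hψ.bijective_quot_dist.comp hφ.bijective_quot_dist
    ext q
    obtain ⟨x, rfl⟩ := Submodule.Quotient.mk_surjective _ q
    rfl
  bijective_quot_isot := by
    convert hψ.bijective_quot_isot.comp hφ.bijective_quot_isot
    ext q
    obtain ⟨x, rfl⟩ := Submodule.Quotient.mk_surjective _ q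
    rfl

/-- An extension χ of M is followed by some ψ back into M. Both ψχ and the identity extend M
compatibly with φ, so they coincide by uniqueness; as ψ is injective, χ is onto. -/
theorem IsGreatest.isMaximal {φ : T.𝔤 →ₗ⁅ℝ⁆ M.𝔤} (h : T.IsGreatest M φ)
    (hφ : T.IsExtension M φ) : M.IsMaximal := by
  intro T' χ hχ
  obtain ⟨ψ, hψ, hψφ, -, -⟩ := h T' (χ.comp φ) (hχ.comp hφ)
  obtain ⟨ρ, -, -, -, hρ⟩ := h M φ hφ
  have h1 : ψ.comp χ = LieHom.id :=
    (hρ _ (hψ.comp hχ) hψφ).trans (hρ _ (.id M) fun _ => rfl).symm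
  refine ⟨hχ.injective, fun y => ⟨ψ y, hψ.injective ?_⟩⟩
  exact LieHom.congr_fun h1 (ψ y)

theorem IsExtension.exists_isIso {M' : ContactTriple.{u}} {ψ : M.𝔤 →ₗ⁅ℝ⁆ M'.𝔤}
    (h : M.IsExtension M' ψ) (hψ : Function.Bijective ψ) :
    ∃ e : M.𝔤 ≃ₗ⁅ℝ⁆ M'.𝔤, M.IsIso M' e ∧ ∀ x, e x = ψ x :=
  ⟨LieEquiv.ofBijective ψ hψ, ⟨fun x => (h.mem_isot_iff x).symm, fun x => (h.mem_dist_iff x).symm⟩,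
    fun _ => rfl⟩

theorem exists_isModel (c : FormalChart T.isot) : ∃ (M : ContactTriple.{u}) (e : M.𝔤 →ₗ[ℝ] c.Der),
    IsModel c M e := by
  let S := c.stabilizer (c.formalModule T.dist)
  have hR := c.rightField_mem_stabilizer T.isot_le T.lie_mem
  have ht : IsTransitivePair (OppositeLie S) (c.vanishing S) :=
    c.isTransitivePair_vanishing (c.isClosed_stabilizer _) hR
  obtain ⟨φ, hφ⟩ := (c.isOpposite_incl S).exists_lift hR
  let l : Submodule ℝ (OppositeLie S) := T.dist.comap (c.value ∘ₗ OppositeLie.incl S)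
  have hl : (c.vanishing S).toSubmodule ≤ l := by
    intro x hx
    have hx : c.value (OppositeLie.incl S x) = 0 := hx
    change c.value (OppositeLie.incl S x) ∈ T.dist
    rw [hx]
    exact T.dist.zero_mem
  have hlc := ht.linearlyCompact
  have := hlc.isTopologicalAddGroup
  have := hlc.continuousSMul
  refine ⟨{ 𝔤 := OppositeLie S
            isot := c.vanishing S
            dist := l
            transitivePair := ht
            isot_le := hl
            contactPair := ⟨hlc, isClosed_of_le ht.isClosed hl, finiteDimensional_quotient_of_le hl, ?_⟩
            lie_mem := ?_ }, OppositeLie.incl S, c.isOpposite_incl S, fun x => Iff.rfl,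
    fun x => c.exists_value_formalModule_iff.symm⟩
  · rw [eq_top_iff]
    intro y _
    have h1 : LieSubalgebra.lieSpan ℝ T.𝔤 (T.dist : Set T.𝔤) ≤
        (LieSubalgebra.lieSpan ℝ (OppositeLie S) (l : Set (OppositeLie S))).comap φ := by
      rw [LieSubalgebra.lieSpan_le]
      intro x hx
      refine LieSubalgebra.subset_lieSpan (R := ℝ) ?_
      change c.value (OppositeLie.incl S (φ x)) ∈ T.dist
      rw [hφ, c.value_rightField]
      exact c.proj_mem_of_mem T.isot_le hx
    -- Every y is an element of the new isotropy plus an element coming from T, and T is generated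
    -- by its distribution, which φ maps into the new one.
    have h2 := FormalChart.sub_lift_mem hφ c.mem_vanishing y
    have h3 : φ (c.value (OppositeLie.incl S y)) ∈
        LieSubalgebra.lieSpan ℝ (OppositeLie S) (l : Set (OppositeLie S)) :=
      h1 (by rw [T.contactPair.generates]; trivial)
    rw [← sub_add_cancel y (φ (c.value (OppositeLie.incl S y)))]
    exact add_mem (LieSubalgebra.subset_lieSpan (R := ℝ) (hl h2)) h3
  · intro x hx y hy
    have hx : c.value (OppositeLie.incl S x) = 0 := hx
    have hy : c.value (OppositeLie.incl S y) ∈ T.dist := hy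
    change c.value (OppositeLie.incl S ⁅x, y⁆) ∈ T.dist
    rw [OppositeLie.incl_lie]
    have h1 := OppositeLie.incl_mem S x
    generalize OppositeLie.incl S x = D at *
    generalize OppositeLie.incl S y = E at *
    -- Since D vanishes at 0, the value of [D, E] depends only on E(0). So E may be replaced by the
    -- left field with the same value, which lies in the formal module that D stabilizes.
    have h2 : c.value ⁅E - c.leftField (c.value E), D⁆ = 0 :=
      c.value_lie_eq_zero (by rw [map_sub, c.value_leftField, c.proj_of_mem (c.value_mem E),
        sub_self]) hx
    have h3 : c.value ⁅E, D⁆ = -c.value ⁅D, c.leftField (c.value E)⁆ := by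
      rw [show ⁅E - c.leftField (c.value E), D⁆ = ⁅E, D⁆ - ⁅c.leftField (c.value E), D⁆
        from sub_lie E _ D, map_sub, sub_eq_zero] at h2
      rw [h2, ← map_neg]
      exact congrArg c.value (lie_skew _ _).symm
    rw [h3, ← c.omega_zero]
    exact T.dist.neg_mem (c.mem_stabilizer_iff.mp h1 _ (c.value_mem E) hy 0)

theorem exists_realization (c : FormalChart T.isot) :
    ∃ (M : ContactTriple.{u}) (φ : T.𝔤 →ₗ⁅ℝ⁆ M.𝔤) (e : M.𝔤 →ₗ[ℝ] c.Der),
      T.IsExtension M φ ∧ M.IsMaximal ∧ T.IsGreatest M φ ∧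
      c.IsOpposite (c.stabilizer (c.formalModule T.dist)) e ∧
      (∀ x, e (φ x) = c.rightField x) ∧
      (∀ x, x ∈ M.isot ↔ c.value (e x) = 0) ∧
      (∀ x, x ∈ M.dist ↔ ∃ Θ ∈ c.formalModule T.dist, c.value (e x) = c.value Θ) := by
  obtain ⟨M, e, hM⟩ := exists_isModel c
  obtain ⟨φ, hφe, hφ, -⟩ := hM.exists_isExtension
  have hg := hM.isGreatest hφ hφe
  exact ⟨M, φ, e, hφ, hg.isMaximal hφ, hg, hM.isOpposite, hφe, hM.mem_isot_iff, hM.mem_dist_iff⟩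

theorem exists_isGreatest (T : ContactTriple.{u}) :
    ∃ (M : ContactTriple.{u}) (φ : T.𝔤 →ₗ⁅ℝ⁆ M.𝔤),
      T.IsExtension M φ ∧ M.IsMaximal ∧ T.IsGreatest M φ := by
  have := T.transitivePair.finite_codim
  obtain ⟨c⟩ := FormalChart.exists_formalChart T.isot
  obtain ⟨M, φ, -, h1, h2, h3, -⟩ := exists_realization c
  exact ⟨M, φ, h1, h2, h3⟩

/-- Both maximal objects map to the greatest extension compatibly with T, and by maximality both
maps are bijective. -/
theorem IsMaximal.exists_isIso {M' : ContactTriple.{u}} {φ : T.𝔤 →ₗ⁅ℝ⁆ M.𝔤}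
    {φ' : T.𝔤 →ₗ⁅ℝ⁆ M'.𝔤} (hφ : T.IsExtension M φ) (hM : M.IsMaximal)
    (hφ' : T.IsExtension M' φ') (hM' : M'.IsMaximal) :
    ∃ e : M.𝔤 ≃ₗ⁅ℝ⁆ M'.𝔤, M.IsIso M' e ∧ ∀ x, e (φ x) = φ' x := by
  obtain ⟨N, χ, -, -, hN⟩ := exists_isGreatest T
  obtain ⟨ψ, hψ, hψφ, -, -⟩ := hN M φ hφ
  obtain ⟨ψ', hψ', hψφ', -, -⟩ := hN M' φ' hφ'
  obtain ⟨e, he, heψ⟩ := hψ.exists_isIso (hM N ψ hψ)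
  obtain ⟨e', he', heψ'⟩ := hψ'.exists_isIso (hM' N ψ' hψ')
  have hsymm (x : M.𝔤) : e' ((e.trans e'.symm) x) = e x := e'.apply_symm_apply (e x)
  refine ⟨e.trans e'.symm, ⟨fun x => ?_, fun x => ?_⟩, fun x => ?_⟩
  · rw [he'.1, hsymm, he.1]
  · rw [he'.2, hsymm, he.2]
  · exact e'.injective ((hsymm _).trans ((heψ _).trans
      ((hψφ x).trans ((hψφ' x).symm.trans (heψ' _).symm))))

end ContactTriple

/-! ### Vectors and brackets in the complexification. -/

section Complexification

variable {N N' : Type u} [AddCommGroup N] [Module ℝ N] [AddCommGroup N'] [Module ℝ N']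

/-- The vector `a + i b` of the complexification. -/
def complexMk (a b : N) : ℂ ⊗[ℝ] N := (1 : ℂ) ⊗ₜ[ℝ] a + Complex.I ⊗ₜ[ℝ] b

theorem complexMk_eq (a b : N) :
    complexMk a b = (1 : ℂ) ⊗ₜ[ℝ] a + Complex.I • ((1 : ℂ) ⊗ₜ[ℝ] b) := by
  rw [TensorProduct.smul_tmul', smul_eq_mul, mul_one]
  rfl

theorem exists_eq_complexMk (z : ℂ ⊗[ℝ] N) : ∃ a b, z = complexMk a b := by
  induction z using TensorProduct.induction_on with
  | zero => exact ⟨0, 0, by simp [complexMk]⟩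
  | add x y hx hy =>
    obtain ⟨a, b, rfl⟩ := hx
    obtain ⟨a', b', rfl⟩ := hy
    refine ⟨a + a', b + b', ?_⟩
    simp only [complexMk, TensorProduct.tmul_add]
    abel
  | tmul s x =>
    refine ⟨s.re • x, s.im • x, ?_⟩
    rw [complexMk, ← TensorProduct.smul_tmul, ← TensorProduct.smul_tmul, ← TensorProduct.add_tmul]
    congr 1
    apply Complex.ext <;> simp

theorem complexRealPart_one_tmul (a : N) : complexRealPart N ((1 : ℂ) ⊗ₜ[ℝ] a) = a := by
  simp [complexRealPart]

theorem complexRealPart_complexMk (a b : N) : complexRealPart N (complexMk a b) = a := by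
  simp [complexRealPart, complexMk]

theorem complexMk_eq_zero {a b : N} : complexMk a b = 0 ↔ a = 0 ∧ b = 0 := by
  refine ⟨fun h => ⟨?_, ?_⟩, ?_⟩
  · rw [← complexRealPart_complexMk a b, h, map_zero]
  · have h1 : complexMk b (-a) = (-Complex.I) • complexMk a b := by
      simp only [complexMk, smul_add, TensorProduct.smul_tmul', smul_eq_mul, mul_one, neg_mul,
        Complex.I_mul_I, neg_neg, TensorProduct.tmul_neg, TensorProduct.neg_tmul]
      abel
    rw [← complexRealPart_complexMk b (-a), h1, h, smul_zero, map_zero]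
  · rintro ⟨rfl, rfl⟩
    simp [complexMk]

theorem baseChange_complexMk (f : N →ₗ[ℝ] N') (a b : N) :
    f.baseChange ℂ (complexMk a b) = complexMk (f a) (f b) := by
  simp [complexMk]

theorem complexMk_mem {q : Submodule ℂ (ℂ ⊗[ℝ] N)} {a b : N} (ha : (1 : ℂ) ⊗ₜ[ℝ] a ∈ q)
    (hb : (1 : ℂ) ⊗ₜ[ℝ] b ∈ q) : complexMk a b ∈ q := by
  rw [complexMk_eq]
  exact q.add_mem ha (q.smul_mem _ hb)

theorem baseChange_injective_of_injective {f : N →ₗ[ℝ] N'} (hf : Function.Injective f) :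
    Function.Injective (f.baseChange ℂ) := by
  rw [← LinearMap.ker_eq_bot, eq_bot_iff]
  intro z hz
  obtain ⟨a, b, rfl⟩ := exists_eq_complexMk z
  rw [LinearMap.mem_ker, baseChange_complexMk, complexMk_eq_zero, map_eq_zero_iff f hf,
    map_eq_zero_iff f hf] at hz
  exact complexMk_eq_zero.mpr hz

theorem mem_baseChange_iff {V : Submodule ℝ N} {w : ℂ ⊗[ℝ] N} :
    w ∈ V.baseChange ℂ ↔ ∃ a ∈ V, ∃ b ∈ V, w = complexMk a b := by
  constructor
  · intro hw
    have h1 : V.baseChange ℂ ≤ LinearMap.range (V.subtype.baseChange ℂ) := by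
      rw [Submodule.baseChange_eq_span, Submodule.span_le]
      rintro _ ⟨a, ha, rfl⟩
      exact ⟨1 ⊗ₜ ⟨a, ha⟩, by simp⟩
    obtain ⟨z, rfl⟩ := h1 hw
    obtain ⟨a, b, rfl⟩ := exists_eq_complexMk z
    exact ⟨a, a.2, b, b.2, baseChange_complexMk _ _ _⟩
  · rintro ⟨a, ha, b, hb, rfl⟩
    exact complexMk_mem (Submodule.tmul_mem_baseChange_of_mem _ ha)
      (Submodule.tmul_mem_baseChange_of_mem _ hb)

theorem baseChange_comp_apply {N'' : Type u} [AddCommGroup N''] [Module ℝ N''] (g : N' →ₗ[ℝ] N'')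
    (f : N →ₗ[ℝ] N') (z : ℂ ⊗[ℝ] N) :
    g.baseChange ℂ (f.baseChange ℂ z) = (g ∘ₗ f).baseChange ℂ z := by
  rw [LinearMap.baseChange_comp]
  rfl

section LieAlgebra

variable {A B : Type u} [LieRing A] [LieAlgebra ℝ A] [LieRing B] [LieAlgebra ℝ B]

theorem ad_complexMk (a b x y : A) :
    LieAlgebra.ad ℂ (ℂ ⊗[ℝ] A) (complexMk a b) (complexMk x y) =
      complexMk (⁅a, x⁆ - ⁅b, y⁆) (⁅a, y⁆ + ⁅b, x⁆) := by
  have h (s t : ℂ) (x y : A) : LieAlgebra.ad ℂ (ℂ ⊗[ℝ] A) (s ⊗ₜ x) (t ⊗ₜ y) =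
    (s * t) ⊗ₜ[ℝ] ⁅x, y⁆ := rfl
  simp only [complexMk, map_add, LinearMap.add_apply, h, mul_one, one_mul, Complex.I_mul_I,
    TensorProduct.tmul_sub, TensorProduct.tmul_add, TensorProduct.neg_tmul]
  abel

theorem baseChange_ad (x : A) (z : ℂ ⊗[ℝ] A) :
    (LieAlgebra.ad ℝ A x : A →ₗ[ℝ] A).baseChange ℂ z =
      LieAlgebra.ad ℂ (ℂ ⊗[ℝ] A) ((1 : ℂ) ⊗ₜ[ℝ] x) z := by
  obtain ⟨a, b, rfl⟩ := exists_eq_complexMk z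
  rw [baseChange_complexMk, show (1 : ℂ) ⊗ₜ[ℝ] x = complexMk x 0 by simp [complexMk], ad_complexMk,
    zero_lie, zero_lie, sub_zero, add_zero]
  rfl

end LieAlgebra

end Complexification

/-! ### The complex formal module and its stabilizer. -/

namespace FormalChart

variable {L : Type u} [LieRing L] [LieAlgebra ℝ L] {i : LieSubalgebra ℝ L} (c : FormalChart i)
  {q : Submodule ℂ (ℂ ⊗[ℝ] L)}

/-- Multiplication of formal vector fields by a formal power series. -/
abbrev mulSeries (f : c.F) : c.Der →ₗ[ℝ] c.Der :=
  (LinearMap.lsmul c.F c.Der f).restrictScalars ℝ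

theorem complexProj_of_mem {z : ℂ ⊗[ℝ] L} (hz : z ∈ c.V.baseChange ℂ) :
    c.proj.baseChange ℂ z = z := by
  obtain ⟨a, ha, b, hb, rfl⟩ := mem_baseChange_iff.mp hz
  rw [baseChange_complexMk, c.proj_of_mem ha, c.proj_of_mem hb]

theorem complexValue_mem (Z : ℂ ⊗[ℝ] c.Der) : c.value.baseChange ℂ Z ∈ c.V.baseChange ℂ := by
  obtain ⟨a, b, rfl⟩ := exists_eq_complexMk Z
  exact mem_baseChange_iff.mpr ⟨_, c.value_mem a, _, c.value_mem b, baseChange_complexMk _ _ _⟩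

theorem complexOmega_mem (d) (Z : ℂ ⊗[ℝ] c.Der) :
    (c.omega d).baseChange ℂ Z ∈ c.V.baseChange ℂ := by
  obtain ⟨a, b, rfl⟩ := exists_eq_complexMk Z
  exact mem_baseChange_iff.mpr ⟨_, c.omega_mem d a, _, c.omega_mem d b, baseChange_complexMk _ _ _⟩

theorem complexOmega_zero : (c.omega 0).baseChange ℂ = c.value.baseChange ℂ :=
  congrArg _ (LinearMap.ext c.omega_zero)

theorem eq_zero_of_complexOmega_eq_zero {Z : ℂ ⊗[ℝ] c.Der}
    (h : ∀ d, (c.omega d).baseChange ℂ Z = 0) : Z = 0 := by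
  obtain ⟨a, b, rfl⟩ := exists_eq_complexMk Z
  simp only [baseChange_complexMk, complexMk_eq_zero] at h
  exact complexMk_eq_zero.mpr ⟨c.eq_zero_of_omega_eq_zero fun d => (h d).1,
    c.eq_zero_of_omega_eq_zero fun d => (h d).2⟩

theorem complexValue_leftField (z : ℂ ⊗[ℝ] L) :
    c.value.baseChange ℂ (c.leftField.baseChange ℂ z) = c.proj.baseChange ℂ z := by
  rw [baseChange_comp_apply]
  exact congrArg (fun f : L →ₗ[ℝ] L => f.baseChange ℂ z) (LinearMap.ext c.value_leftField)

theorem complexValue_rightField (z : ℂ ⊗[ℝ] L) :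
    c.value.baseChange ℂ (c.rightField.baseChange ℂ z) = c.proj.baseChange ℂ z := by
  rw [baseChange_comp_apply]
  exact congrArg (fun f : L →ₗ[ℝ] L => f.baseChange ℂ z) (LinearMap.ext c.value_rightField)

theorem complexOmega_mulSeries_leftField (d) (f : c.F) (z : ℂ ⊗[ℝ] L) :
    (c.omega d).baseChange ℂ ((c.mulSeries f).baseChange ℂ (c.leftField.baseChange ℂ z)) =
      MvPowerSeries.coeff d f • c.proj.baseChange ℂ z := by
  rw [baseChange_comp_apply, baseChange_comp_apply, ← LinearMap.smul_apply,
    ← LinearMap.baseChange_smul]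
  exact congrArg (fun f : L →ₗ[ℝ] L => f.baseChange ℂ z)
    (LinearMap.ext fun X => c.omega_smul_leftField d f X)

theorem mulSeries_leftField_mem (f : c.F) {w : ℂ ⊗[ℝ] L} (hw : w ∈ c.V.baseChange ℂ)
    (hq : w ∈ q) :
    (c.mulSeries f).baseChange ℂ (c.leftField.baseChange ℂ w) ∈ c.complexFormalModule q :=
  Submodule.subset_span ⟨f, w, hw, hq, rfl⟩

theorem mulSeries_one : c.mulSeries 1 = LinearMap.id := LinearMap.ext fun D => one_smul c.F D

theorem complexLeftField_mem {w : ℂ ⊗[ℝ] L} (hw : w ∈ c.V.baseChange ℂ) (hq : w ∈ q) :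
    c.leftField.baseChange ℂ w ∈ c.complexFormalModule q := by
  have := c.mulSeries_leftField_mem 1 hw hq
  rwa [mulSeries_one, LinearMap.baseChange_id] at this

theorem mem_complexFormalModule_iff {Z : ℂ ⊗[ℝ] c.Der} :
    Z ∈ c.complexFormalModule q ↔ ∀ d, (c.omega d).baseChange ℂ Z ∈ q := by
  constructor
  · intro hZ d
    rw [complexFormalModule] at hZ
    induction hZ using Submodule.span_induction with
    | mem x hx =>
      obtain ⟨f, w, hw, hq, rfl⟩ := hx
      rw [complexOmega_mulSeries_leftField, c.complexProj_of_mem hw]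
      exact q.smul_of_tower_mem _ hq
    | zero => rw [map_zero]; exact q.zero_mem
    | add x y _ _ hx hy => rw [map_add]; exact q.add_mem hx hy
    | smul r x _ hx => rw [map_smul]; exact q.smul_mem r hx
  · intro h
    have : FiniteDimensional ℝ c.V := c.basis.finiteDimensional_of_finite
    have : FiniteDimensional ℂ (c.V.baseChange ℂ) := by
      have h1 : c.V.baseChange ℂ ≤ LinearMap.range (c.V.subtype.baseChange ℂ) := by
        intro w hw
        obtain ⟨a, ha, b, hb, rfl⟩ := mem_baseChange_iff.mp hw
        exact ⟨complexMk ⟨a, ha⟩ ⟨b, hb⟩, baseChange_complexMk _ _ _⟩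
      exact Submodule.finiteDimensional_of_le h1
    have : FiniteDimensional ℂ (c.V.baseChange ℂ ⊓ q : Submodule ℂ (ℂ ⊗[ℝ] L)) :=
      Submodule.finiteDimensional_of_le inf_le_left
    let b := Module.finBasis ℂ (c.V.baseChange ℂ ⊓ q : Submodule ℂ (ℂ ⊗[ℝ] L))
    let γ (d) (j) : ℂ := b.repr ⟨(c.omega d).baseChange ℂ Z, c.complexOmega_mem d Z, h d⟩ j
    -- The generators carry real series, so the complex coordinates are split into real and
    -- imaginary parts and the latter reinserted with the scalar i.
    let f (j) : c.F := fun d => (γ d j).re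
    let g (j) : c.F := fun d => (γ d j).im
    have hZ : Z = ∑ j, ((c.mulSeries (f j)).baseChange ℂ (c.leftField.baseChange ℂ (b j)) +
        Complex.I • (c.mulSeries (g j)).baseChange ℂ (c.leftField.baseChange ℂ (b j))) := by
      rw [← sub_eq_zero]
      refine c.eq_zero_of_complexOmega_eq_zero fun d => ?_
      rw [map_sub, map_sum, sub_eq_zero]
      have h1 := congrArg Subtype.val
        (b.sum_repr ⟨(c.omega d).baseChange ℂ Z, c.complexOmega_mem d Z, h d⟩)
      rw [Submodule.coe_sum] at h1
      refine h1.symm.trans (Finset.sum_congr rfl fun j _ => ?_)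
      rw [map_add, map_smul, complexOmega_mulSeries_leftField, complexOmega_mulSeries_leftField,
        c.complexProj_of_mem (b j).2.1]
      change γ d j • (b j : ℂ ⊗[ℝ] L) = (γ d j).re • (b j : ℂ ⊗[ℝ] L) +
        Complex.I • (γ d j).im • (b j : ℂ ⊗[ℝ] L)
      conv_lhs => rw [← Complex.re_add_im (γ d j), add_smul, mul_comm, mul_smul]
      congr 2
    rw [hZ]
    exact Submodule.sum_mem _ fun j _ => Submodule.add_mem _
      (c.mulSeries_leftField_mem _ (b j).2.1 (b j).2.2)
      (Submodule.smul_mem _ _ (c.mulSeries_leftField_mem _ (b j).2.1 (b j).2.2))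

theorem exists_value_complexFormalModule_iff {Z : ℂ ⊗[ℝ] c.Der} :
    (∃ Θ ∈ c.complexFormalModule q, c.value.baseChange ℂ Z = c.value.baseChange ℂ Θ) ↔
      c.value.baseChange ℂ Z ∈ q := by
  constructor
  · rintro ⟨Θ, hΘ, h⟩
    rw [h, ← complexOmega_zero]
    exact c.mem_complexFormalModule_iff.mp hΘ 0
  · intro h
    exact ⟨_, c.complexLeftField_mem (c.complexValue_mem Z) h,
      by rw [complexValue_leftField, c.complexProj_of_mem (c.complexValue_mem Z)]⟩

theorem mulSeries_mem (f : c.F) {Z : ℂ ⊗[ℝ] c.Der} (hZ : Z ∈ c.complexFormalModule q) :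
    (c.mulSeries f).baseChange ℂ Z ∈ c.complexFormalModule q := by
  rw [complexFormalModule] at hZ
  induction hZ using Submodule.span_induction with
  | mem x hx =>
    obtain ⟨g, w, hw, hq, rfl⟩ := hx
    have h1 : c.mulSeries f ∘ₗ c.mulSeries g = c.mulSeries (f * g) :=
      LinearMap.ext fun D => smul_smul f g D
    rw [baseChange_comp_apply, h1]
    exact c.mulSeries_leftField_mem _ hw hq
  | zero => rw [map_zero]; exact Submodule.zero_mem _
  | add x y _ _ hx hy => rw [map_add]; exact Submodule.add_mem _ hx hy
  | smul r x _ hx => rw [map_smul]; exact Submodule.smul_mem _ r hx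

theorem bracket_mulSeries (D : c.Der) (f : c.F) (Z : ℂ ⊗[ℝ] c.Der) :
    (c.bracket D).baseChange ℂ ((c.mulSeries f).baseChange ℂ Z) =
      (c.mulSeries (D f)).baseChange ℂ Z +
        (c.mulSeries f).baseChange ℂ ((c.bracket D).baseChange ℂ Z) := by
  rw [baseChange_comp_apply, baseChange_comp_apply, ← LinearMap.add_apply,
    ← LinearMap.baseChange_add]
  exact congrArg (fun f : c.Der →ₗ[ℝ] c.Der => f.baseChange ℂ Z)
    (LinearMap.ext fun E => c.lie_mv_smul_der D E f)

theorem mem_complexStabilizer_iff {D : c.Der} :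
    D ∈ c.complexStabilizer (c.complexFormalModule q) ↔
      ∀ w ∈ c.V.baseChange ℂ, w ∈ q → ∀ d,
        (c.omega d).baseChange ℂ ((c.bracket D).baseChange ℂ (c.leftField.baseChange ℂ w)) ∈ q := by
  constructor
  · intro hD w hw hwl
    exact c.mem_complexFormalModule_iff.mp (hD _ (c.complexLeftField_mem hw hwl))
  · intro h Θ hΘ
    change (c.bracket D).baseChange ℂ Θ ∈ c.complexFormalModule q
    rw [complexFormalModule] at hΘ
    induction hΘ using Submodule.span_induction with
    | mem x hx =>
      obtain ⟨f, w, hw, hq, rfl⟩ := hx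
      rw [bracket_mulSeries]
      exact Submodule.add_mem _ (c.mulSeries_leftField_mem _ hw hq)
        (c.mulSeries_mem _ (c.mem_complexFormalModule_iff.mpr (h w hw hq)))
    | zero => rw [map_zero]; exact Submodule.zero_mem _
    | add x y _ _ hx hy => rw [map_add]; exact Submodule.add_mem _ hx hy
    | smul r x _ hx => rw [map_smul]; exact Submodule.smul_mem _ r hx

theorem sub_complexProj_mem (hi : ∀ x ∈ i, (1 : ℂ) ⊗ₜ[ℝ] x ∈ q) (z : ℂ ⊗[ℝ] L) :
    z - c.proj.baseChange ℂ z ∈ q := by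
  obtain ⟨a, b, rfl⟩ := exists_eq_complexMk z
  have : complexMk a b - c.proj.baseChange ℂ (complexMk a b) =
      complexMk (a - c.proj a) (b - c.proj b) := by
    rw [baseChange_complexMk]
    simp only [complexMk, TensorProduct.tmul_sub]
    abel
  rw [this]
  exact complexMk_mem (hi _ (c.sub_proj_mem a)) (hi _ (c.sub_proj_mem b))

theorem complexProj_mem_iff (hi : ∀ x ∈ i, (1 : ℂ) ⊗ₜ[ℝ] x ∈ q) {z : ℂ ⊗[ℝ] L} :
    c.proj.baseChange ℂ z ∈ q ↔ z ∈ q := by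
  have h := c.sub_complexProj_mem hi z
  exact ⟨fun hz => by simpa using q.add_mem h hz, fun hz => by simpa using q.sub_mem hz h⟩

/-- The formula for ω[R*_X, L*_w] is complexified. As i lies in q and q is a subalgebra, the bracket
of an i-valued coefficient with w stays in q, and so does its projection. -/
theorem rightField_mem_complexStabilizer {q : LieSubalgebra ℂ (ℂ ⊗[ℝ] L)}
    (hi : ∀ x ∈ i, (1 : ℂ) ⊗ₜ[ℝ] x ∈ q) (x : L) :
    c.rightField x ∈ c.complexStabilizer (c.complexFormalModule q.toSubmodule) := by
  rw [c.mem_complexStabilizer_iff]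
  intro w _ hwq d
  have h : c.omega d ∘ₗ c.bracket (c.rightField x) ∘ₗ c.leftField =
      -(c.proj ∘ₗ LieAlgebra.ad ℝ L (c.isotSeries (-1) x d)) :=
    LinearMap.ext fun w => c.omega_rightField_leftField d x w
  rw [baseChange_comp_apply, baseChange_comp_apply, LinearMap.comp_assoc, h,
    LinearMap.baseChange_neg, LinearMap.neg_apply, ← baseChange_comp_apply, baseChange_ad]
  exact q.toSubmodule.neg_mem ((c.complexProj_mem_iff hi).mpr
    (q.lie_mem (hi _ (c.isotSeries_mem _ _ _)) hwq))

theorem isClosed_complexMk_mem (q : Submodule ℂ (ℂ ⊗[ℝ] L)) {Y : Type*} [TopologicalSpace Y]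
    {g h : Y → L} (hg : ∀ y, g y ∈ c.V) (hh : ∀ y, h y ∈ c.V)
    (hgc : ∀ k, Continuous fun y => c.coord k (g y))
    (hhc : ∀ k, Continuous fun y => c.coord k (h y)) :
    IsClosed {y | complexMk (g y) (h y) ∈ q} := by
  let v : (c.ι → ℝ) →ₗ[ℝ] L := Fintype.linearCombination ℝ c.vec
  let m : (c.ι → ℝ) × (c.ι → ℝ) →ₗ[ℝ] ℂ ⊗[ℝ] L :=
    (TensorProduct.mk ℝ ℂ L 1 ∘ₗ v).coprod (TensorProduct.mk ℝ ℂ L Complex.I ∘ₗ v)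
  have h1 : IsClosed (((q.restrictScalars ℝ).comap m : Submodule ℝ ((c.ι → ℝ) × (c.ι → ℝ))) :
      Set ((c.ι → ℝ) × (c.ι → ℝ))) := Submodule.closed_of_finiteDimensional _
  have h2 : Continuous fun y => ((fun k => c.coord k (g y) : c.ι → ℝ),
      (fun k => c.coord k (h y) : c.ι → ℝ)) :=
    (continuous_pi hgc).prodMk (continuous_pi hhc)
  convert h1.preimage h2 using 1
  ext y
  have h3 {z : L} (hz : z ∈ c.V) : v (fun k => c.coord k z) = z := by
    rw [Fintype.linearCombination_apply, ← proj_eq_sum, c.proj_of_mem hz]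
  have h4 : m (fun k => c.coord k (g y), fun k => c.coord k (h y)) = complexMk (g y) (h y) := by
    rw [LinearMap.coprod_apply, LinearMap.comp_apply, LinearMap.comp_apply, h3 (hg y), h3 (hh y)]
    rfl
  change _ ↔ m (fun k => c.coord k (g y), fun k => c.coord k (h y)) ∈ q
  rw [h4]
  rfl

theorem isClosed_complexStabilizer (q : Submodule ℂ (ℂ ⊗[ℝ] L)) :
    IsClosed (c.complexStabilizer (c.complexFormalModule q) : Set c.Der) := by
  have : (c.complexStabilizer (c.complexFormalModule q) : Set c.Der) =
      ⋂ (w : ℂ ⊗[ℝ] L) (_ : w ∈ c.V.baseChange ℂ) (_ : w ∈ q) (d), {D : c.Der |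
        (c.omega d).baseChange ℂ ((c.bracket D).baseChange ℂ (c.leftField.baseChange ℂ w)) ∈ q} := by
    ext D
    rw [SetLike.mem_coe, c.mem_complexStabilizer_iff]
    simp
  rw [this]
  refine isClosed_iInter fun w => isClosed_iInter fun _ => isClosed_iInter fun _ =>
    isClosed_iInter fun d => ?_
  obtain ⟨a, b, rfl⟩ := exists_eq_complexMk w
  simp only [baseChange_complexMk]
  have hc (x : L) (k : c.ι) :
      Continuous fun D : c.Der => c.coord k (c.omega d (c.bracket D (c.leftField x))) :=
    (c.continuous_coord_omega k d).comp
      (VSeries.continuous_der_lie.comp (continuous_id.prodMk continuous_const))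
  exact c.isClosed_complexMk_mem q (fun D => c.omega_mem d _) (fun D => c.omega_mem d _)
    (hc a) (hc b)

end FormalChart

/-! ### Complexified brackets and the bracket closure of the new q. -/

section Complexification

variable {A B : Type u} [LieRing A] [LieAlgebra ℝ A] [LieRing B] [LieAlgebra ℝ B]

theorem baseChange_ad_of_antihom {e : A →ₗ[ℝ] B} (he : ∀ x y, e ⁅x, y⁆ = ⁅e y, e x⁆)
    (z w : ℂ ⊗[ℝ] A) : e.baseChange ℂ (LieAlgebra.ad ℂ (ℂ ⊗[ℝ] A) z w) =
      LieAlgebra.ad ℂ (ℂ ⊗[ℝ] B) (e.baseChange ℂ w) (e.baseChange ℂ z) := by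
  obtain ⟨a, b, rfl⟩ := exists_eq_complexMk z
  obtain ⟨x, y, rfl⟩ := exists_eq_complexMk w
  simp only [ad_complexMk, baseChange_complexMk, map_sub, map_add, he]
  rw [add_comm]

theorem ad_complex_skew (z w : ℂ ⊗[ℝ] A) :
    LieAlgebra.ad ℂ (ℂ ⊗[ℝ] A) z w = -LieAlgebra.ad ℂ (ℂ ⊗[ℝ] A) w z :=
  (lie_skew z w).symm

end Complexification

namespace FormalChart

variable {L : Type u} [LieRing L] [LieAlgebra ℝ L] {i : LieSubalgebra ℝ L} (c : FormalChart i)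

theorem complexValue_ad_eq_zero {A B : ℂ ⊗[ℝ] c.Der} (hA : c.value.baseChange ℂ A = 0)
    (hB : c.value.baseChange ℂ B = 0) :
    c.value.baseChange ℂ (LieAlgebra.ad ℂ (ℂ ⊗[ℝ] c.Der) A B) = 0 := by
  obtain ⟨a, b, rfl⟩ := exists_eq_complexMk A
  obtain ⟨x, y, rfl⟩ := exists_eq_complexMk B
  rw [baseChange_complexMk, complexMk_eq_zero] at hA hB
  rw [ad_complexMk, baseChange_complexMk, complexMk_eq_zero, map_sub, map_add,
    c.value_lie_eq_zero hA.1 hB.1, c.value_lie_eq_zero hA.2 hB.2, c.value_lie_eq_zero hA.1 hB.2,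
    c.value_lie_eq_zero hA.2 hB.1, sub_zero, add_zero]
  exact ⟨rfl, rfl⟩

theorem complexValue_ad_leftField {z w : ℂ ⊗[ℝ] L} (hz : z ∈ c.V.baseChange ℂ)
    (hw : w ∈ c.V.baseChange ℂ) :
    c.value.baseChange ℂ (LieAlgebra.ad ℂ (ℂ ⊗[ℝ] c.Der) (c.leftField.baseChange ℂ z)
      (c.leftField.baseChange ℂ w)) =
        c.proj.baseChange ℂ (LieAlgebra.ad ℂ (ℂ ⊗[ℝ] L) z w) := by
  obtain ⟨a, ha, b, hb, rfl⟩ := mem_baseChange_iff.mp hz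
  obtain ⟨x, hx, y, hy, rfl⟩ := mem_baseChange_iff.mp hw
  simp only [ad_complexMk, baseChange_complexMk, map_sub, map_add, c.value_lie_leftField ha hx,
    c.value_lie_leftField ha hy, c.value_lie_leftField hb hx, c.value_lie_leftField hb hy]

theorem ad_mem_complexFormalModule {q : Submodule ℂ (ℂ ⊗[ℝ] L)} {a b : c.Der}
    (ha : a ∈ c.complexStabilizer (c.complexFormalModule q))
    (hb : b ∈ c.complexStabilizer (c.complexFormalModule q)) {Θ : ℂ ⊗[ℝ] c.Der}
    (hΘ : Θ ∈ c.complexFormalModule q) :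
    LieAlgebra.ad ℂ (ℂ ⊗[ℝ] c.Der) (complexMk a b) Θ ∈ c.complexFormalModule q := by
  have h (D : c.Der) (hD : D ∈ c.complexStabilizer (c.complexFormalModule q)) :
      LieAlgebra.ad ℂ (ℂ ⊗[ℝ] c.Der) ((1 : ℂ) ⊗ₜ[ℝ] D) Θ ∈ c.complexFormalModule q := by
    rw [← baseChange_ad]
    exact hD Θ hΘ
  rw [complexMk_eq, map_add, map_smul, LinearMap.add_apply, LinearMap.smul_apply]
  exact Submodule.add_mem _ (h a ha) (Submodule.smul_mem _ _ (h b hb))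

/-- Let A', B' be the left fields with the values of A, B at 0. As A - A' and B - B' vanish at 0, so
does their bracket, and the value of [A, B] is that of [A, B'] + [A', B] - [A', B']. The first two
lie in q because A and B stabilize the formal module containing A' and B'. The third has value
π[A(0), B(0)], in q because q is a subalgebra containing i. -/
theorem complexValue_ad_mem {q : LieSubalgebra ℂ (ℂ ⊗[ℝ] L)}
    (hi : ∀ x ∈ i, (1 : ℂ) ⊗ₜ[ℝ] x ∈ q) {a b x y : c.Der}
    (ha : a ∈ c.complexStabilizer (c.complexFormalModule q.toSubmodule))
    (hb : b ∈ c.complexStabilizer (c.complexFormalModule q.toSubmodule))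
    (hx : x ∈ c.complexStabilizer (c.complexFormalModule q.toSubmodule))
    (hy : y ∈ c.complexStabilizer (c.complexFormalModule q.toSubmodule))
    (h : c.value.baseChange ℂ (complexMk a b) ∈ q) (h' : c.value.baseChange ℂ (complexMk x y) ∈ q) :
    c.value.baseChange ℂ
      (LieAlgebra.ad ℂ (ℂ ⊗[ℝ] c.Der) (complexMk a b) (complexMk x y)) ∈ q := by
  have key {Θ : ℂ ⊗[ℝ] c.Der} (hΘ : Θ ∈ c.complexFormalModule q.toSubmodule) :
      c.value.baseChange ℂ Θ ∈ q := by
    rw [← complexOmega_zero]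
    exact c.mem_complexFormalModule_iff.mp hΘ 0
  have hw := c.complexValue_mem (complexMk a b)
  have hw' := c.complexValue_mem (complexMk x y)
  have hA (Z : ℂ ⊗[ℝ] c.Der) :
      c.value.baseChange ℂ (Z - c.leftField.baseChange ℂ (c.value.baseChange ℂ Z)) = 0 := by
    rw [map_sub, complexValue_leftField, c.complexProj_of_mem (c.complexValue_mem Z), sub_self]
  have h0 := c.complexValue_ad_eq_zero (hA (complexMk a b)) (hA (complexMk x y))
  have h1 := key (c.ad_mem_complexFormalModule ha hb (c.complexLeftField_mem hw' h'))
  have h2 := key (c.ad_mem_complexFormalModule hx hy (c.complexLeftField_mem hw h))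
  have h3 : c.proj.baseChange ℂ (LieAlgebra.ad ℂ (ℂ ⊗[ℝ] L) _ _) ∈ q :=
    (c.complexProj_mem_iff hi).mpr (q.lie_mem h h')
  rw [← c.complexValue_ad_leftField hw hw'] at h3
  generalize complexMk a b = A at *
  generalize complexMk x y = B at *
  generalize c.leftField.baseChange ℂ (c.value.baseChange ℂ A) = A' at *
  generalize c.leftField.baseChange ℂ (c.value.baseChange ℂ B) = B' at *
  simp only [map_sub, LinearMap.sub_apply, ad_complex_skew A' B, map_neg] at h0
  rw [sub_eq_zero, sub_eq_iff_eq_add] at h0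
  rw [h0]
  exact add_mem (sub_mem h1 h3) (neg_mem h2)

theorem complexLift_mem_iff {M : Type u} [LieRing M] [LieAlgebra ℝ M] {e : M →ₗ[ℝ] c.Der}
    {q : Submodule ℂ (ℂ ⊗[ℝ] L)} (hi : ∀ x ∈ i, (1 : ℂ) ⊗ₜ[ℝ] x ∈ q) {φ : L →ₗ⁅ℝ⁆ M}
    (hφ : ∀ x, e (φ x) = c.rightField x) (z : ℂ ⊗[ℝ] L) :
    c.value.baseChange ℂ (e.baseChange ℂ ((φ : L →ₗ[ℝ] M).baseChange ℂ z)) ∈ q ↔ z ∈ q := by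
  rw [baseChange_comp_apply e, show e ∘ₗ (φ : L →ₗ[ℝ] M) = c.rightField from LinearMap.ext hφ,
    complexValue_rightField, c.complexProj_mem_iff hi]

theorem complexValue_sub_lift {M : Type u} [LieRing M] [LieAlgebra ℝ M] {e : M →ₗ[ℝ] c.Der}
    {φ : L →ₗ⁅ℝ⁆ M} (hφ : ∀ x, e (φ x) = c.rightField x) (Z : ℂ ⊗[ℝ] M) :
    c.value.baseChange ℂ (e.baseChange ℂ (Z - (φ : L →ₗ[ℝ] M).baseChange ℂ
      (c.value.baseChange ℂ (e.baseChange ℂ Z)))) = 0 := by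
  rw [map_sub, map_sub, baseChange_comp_apply e,
    show e ∘ₗ (φ : L →ₗ[ℝ] M) = c.rightField from LinearMap.ext hφ,
    complexValue_rightField, c.complexProj_of_mem (c.complexValue_mem _), sub_self]

end FormalChart

/-! ### CR algebras: the model, its universality, uniqueness. -/

namespace CRAlgebra

variable {T : CRAlgebra.{u}}

/-- `M`, embedded by `e`, is the CR algebra of formal vector fields attached to `T` and the
chart `c`. -/
structure IsModel (c : FormalChart (realPoints T.q)) (M : CRAlgebra.{u}) (e : M.𝔤 →ₗ[ℝ] c.Der) :
    Prop where
  isOpposite : c.IsOpposite (c.complexStabilizer (c.complexFormalModule T.q.toSubmodule)) e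
  mem_q_iff : ∀ z, z ∈ M.q ↔ ∃ Θ ∈ c.complexFormalModule T.q.toSubmodule,
    c.value.baseChange ℂ (e.baseChange ℂ z) = c.value.baseChange ℂ Θ

variable {c : FormalChart (realPoints T.q)} {M : CRAlgebra.{u}} {e : M.𝔤 →ₗ[ℝ] c.Der}

theorem IsModel.mem_q_iff' (h : IsModel c M e) (z : ℂ ⊗[ℝ] M.𝔤) :
    z ∈ M.q ↔ c.value.baseChange ℂ (e.baseChange ℂ z) ∈ T.q :=
  (h.mem_q_iff z).trans c.exists_value_complexFormalModule_iff

/-- The value lies in V, and V meets the real points of q only in 0. So the isotropy of the model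
consists of the fields vanishing at 0. -/
theorem value_eq_zero_iff (c : FormalChart (realPoints T.q)) (D : c.Der) :
    c.value D = 0 ↔ (1 : ℂ) ⊗ₜ[ℝ] c.value D ∈ T.q := by
  constructor
  · intro h
    rw [h, TensorProduct.tmul_zero]
    exact T.q.zero_mem
  · intro h
    rw [← c.proj_of_mem (c.value_mem D)]
    exact c.proj_of_mem_isot h

theorem IsModel.mem_realPoints_iff (h : IsModel c M e) (x : M.𝔤) :
    x ∈ realPoints M.q ↔ c.value (e x) = 0 := by
  rw [value_eq_zero_iff]
  exact (h.mem_q_iff' _).trans (by simp)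

theorem IsModel.exists_isExtension (h : IsModel c M e) :
    ∃ φ : T.𝔤 →ₗ⁅ℝ⁆ M.𝔤, (∀ x, e (φ x) = c.rightField x) ∧ T.IsExtension M φ ∧ Continuous φ := by
  have hR : ∀ x ∈ realPoints T.q, (1 : ℂ) ⊗ₜ[ℝ] x ∈ T.q := fun _ hx => hx
  obtain ⟨φ, hφ⟩ := h.isOpposite.exists_lift (c.rightField_mem_complexStabilizer hR)
  have hq (z : ℂ ⊗[ℝ] T.𝔤) : (φ : T.𝔤 →ₗ[ℝ] M.𝔤).baseChange ℂ z ∈ M.q ↔ z ∈ T.q :=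
    (h.mem_q_iff' _).trans (c.complexLift_mem_iff (q := T.q.toSubmodule) hR hφ z)
  have hi := FormalChart.lift_mem_iff hφ h.mem_realPoints_iff
  refine ⟨φ, hφ, ⟨FormalChart.injective_lift T.transitivePair.ideal_eq_bot hφ,
    fun z hz => (hq z).mpr hz, fun x hx => (hi x).mpr hx, ?_, ?_⟩,
    h.isOpposite.continuous_lift T.transitivePair hφ⟩
  · exact FormalChart.bijective_mapQ _ (fun x => (hi x).mp)
      fun y => ⟨_, FormalChart.sub_lift_mem hφ h.mem_realPoints_iff y⟩
  · refine FormalChart.bijective_mapQ _ (fun x => (hq x).mp) fun Z =>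
      ⟨c.value.baseChange ℂ (e.baseChange ℂ Z), (h.mem_q_iff' _).mpr ?_⟩
    rw [c.complexValue_sub_lift hφ Z]
    exact T.q.zero_mem

section Extension

variable {T' : CRAlgebra.{u}} {φ : T.𝔤 →ₗ⁅ℝ⁆ T'.𝔤}

theorem IsExtension.mem_q_iff (h : T.IsExtension T' φ) (z : ℂ ⊗[ℝ] T.𝔤) :
    (φ : T.𝔤 →ₗ[ℝ] T'.𝔤).baseChange ℂ z ∈ T'.q ↔ z ∈ T.q := by
  refine ⟨fun hz => ?_, fun hz => h.q_le hz⟩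
  have h1 : (Submodule.Quotient.mk z : _ ⧸ T.q.toSubmodule) = 0 := by
    refine h.bijective_quot_q.1 ?_
    rw [Submodule.mapQ_apply, map_zero]
    exact (Submodule.Quotient.mk_eq_zero _).mpr hz
  exact (Submodule.Quotient.mk_eq_zero _).mp h1

/-- The image of a chart under an extension. -/
abbrev IsExtension.push (h : T.IsExtension T' φ) (c : FormalChart (realPoints T.q)) :
    FormalChart (realPoints T'.q) :=
  c.push φ h.injective h.realPoints_le h.bijective_quot_realPoints

variable (h : T.IsExtension T' φ) (c : FormalChart (realPoints T.q))

theorem IsExtension.push_field (ε : ℝ) (x : T.𝔤) :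
    ((h.push c).field ε (φ x) : c.Der) = c.field ε x :=
  c.transport_field (c.push_basis φ h.injective h.realPoints_le h.bijective_quot_realPoints)
    (fun _ hx => h.realPoints_le hx) ε x

theorem IsExtension.push_value :
    (h.push c).value = (φ : T.𝔤 →ₗ[ℝ] T'.𝔤) ∘ₗ c.value :=
  LinearMap.ext fun D => c.transport_value
    (c.push_basis φ h.injective h.realPoints_le h.bijective_quot_realPoints) D

theorem IsExtension.push_leftField (z : ℂ ⊗[ℝ] T.𝔤) :
    (h.push c).leftField.baseChange ℂ ((φ : T.𝔤 →ₗ[ℝ] T'.𝔤).baseChange ℂ z) =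
      c.leftField.baseChange ℂ z := by
  rw [baseChange_comp_apply]
  exact congrArg (fun f : T.𝔤 →ₗ[ℝ] c.Der => f.baseChange ℂ z)
    (LinearMap.ext fun x => h.push_field c 1 x)

theorem IsExtension.push_complexFormalModule :
    (h.push c).complexFormalModule T'.q.toSubmodule =
      (c.complexFormalModule T.q.toSubmodule : Submodule ℂ (ℂ ⊗[ℝ] c.Der)) := by
  unfold FormalChart.complexFormalModule
  congr 1
  ext D
  constructor
  · rintro ⟨f, w, hw, hq, rfl⟩
    obtain ⟨_, ⟨a, ha, rfl⟩, _, ⟨b, hb, rfl⟩, rfl⟩ := mem_baseChange_iff.mp hw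
    have h1 := (baseChange_complexMk (φ : T.𝔤 →ₗ[ℝ] T'.𝔤) a b).symm
    rw [h1] at hq ⊢
    exact ⟨f, complexMk a b, mem_baseChange_iff.mpr ⟨a, ha, b, hb, rfl⟩, (h.mem_q_iff _).mp hq,
      congrArg _ (h.push_leftField c _)⟩
  · rintro ⟨f, w, hw, hq, rfl⟩
    obtain ⟨a, ha, b, hb, rfl⟩ := mem_baseChange_iff.mp hw
    exact ⟨f, _, mem_baseChange_iff.mpr ⟨_, ⟨a, ha, rfl⟩, _, ⟨b, hb, rfl⟩,
      baseChange_complexMk _ _ _⟩, (h.mem_q_iff _).mpr hq, congrArg _ (h.push_leftField c _).symm⟩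

theorem IsModel.push {c : FormalChart (realPoints T.q)} {M : CRAlgebra.{u}} {e : M.𝔤 →ₗ[ℝ] c.Der}
    (hM : IsModel c M e) : IsModel (h.push c) M e where
  isOpposite := by
    rw [h.push_complexFormalModule c]
    exact ⟨hM.isOpposite.injective, hM.isOpposite.range_eq, hM.isOpposite.map_lie,
      hM.isOpposite.isInducing⟩
  mem_q_iff z := by
    rw [hM.mem_q_iff, h.push_complexFormalModule c, h.push_value c]
    simp only [← baseChange_comp_apply,
      (baseChange_injective_of_injective (f := (φ : T.𝔤 →ₗ[ℝ] T'.𝔤)) h.injective).eq_iff]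

end Extension

theorem IsModel.isGreatest (h : IsModel c M e) {φ : T.𝔤 →ₗ⁅ℝ⁆ M.𝔤} (hφ : T.IsExtension M φ)
    (hφe : ∀ x, e (φ x) = c.rightField x) : T.IsGreatest M φ := by
  intro T' φ' hφ'
  obtain ⟨ψ, hψe, hψ, hψc⟩ := (h.push hφ').exists_isExtension
  have hψφ (x : T.𝔤) : ψ (φ' x) = φ x :=
    h.isOpposite.injective ((hψe _).trans ((hφ'.push_field c (-1) x).trans (hφe x).symm))
  refine ⟨ψ, hψ, hψφ, hψc, fun ψ' hψ' hψφ' => ?_⟩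
  exact c.hom_ext M.transitivePair.ideal_eq_bot φ' hφ'.injective hφ'.realPoints_le
    hφ'.bijective_quot_realPoints φ hφ.injective hφ.realPoints_le hφ.bijective_quot_realPoints
    (fun x hx => hψ'.realPoints_le hx) (fun x hx => hψ.realPoints_le hx) hψφ' hψφ

theorem IsExtension.id (T : CRAlgebra.{u}) : T.IsExtension T LieHom.id where
  injective := Function.injective_id
  q_le z h := by
    change LinearMap.baseChange ℂ LinearMap.id z ∈ T.q
    rwa [LinearMap.baseChange_id]
  realPoints_le _ h := h
  bijective_quot_realPoints := FormalChart.bijective_mapQ _ (fun _ h => h) fun y =>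
    ⟨y, by simp⟩
  bijective_quot_q := by
    have h1 : ((LieHom.id : T.𝔤 →ₗ⁅ℝ⁆ T.𝔤) : T.𝔤 →ₗ[ℝ] T.𝔤).baseChange ℂ = LinearMap.id :=
      LinearMap.baseChange_id
    refine FormalChart.bijective_mapQ _ (fun z h => ?_) fun z => ⟨z, ?_⟩
    · rwa [h1] at h
    · rw [h1, LinearMap.id_apply, sub_self]
      exact T.q.zero_mem

theorem IsExtension.comp {T' T'' : CRAlgebra.{u}} {φ : T.𝔤 →ₗ⁅ℝ⁆ T'.𝔤} {ψ : T'.𝔤 →ₗ⁅ℝ⁆ T''.𝔤}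
    (hψ : T'.IsExtension T'' ψ) (hφ : T.IsExtension T' φ) : T.IsExtension T'' (ψ.comp φ) := by
  have h1 (z : ℂ ⊗[ℝ] T.𝔤) : (ψ.comp φ : T.𝔤 →ₗ[ℝ] T''.𝔤).baseChange ℂ z =
      (ψ : T'.𝔤 →ₗ[ℝ] T''.𝔤).baseChange ℂ ((φ : T.𝔤 →ₗ[ℝ] T'.𝔤).baseChange ℂ z) :=
    (baseChange_comp_apply _ _ z).symm
  refine ⟨hψ.injective.comp hφ.injective, fun z h => ?_,
    fun _ h => hψ.realPoints_le (hφ.realPoints_le h), ?_, ?_⟩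
  · change (ψ.comp φ : T.𝔤 →ₗ[ℝ] T''.𝔤).baseChange ℂ z ∈ T''.q
    rw [h1]
    exact hψ.q_le (hφ.q_le h)
  · convert hψ.bijective_quot_realPoints.comp hφ.bijective_quot_realPoints
    ext q
    obtain ⟨x, rfl⟩ := Submodule.Quotient.mk_surjective _ q
    rfl
  · convert hψ.bijective_quot_q.comp hφ.bijective_quot_q
    ext q
    obtain ⟨x, rfl⟩ := Submodule.Quotient.mk_surjective _ q
    exact congrArg Submodule.Quotient.mk (h1 x)

theorem IsGreatest.isMaximal {φ : T.𝔤 →ₗ⁅ℝ⁆ M.𝔤} (h : T.IsGreatest M φ)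
    (hφ : T.IsExtension M φ) : M.IsMaximal := by
  intro T' χ hχ
  obtain ⟨ψ, hψ, hψφ, -, -⟩ := h T' (χ.comp φ) (hχ.comp hφ)
  obtain ⟨ρ, -, -, -, hρ⟩ := h M φ hφ
  have h1 : ψ.comp χ = LieHom.id :=
    (hρ _ (hψ.comp hχ) hψφ).trans (hρ _ (.id M) fun _ => rfl).symm
  refine ⟨hχ.injective, fun y => ⟨ψ y, hψ.injective ?_⟩⟩
  exact LieHom.congr_fun h1 (ψ y)

theorem IsExtension.exists_isIso {M' : CRAlgebra.{u}} {ψ : M.𝔤 →ₗ⁅ℝ⁆ M'.𝔤}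
    (h : M.IsExtension M' ψ) (hψ : Function.Bijective ψ) :
    ∃ e : M.𝔤 ≃ₗ⁅ℝ⁆ M'.𝔤, M.IsIso M' e ∧ ∀ x, e x = ψ x :=
  ⟨LieEquiv.ofBijective ψ hψ, fun z => (h.mem_q_iff z).symm, fun _ => rfl⟩

theorem exists_isModel (c : FormalChart (realPoints T.q)) :
    ∃ (M : CRAlgebra.{u}) (e : M.𝔤 →ₗ[ℝ] c.Der), IsModel c M e := by
  let S := c.complexStabilizer (c.complexFormalModule T.q.toSubmodule)
  have hq : ∀ x ∈ realPoints T.q, (1 : ℂ) ⊗ₜ[ℝ] x ∈ T.q := fun _ hx => hx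
  have ht : IsTransitivePair (OppositeLie S) (c.vanishing S) :=
    c.isTransitivePair_vanishing (c.isClosed_complexStabilizer _)
      (c.rightField_mem_complexStabilizer hq)
  let e := OppositeLie.incl S
  let q' : LieSubalgebra ℂ (ℂ ⊗[ℝ] OppositeLie S) :=
    { T.q.toSubmodule.comap (c.value.baseChange ℂ ∘ₗ e.baseChange ℂ) with
      lie_mem' := by
        intro Z W hZ hW
        have hZ : c.value.baseChange ℂ (e.baseChange ℂ Z) ∈ T.q := hZ
        have hW : c.value.baseChange ℂ (e.baseChange ℂ W) ∈ T.q := hW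
        change c.value.baseChange ℂ
          (e.baseChange ℂ (LieAlgebra.ad ℂ (ℂ ⊗[ℝ] OppositeLie S) Z W)) ∈ T.q
        rw [baseChange_ad_of_antihom (OppositeLie.incl_lie S)]
        obtain ⟨a, b, rfl⟩ := exists_eq_complexMk Z
        obtain ⟨x, y, rfl⟩ := exists_eq_complexMk W
        rw [baseChange_complexMk] at hZ hW ⊢
        rw [baseChange_complexMk]
        -- The inclusion reverses brackets, hence the exchanged order of the two hypotheses.
        exact c.complexValue_ad_mem hq (OppositeLie.incl_mem S _) (OppositeLie.incl_mem S _)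
          (OppositeLie.incl_mem S _) (OppositeLie.incl_mem S _) hW hZ }
  have hr : realPoints q' = c.vanishing S := by
    ext x
    have h1 : c.value.baseChange ℂ (e.baseChange ℂ ((1 : ℂ) ⊗ₜ[ℝ] x)) =
        (1 : ℂ) ⊗ₜ[ℝ] c.value (e x) := rfl
    rw [c.mem_vanishing, value_eq_zero_iff]
    exact (Eq.to_iff (congrArg (· ∈ T.q) h1) :)
  refine ⟨{ 𝔤 := OppositeLie S
            q := q'
            isClosed := ?_
            transitivePair := hr ▸ ht }, e, c.isOpposite_incl S,
    fun z => c.exists_value_complexFormalModule_iff.symm⟩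
  have h1 (k : c.ι) : Continuous fun x : OppositeLie S => c.coord k (c.value (e x)) := by
    simp only [c.coord_value]
    exact (VSeries.continuous_coeff_der k 0).comp OppositeLie.isInducing_incl.continuous
  have h2 := c.isClosed_complexMk_mem T.q.toSubmodule (Y := OppositeLie S × OppositeLie S)
    (g := fun p => c.value (e p.1)) (h := fun p => c.value (e p.2)) (fun p => c.value_mem _)
    (fun p => c.value_mem _) (fun k => (h1 k).comp continuous_fst)
    (fun k => (h1 k).comp continuous_snd)
  convert h2 using 1
  ext p
  change c.value.baseChange ℂ (e.baseChange ℂ (complexMk p.1 p.2)) ∈ T.q ↔ _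
  rw [baseChange_complexMk, baseChange_complexMk]
  rfl

theorem exists_realization (c : FormalChart (realPoints T.q)) :
    ∃ (M : CRAlgebra.{u}) (φ : T.𝔤 →ₗ⁅ℝ⁆ M.𝔤) (e : M.𝔤 →ₗ[ℝ] c.Der),
      T.IsExtension M φ ∧ M.IsMaximal ∧ T.IsGreatest M φ ∧
      c.IsOpposite (c.complexStabilizer (c.complexFormalModule T.q.toSubmodule)) e ∧
      (∀ x, e (φ x) = c.rightField x) ∧
      (∀ x, x ∈ realPoints M.q ↔ c.value (e x) = 0) ∧
      (∀ z, z ∈ M.q ↔ ∃ Θ ∈ c.complexFormalModule T.q.toSubmodule,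
        LinearMap.baseChange ℂ c.value (LinearMap.baseChange ℂ e z) =
          LinearMap.baseChange ℂ c.value Θ) := by
  obtain ⟨M, e, hM⟩ := exists_isModel c
  obtain ⟨φ, hφe, hφ, -⟩ := hM.exists_isExtension
  have hg := hM.isGreatest hφ hφe
  exact ⟨M, φ, e, hφ, hg.isMaximal hφ, hg, hM.isOpposite, hφe, hM.mem_realPoints_iff,
    hM.mem_q_iff⟩

theorem exists_isGreatest (T : CRAlgebra.{u}) :
    ∃ (M : CRAlgebra.{u}) (φ : T.𝔤 →ₗ⁅ℝ⁆ M.𝔤),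
      T.IsExtension M φ ∧ M.IsMaximal ∧ T.IsGreatest M φ := by
  have := T.transitivePair.finite_codim
  obtain ⟨c⟩ := FormalChart.exists_formalChart (realPoints T.q)
  obtain ⟨M, φ, -, h1, h2, h3, -⟩ := exists_realization c
  exact ⟨M, φ, h1, h2, h3⟩

theorem IsMaximal.exists_isIso {M' : CRAlgebra.{u}} {φ : T.𝔤 →ₗ⁅ℝ⁆ M.𝔤}
    {φ' : T.𝔤 →ₗ⁅ℝ⁆ M'.𝔤} (hφ : T.IsExtension M φ) (hM : M.IsMaximal)
    (hφ' : T.IsExtension M' φ') (hM' : M'.IsMaximal) :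
    ∃ e : M.𝔤 ≃ₗ⁅ℝ⁆ M'.𝔤, M.IsIso M' e ∧ ∀ x, e (φ x) = φ' x := by
  obtain ⟨N, χ, -, -, hN⟩ := exists_isGreatest T
  obtain ⟨ψ, hψ, hψφ, -, -⟩ := hN M φ hφ
  obtain ⟨ψ', hψ', hψφ', -, -⟩ := hN M' φ' hφ'
  obtain ⟨e, he, heψ⟩ := hψ.exists_isIso (hM N ψ hψ)
  obtain ⟨e', he', heψ'⟩ := hψ'.exists_isIso (hM' N ψ' hψ')
  have hsymm (x : M.𝔤) : e' ((e.trans e'.symm) x) = e x := e'.apply_symm_apply (e x)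
  refine ⟨e.trans e'.symm, fun z => ?_, fun x => ?_⟩
  · have h1 : (e'.toLinearEquiv : M'.𝔤 →ₗ[ℝ] N.𝔤) ∘ₗ
        ((e.trans e'.symm).toLinearEquiv : M.𝔤 →ₗ[ℝ] M'.𝔤) = (e.toLinearEquiv : M.𝔤 →ₗ[ℝ] N.𝔤) :=
      LinearMap.ext hsymm
    rw [he' _, baseChange_comp_apply, h1, he z]
  · exact e'.injective ((hsymm _).trans ((heψ _).trans
      ((hψφ x).trans ((hψφ' x).symm.trans (heψ' _).symm))))

/-- The real parts of the new q contain the isotropy and the image of the real parts of the old q.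
The latter generate the image of T, and the image together with the isotropy is everything. -/
theorem IsFundamental.of_isExtension {φ : T.𝔤 →ₗ⁅ℝ⁆ M.𝔤} (hT : T.IsFundamental)
    (h : T.IsExtension M φ) : M.IsFundamental := by
  have hlc := M.transitivePair.linearlyCompact
  have := hlc.isTopologicalAddGroup
  have := hlc.continuousSMul
  have := M.transitivePair.finite_codim
  have hl : (realPoints M.q).toSubmodule ≤ realParts M.q := fun x hx =>
    ⟨(1 : ℂ) ⊗ₜ[ℝ] x, hx, complexRealPart_one_tmul x⟩
  refine ⟨hlc, isClosed_of_le M.transitivePair.isClosed hl, finiteDimensional_quotient_of_le hl,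
    ?_⟩
  rw [eq_top_iff]
  intro y _
  have h1 : LieSubalgebra.lieSpan ℝ T.𝔤 (realParts T.q : Set T.𝔤) ≤
      (LieSubalgebra.lieSpan ℝ M.𝔤 (realParts M.q : Set M.𝔤)).comap φ := by
    rw [LieSubalgebra.lieSpan_le]
    rintro _ ⟨z, hz, rfl⟩
    refine LieSubalgebra.subset_lieSpan (R := ℝ)
      ⟨(φ : T.𝔤 →ₗ[ℝ] M.𝔤).baseChange ℂ z, h.q_le hz, ?_⟩
    obtain ⟨a, b, rfl⟩ := exists_eq_complexMk z
    rw [baseChange_complexMk, complexRealPart_complexMk, complexRealPart_complexMk]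
  obtain ⟨x, hx⟩ := FormalChart.exists_sub_mem_isot φ h.realPoints_le h.bijective_quot_realPoints y
  have h3 : φ x ∈ LieSubalgebra.lieSpan ℝ M.𝔤 (realParts M.q : Set M.𝔤) :=
    h1 (by rw [hT.generates]; trivial)
  rw [← sub_add_cancel y (φ x)]
  exact add_mem (LieSubalgebra.subset_lieSpan (R := ℝ) (hl hx)) h3

end CRAlgebra

theorem mainTheorem7 :
    -- contact triples
    (∀ T : ContactTriple.{u},
      -- existence of a maximal extension
      (∃ (M : ContactTriple.{u}) (φ : T.𝔤 →ₗ⁅ℝ⁆ M.𝔤),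
        T.IsExtension M φ ∧ M.IsMaximal ∧ T.IsGreatest M φ) ∧
      -- uniqueness up to isomorphism
      (∀ (M M' : ContactTriple.{u}) (φ : T.𝔤 →ₗ⁅ℝ⁆ M.𝔤) (φ' : T.𝔤 →ₗ⁅ℝ⁆ M'.𝔤),
        T.IsExtension M φ → M.IsMaximal → T.IsExtension M' φ' → M'.IsMaximal →
        ∃ e : M.𝔤 ≃ₗ⁅ℝ⁆ M'.𝔤, M.IsIso M' e ∧ ∀ x, e (φ x) = φ' x) ∧
      -- realization by formal vector fields
      (∀ c : FormalChart T.isot,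
        ∃ (M : ContactTriple.{u}) (φ : T.𝔤 →ₗ⁅ℝ⁆ M.𝔤) (e : M.𝔤 →ₗ[ℝ] c.Der),
          T.IsExtension M φ ∧ M.IsMaximal ∧ T.IsGreatest M φ ∧
          c.IsOpposite (c.stabilizer (c.formalModule T.dist)) e ∧
          (∀ x, e (φ x) = c.rightField x) ∧
          (∀ x, x ∈ M.isot ↔ c.value (e x) = 0) ∧
          (∀ x, x ∈ M.dist ↔ ∃ Θ ∈ c.formalModule T.dist, c.value (e x) = c.value Θ))) ∧
    -- CR algebras
    (∀ T : CRAlgebra.{u},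
      -- existence of a maximal extension
      (∃ (M : CRAlgebra.{u}) (φ : T.𝔤 →ₗ⁅ℝ⁆ M.𝔤),
        T.IsExtension M φ ∧ M.IsMaximal ∧ T.IsGreatest M φ) ∧
      -- uniqueness up to isomorphism
      (∀ (M M' : CRAlgebra.{u}) (φ : T.𝔤 →ₗ⁅ℝ⁆ M.𝔤) (φ' : T.𝔤 →ₗ⁅ℝ⁆ M'.𝔤),
        T.IsExtension M φ → M.IsMaximal → T.IsExtension M' φ' → M'.IsMaximal →
        ∃ e : M.𝔤 ≃ₗ⁅ℝ⁆ M'.𝔤, M.IsIso M' e ∧ ∀ x, e (φ x) = φ' x) ∧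
      -- extensions of fundamental CR algebras are fundamental
      (T.IsFundamental → ∀ (M : CRAlgebra.{u}) (φ : T.𝔤 →ₗ⁅ℝ⁆ M.𝔤), T.IsExtension M φ →
        M.IsFundamental) ∧
      -- realization by formal vector fields
      (∀ c : FormalChart (realPoints T.q),
        ∃ (M : CRAlgebra.{u}) (φ : T.𝔤 →ₗ⁅ℝ⁆ M.𝔤) (e : M.𝔤 →ₗ[ℝ] c.Der),
          T.IsExtension M φ ∧ M.IsMaximal ∧ T.IsGreatest M φ ∧
          c.IsOpposite (c.complexStabilizer (c.complexFormalModule T.q.toSubmodule)) e ∧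
          (∀ x, e (φ x) = c.rightField x) ∧
          (∀ x, x ∈ realPoints M.q ↔ c.value (e x) = 0) ∧
          (∀ z, z ∈ M.q ↔ ∃ Θ ∈ c.complexFormalModule T.q.toSubmodule,
            LinearMap.baseChange ℂ c.value (LinearMap.baseChange ℂ e z) =
              LinearMap.baseChange ℂ c.value Θ))) :=
  ⟨fun T => ⟨T.exists_isGreatest, fun _ _ _ _ hφ hM hφ' hM' => hM.exists_isIso hφ hφ' hM',
    fun c => ContactTriple.exists_realization c⟩,
  fun T => ⟨T.exists_isGreatest, fun _ _ _ _ hφ hM hφ' hM' => hM.exists_isIso hφ hφ' hM',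
    fun hT _ _ h => hT.of_isExtension h, fun c => CRAlgebra.exists_realization c⟩⟩

end
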